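/- For every $n\ge 1$ let $X=X_n$ be an $n\times n$ complex Ginibre matrix, i.e. a random matrix with independent entries, each distributed as $n^{-1/2}\chi$, where $\chi$ is a standard complex Gaussian (real and imaginary parts independent, centred, of variance $1/2$). Let $\sigma_1,\dots,\sigma_n$ be its eigenvalues, counted with algebraic multiplicity and labelled so that $|\sigma_1|\ge|\sigma_2|\ge\dots\ge|\sigma_n|$ (ties broken arbitrarily), let $\arg$ take values in $[0,2\pi)$, and set $\gamma_n:=\log n-2\log\log n-\log 2\pi$ (which is positive for all large $n$). (i) For all fixed $r\in\mathbb R$ and $\theta\in[0,2\pi)$, $$\lim_{n\to\infty}\mathbf P\Big(|\sigma_1|\le 1+\sqrt{\frac{\gamma_n}{4n}}+\frac{r}{\sqrt{4n\gamma_n}},\ 0\le\arg(\sigma_1)\le\theta\Big)=\frac{\theta}{2\pi}\,e^{-e^{-r}}.$$ (ii) Rescale the eigenvalues as $$\sigma_j=e^{i\theta_j}\Big(1+\sqrt{\frac{\gamma_n}{4n}}+\frac{r_j}{\sqrt{4n\gamma_n}}\Big),\qquad \theta_j=\arg(\sigma_j)\in[0,2\pi),\quad r_j=\sqrt{4n\gamma_n}\Big(|\sigma_j|-1-\sqrt{\frac{\gamma_n}{4n}}\Big)\in\mathbb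 R.$$ Then for every $t\in\mathbb R$ and every non-negative $g\in C^2_c(\mathbb C)$ supported on $\{z=re^{i\theta}: r\in[t,\infty),\ \theta\in[0,2\pi)\}$, $$\lim_{n\to\infty}\mathbf E\Big[e^{-\sum_{j=1}^n g(r_je^{i\theta_j})}\Big]=\exp\Big(-\int_0^{2\pi}\int_{\mathbb R}\big(1-e^{-g(re^{i\theta})}\big)\frac{e^{-r}}{2\pi}\,dr\,d\theta\Big).$$ -/

import Mathlib

open MeasureTheory ProbabilityTheory Filter Topology

noncomputable section

/-- The standard complex Gaussian distribution: the law of `x + i y` with `x`, `y` independent real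
centred Gaussians of variance `1/2`, so that `E χ = 0`, `E |χ|² = 1` and `E χ² = 0`. -/
def stdComplexGaussian : Measure ℂ :=
  ((gaussianReal 0 (1 / 2)).prod (gaussianReal 0 (1 / 2))).map
    (fun p : ℝ × ℝ => (p.1 : ℂ) + (p.2 : ℂ) * Complex.I)

/-- `X` is an `n × n` complex i.i.d. matrix for the entry distribution `μ`: the entries of `X` are
independent, and each of them is distributed as `n ^ (-1/2) χ`, where `χ` has law `μ`. -/
structure IsComplexIIDMatrix {Ω : Type*} [MeasurableSpace Ω] (μ : Measure ℂ) (P : Measure Ω)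
    {n : ℕ} (X : Ω → Matrix (Fin n) (Fin n) ℂ) : Prop where
  indep : iIndepFun (fun (ab : Fin n × Fin n) (ω : Ω) => X ω ab.1 ab.2) P
  law : ∀ a b : Fin n,
    HasLaw (fun ω => X ω a b) (μ.map fun z : ℂ => z / (Real.sqrt (n : ℝ) : ℂ)) P

/-- `X` is an `n × n` complex Ginibre matrix. -/
def IsComplexGinibre {Ω : Type*} [MeasurableSpace Ω] (P : Measure Ω)
    {n : ℕ} (X : Ω → Matrix (Fin n) (Fin n) ℂ) : Prop :=
  IsComplexIIDMatrix stdComplexGaussian P X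

/-- `s 1, …, s n` are the eigenvalues of the `n × n` matrix `A`, with algebraic multiplicity,
labelled so that `|s 1| ≥ |s 2| ≥ … ≥ |s n|`. (The values of `s` outside `{1, …, n}` play no
role, and neither does the order among eigenvalues of equal modulus.) -/
structure IsOrderedSpectrum {n : ℕ} (A : Matrix (Fin n) (Fin n) ℂ) (s : ℕ → ℂ) : Prop where
  roots_eq : A.charpoly.roots = (Finset.Icc 1 n).val.map s
  norm_anti : ∀ i j : ℕ, 1 ≤ i → i ≤ j → j ≤ n → ‖s j‖ ≤ ‖s i‖

/-- The argument of a complex number, normalised to lie in `[0, 2π)`. -/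
def argTwoPi (z : ℂ) : ℝ :=
  if 0 ≤ z.arg then z.arg else z.arg + 2 * Real.pi

/-- `γ_n = log n - 2 log log n - log (2π)`, which is positive for all large `n`. -/
def gammaSeq (n : ℕ) : ℝ :=
  Real.log n - 2 * Real.log (Real.log n) - Real.log (2 * Real.pi)

/-- The radius `1 + √(γ_n / (4n)) + r / √(4 n γ_n)` at the rescaled position `r`. -/
def scaledRadius (n : ℕ) (r : ℝ) : ℝ :=
  1 + Real.sqrt (gammaSeq n / (4 * n)) + r / Real.sqrt (4 * n * gammaSeq n)

/-- The rescaled modulus of `z`: the real number `r` such that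
`|z| = 1 + √(γ_n / (4n)) + r / √(4 n γ_n)`, for all `n` with `γ_n > 0`. -/
def rescaledModulus (n : ℕ) (z : ℂ) : ℝ :=
  Real.sqrt (4 * n * gammaSeq n) * (‖z‖ - 1 - Real.sqrt (gammaSeq n / (4 * n)))

/-- The point of the plane with (real, possibly negative) radial coordinate `r` and angle `θ`. -/
def polarPoint (r θ : ℝ) : ℂ :=
  (r : ℂ) * Complex.exp ((θ : ℂ) * Complex.I)

end

/-! Multiply the matrix by `√n`, so that its entries are standard complex Gaussians. The eigenvalues
then form a determinantal point process. The proof has three ingredients: the joint density of the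
eigenvalues, a determinant formula for multiplicative statistics, and the asymptotics of the
one-point intensity.

Joint density. A matrix of size `m + 1` is parametrised by an eigenvalue `l`, an eigenvector `(1,
w)`, the rest `b` of its first row and the compression `M` to the quotient (`deflate`). The Jacobian
is `|det (l - M)|²`, and the Gaussian weight factors after `b` and `w` are integrated out
(`frobSq_deflate`, `lintegral_peelKernel`). The parametrisation is injective where `l` strictly
dominates the spectrum of `M` (`injOn_eigenCol`), which gives an inequality between integrals
(`matGauss_succ_ge`). By induction the law of the spectrum is bounded below by the Vandermonde
density `vdmWeight` (`coulomb_le_matGauss`). Surjectivity is never needed: the two total masses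
agree, so the inequality for `F` and for `1 - F` forces equality (`matGauss_eq_coulomb`).

Determinants. By Andréief's identity `E ∏ (1 - f(z_j)) = det (1 - K)`, where `K` is multiplication
by `f` compressed to the span of `n` orthonormal functions `z^j e^(-|z|²/2)` (`coulomb_prod`). If
`f` lives outside a disc slightly larger than the one carrying the bulk, Chebyshev's inequality
bounds every eigenvalue of `K` by a quantity tending to zero, so `det (1 - K)` behaves like `exp
(-tr K)` (`tendsto_det_one_sub`).

Intensity. The trace is an integral of `f` against `π⁻¹` times the probability that a Poisson
variable of parameter `|z|²` is below `n`. Sharp two-sided tail bounds and Stirling's formula show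
that, in the rescaled coordinates, this intensity tends to `e^(-r) dr dθ / 2π`; the sequence `γ_n`
is exactly what makes the constant one (`tendsto_poissonCdf`). An exponential bound allows dominated
convergence (`tendsto_det_polar`).

The Laplace functional is the case `1 - f = e^(-g)`. For the largest eigenvalue, the indicator of a
disc gives the Gumbel law of the modulus (`tendsto_disc`), and rotation invariance of the density
makes the argument uniform and independent of the modulus (`coulomb_topInd_sector`). -/

/-! ### The spectrum as a multiset, and measurability of its symmetric functions -/

/-- The multiset of the values of a tuple. -/
def tupleMultiset {n : ℕ} (z : Fin n → ℂ) : Multiset ℂ := Finset.univ.val.map z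

/-- The eigenvalues, with algebraic multiplicity, of the matrix with entries `x i j`. -/
noncomputable def spec {n : ℕ} (x : Fin n → Fin n → ℂ) : Multiset ℂ :=
  (Matrix.of x).charpoly.roots

theorem measurable_coeff_prod_X_sub_C {n : ℕ} (s : Finset (Fin n)) (k : ℕ) :
    Measurable fun z : Fin n → ℂ => (∏ i ∈ s, (Polynomial.X - Polynomial.C (z i))).coeff k := by
  classical
  induction s using Finset.induction_on generalizing k with
  | empty => simp
  | insert a s ha ih =>
    simp only [Finset.prod_insert ha, Polynomial.coeff_mul]
    refine Finset.measurable_sum _ fun p _ => Measurable.mul ?_ (ih _)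
    simp only [Polynomial.coeff_sub, Polynomial.coeff_C]
    split_ifs <;> fun_prop

/-- Specialising the universal characteristic polynomial shows that each coefficient is a polynomial
in the entries. -/
theorem measurable_coeff_charpoly {n : ℕ} (k : ℕ) :
    Measurable fun x : Fin n → Fin n → ℂ => (Matrix.of x).charpoly.coeff k := by
  have h : ∀ x : Fin n → Fin n → ℂ, (Matrix.of x).charpoly.coeff k =
      MvPolynomial.eval (fun p : Fin n × Fin n => x p.1 p.2)
        ((Matrix.charpoly.univ ℂ (Fin n)).coeff k) := by
    intro x
    have := Matrix.charpoly.univ_map_eval₂Hom (Fin n) (RingHom.id ℂ) (Function.uncurry x)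
    rw [Function.curry_uncurry] at this
    rw [← this, Polynomial.coeff_map]
    rfl
  simp only [h]
  exact ((MvPolynomial.continuous_eval _).comp (by fun_prop)).measurable

/-- The monic polynomial of degree `n` with the given lower coefficients. -/
noncomputable def monicOfCoeff {n : ℕ} (c : Fin n → ℂ) : Polynomial ℂ :=
  Polynomial.X ^ n + ∑ k : Fin n, Polynomial.C (c k) * Polynomial.X ^ (k : ℕ)

theorem monicOfCoeff_coeff {n : ℕ} {p : Polynomial ℂ} (hp : p.Monic) (hn : p.natDegree = n) :
    monicOfCoeff (fun k : Fin n => p.coeff k) = p := by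
  conv_rhs => rw [hp.as_sum, hn]
  rw [monicOfCoeff, Fin.sum_univ_eq_sum_range
    (fun k => Polynomial.C (p.coeff k) * Polynomial.X ^ k)]

theorem monicOfCoeff_degree {n : ℕ} (c : Fin n → ℂ) :
    (∑ k : Fin n, Polynomial.C (c k) * Polynomial.X ^ (k : ℕ)).degree <
      (n : WithBot ℕ) := by
  refine (Polynomial.degree_sum_le _ _).trans_lt ?_
  rw [Finset.sup_lt_iff (WithBot.bot_lt_coe _)]
  intro k _
  refine (Polynomial.degree_C_mul_X_pow_le _ _).trans_lt ?_
  exact_mod_cast k.2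

theorem monicOfCoeff_monic {n : ℕ} (c : Fin n → ℂ) : (monicOfCoeff c).Monic :=
  Polynomial.monic_X_pow_add (monicOfCoeff_degree c)

theorem monicOfCoeff_natDegree {n : ℕ} (c : Fin n → ℂ) : (monicOfCoeff c).natDegree = n :=
  Polynomial.natDegree_eq_of_degree_eq_some (by
    rw [monicOfCoeff, Polynomial.degree_add_eq_left_of_degree_lt] <;>
      rw [Polynomial.degree_X_pow]
    exact monicOfCoeff_degree c)

theorem exists_tupleMultiset {n : ℕ} (s : Multiset ℂ) (hs : s.card = n) :
    ∃ z : Fin n → ℂ, tupleMultiset z = s := by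
  subst hs
  refine ⟨fun i => s.toList.get (i.cast (by simp)), ?_⟩
  conv_rhs => rw [← s.coe_toList]
  rw [tupleMultiset, Fin.univ_val_map, Multiset.coe_eq_coe]
  refine List.Perm.of_eq (List.ext_get (by simp) ?_)
  intro i h1 h2
  simp

theorem roots_tuple_prod {n : ℕ} (z : Fin n → ℂ) :
    (∏ i, (Polynomial.X - Polynomial.C (z i))).roots = tupleMultiset z := by
  have : ∏ i, (Polynomial.X - Polynomial.C (z i)) =
      ((tupleMultiset z).map fun a => Polynomial.X - Polynomial.C a).prod := by
    rw [tupleMultiset, Multiset.map_map]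
    rfl
  rw [this, Polynomial.roots_multiset_prod_X_sub_C]

theorem card_roots_of_monic {n : ℕ} {p : Polynomial ℂ} (hn : p.natDegree = n) :
    p.roots.card = n := by
  rw [← hn]
  exact (IsAlgClosed.splits p).natDegree_eq_card_roots.symm

theorem card_spec {n : ℕ} (x : Fin n → Fin n → ℂ) : (spec x).card = n :=
  card_roots_of_monic (by simp [Matrix.charpoly_natDegree_eq_dim])

/-- A function of `n` points that does not depend on their order and is measurable on tuples is
measurable as a function of the coefficients of the polynomial with these roots. -/
theorem measurable_roots_monicOfCoeff {α : Type*} [MeasurableSpace α] [StandardBorelSpace α]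
    {n : ℕ} {F : α → Multiset ℂ → ENNReal}
    (hF : Measurable fun p : α × (Fin n → ℂ) => F p.1 (tupleMultiset p.2)) :
    Measurable fun p : α × (Fin n → ℂ) => F p.1 (monicOfCoeff p.2).roots := by
  let f : α × (Fin n → ℂ) → α × (Fin n → ℂ) := fun p =>
    (p.1, fun k => (∏ i, (Polynomial.X - Polynomial.C (p.2 i))).coeff k)
  have hmon : ∀ z : Fin n → ℂ, (∏ i, (Polynomial.X - Polynomial.C (z i))).Monic :=
    fun z => Polynomial.monic_prod_of_monic _ _ fun i _ => Polynomial.monic_X_sub_C _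
  have hdeg : ∀ z : Fin n → ℂ, (∏ i, (Polynomial.X - Polynomial.C (z i))).natDegree = n := by
    intro z
    rw [Polynomial.natDegree_prod_of_monic _ _ fun i _ => Polynomial.monic_X_sub_C _]
    simp
  have hf : Measurable f := by
    refine measurable_fst.prodMk (measurable_pi_lambda _ fun k => ?_)
    exact (measurable_coeff_prod_X_sub_C Finset.univ (k : ℕ)).comp
      (measurable_snd (α := α) (β := Fin n → ℂ))
  have hsurj : Function.Surjective f := by
    rintro ⟨a, c⟩
    obtain ⟨z, hz⟩ := exists_tupleMultiset (monicOfCoeff c).roots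
      (card_roots_of_monic (monicOfCoeff_natDegree c))
    refine ⟨(a, z), Prod.ext rfl ?_⟩
    have hp : ∏ i, (Polynomial.X - Polynomial.C (z i)) = monicOfCoeff c := by
      have := (IsAlgClosed.splits (monicOfCoeff c)).eq_prod_roots_of_monic (monicOfCoeff_monic c)
      rw [this, ← hz, tupleMultiset, Multiset.map_map]
      rfl
    funext k
    simp only [f, hp]
    rw [monicOfCoeff, Polynomial.coeff_add, Polynomial.coeff_X_pow, if_neg k.2.ne]
    simp [Polynomial.coeff_X_pow, Fin.val_inj]
  -- No measurable choice of roots is made. A measurable surjection out of a standard Borel space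
  -- detects measurability, so it suffices to compose with the map from roots to coefficients, where
  -- the function is measurable by assumption.
  refine (hf.measurable_comp_iff_of_surjective hsurj).1 ?_
  convert hF using 2 with p
  simp only [Function.comp, f]
  rw [monicOfCoeff_coeff (hmon _) (hdeg _), roots_tuple_prod]

/-- The parameter in `α` is there for functions that depend jointly on a matrix and on an eigenvalue
already split off. -/
theorem measurable_spec {α : Type*} [MeasurableSpace α] [StandardBorelSpace α]
    {n : ℕ} {F : α → Multiset ℂ → ENNReal}
    (hF : Measurable fun p : α × (Fin n → ℂ) => F p.1 (tupleMultiset p.2)) :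
    Measurable fun p : α × (Fin n → Fin n → ℂ) => F p.1 (spec p.2) := by
  have hc : Measurable fun p : α × (Fin n → Fin n → ℂ) =>
      (p.1, fun k : Fin n => (Matrix.of p.2).charpoly.coeff k) := by
    refine measurable_fst.prodMk (measurable_pi_lambda _ fun k => ?_)
    exact (measurable_coeff_charpoly (n := n) (k : ℕ)).comp
      (measurable_snd (α := α) (β := Fin n → Fin n → ℂ))
  convert (measurable_roots_monicOfCoeff hF).comp hc using 2 with p
  simp only [Function.comp, spec]
  rw [monicOfCoeff_coeff (Matrix.charpoly_monic _) (by simp [Matrix.charpoly_natDegree_eq_dim])]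

attribute [irreducible] spec

/-! ### Frobenius norm and deflation by an eigenvector -/

/-- The square of the Frobenius norm. -/
noncomputable def frobSq {k l : Type*} [Fintype k] [Fintype l] (A : Matrix k l ℂ) : ℝ :=
  ∑ i, ∑ j, ‖A i j‖ ^ 2

theorem frobSq_eq_trace {k l : Type*} [Fintype k] [Fintype l] (A : Matrix k l ℂ) :
    (frobSq A : ℂ) = (A.conjTranspose * A).trace := by
  simp only [frobSq, Matrix.trace, Matrix.diag, Matrix.mul_apply, Matrix.conjTranspose_apply]
  push_cast
  rw [Finset.sum_comm]
  refine Finset.sum_congr rfl fun i _ => Finset.sum_congr rfl fun j _ => ?_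
  rw [RCLike.star_def, RCLike.conj_mul]
  rfl

theorem frobSq_fromBlocks {k l : Type*} [Fintype k] [Fintype l] (A : Matrix k k ℂ)
    (B : Matrix k l ℂ) (C : Matrix l k ℂ) (D : Matrix l l ℂ) :
    frobSq (Matrix.fromBlocks A B C D) = frobSq A + frobSq B + (frobSq C + frobSq D) := by
  simp only [frobSq, Fintype.sum_sum_type, Matrix.fromBlocks_apply₁₁, Matrix.fromBlocks_apply₁₂,
    Matrix.fromBlocks_apply₂₁, Matrix.fromBlocks_apply₂₂, Finset.sum_add_distrib]
  ring

/-- With `Q = G* G`, the squared norm of `G T G⁻¹` is `tr (T* Q T Q⁻¹)`, which sees `G` only through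
`Q`. This lets a lower triangular conjugation be traded for an upper triangular one. -/
theorem frobSq_conj {k : Type*} [Fintype k] [DecidableEq k] {G G' R R' : Matrix k k ℂ}
    (hG : G * G' = 1) (hR : R * R' = 1)
    (h : G.conjTranspose * G = R.conjTranspose * R) (T : Matrix k k ℂ) :
    frobSq (G * T * G') = frobSq (R * T * R') := by
  have key : ∀ {K K' : Matrix k k ℂ}, K * K' = 1 →
      (frobSq (K * T * K') : ℂ) =
        (T.conjTranspose * (K.conjTranspose * K) * T * (K.conjTranspose * K)⁻¹).trace := by
    intro K K' hK
    have hinv : (K.conjTranspose * K)⁻¹ = K' * K'.conjTranspose := by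
      refine Matrix.inv_eq_right_inv ?_
      rw [Matrix.mul_assoc, ← Matrix.mul_assoc K, hK, Matrix.one_mul,
        ← Matrix.conjTranspose_mul, mul_eq_one_comm.1 hK, Matrix.conjTranspose_one]
    rw [frobSq_eq_trace, hinv, Matrix.conjTranspose_mul, Matrix.conjTranspose_mul,
      Matrix.mul_assoc, Matrix.trace_mul_comm]
    simp only [Matrix.mul_assoc]
  have := (key hG).trans ((congrArg (fun Q => (T.conjTranspose * Q * T * Q⁻¹).trace) h).trans
    (key hR).symm)
  exact_mod_cast this

section Blocks

variable {m : ℕ}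

/-- The `(m + 1) × (m + 1)` matrix with blocks `a`, `b`, `c`, `Y`. -/
def blk (a : ℂ) (b c : Fin m → ℂ) (Y : Fin m → Fin m → ℂ) : Fin (m + 1) → Fin (m + 1) → ℂ :=
  Fin.cons (Fin.cons a b : Fin (m + 1) → ℂ) (fun i => (Fin.cons (c i) (Y i) : Fin (m + 1) → ℂ))

/-- Rows and columns as block indices. -/
def blkEquiv (m : ℕ) : Fin 1 ⊕ Fin m ≃ Fin (m + 1) :=
  finSumFinEquiv.trans (finCongr (add_comm 1 m))

theorem blkEquiv_inl (i : Fin 1) : blkEquiv m (Sum.inl i) = 0 := by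
  ext; simp [blkEquiv]

theorem blkEquiv_inr (i : Fin m) : blkEquiv m (Sum.inr i) = i.succ := by
  ext; simp [blkEquiv]

/-- A vector as a column. -/
def colMat (c : Fin m → ℂ) : Matrix (Fin m) (Fin 1) ℂ := Matrix.of fun i _ => c i

/-- A vector as a row. -/
def rowMat (b : Fin m → ℂ) : Matrix (Fin 1) (Fin m) ℂ := Matrix.of fun _ i => b i

theorem of_blk (a : ℂ) (b c : Fin m → ℂ) (Y : Fin m → Fin m → ℂ) :
    Matrix.of (blk a b c Y) = Matrix.reindex (blkEquiv m) (blkEquiv m)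
      (Matrix.fromBlocks (Matrix.of fun _ _ => a) (rowMat b) (colMat c) (Matrix.of Y)) := by
  ext i j
  obtain ⟨i, rfl⟩ := (blkEquiv m).surjective i
  obtain ⟨j, rfl⟩ := (blkEquiv m).surjective j
  rw [Matrix.reindex_apply, Matrix.submatrix_apply, Equiv.symm_apply_apply,
    Equiv.symm_apply_apply]
  rcases i with i | i <;> rcases j with j | j <;>
    simp [blkEquiv_inl, blkEquiv_inr, blk, rowMat, colMat]

theorem frobSq_reindex {k l : Type*} [Fintype k] [Fintype l] (e : k ≃ l) (A : Matrix k k ℂ) :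
    frobSq (Matrix.reindex e e A) = frobSq A := by
  simp only [frobSq, Matrix.reindex_apply, Matrix.submatrix_apply]
  rw [← e.sum_comp]
  refine Finset.sum_congr rfl fun i _ => ?_
  rw [← e.sum_comp]
  simp

/-- The matrix with eigenvalue `l` and eigenvector `(1, w)` whose compression to the quotient by
this vector is `M`. -/
def deflate (l : ℂ) (w b : Fin m → ℂ) (M : Fin m → Fin m → ℂ) : Fin (m + 1) → Fin (m + 1) → ℂ :=
  blk (l - ∑ i, b i * w i) b
    (fun i => l * w i - ∑ j, (M i j + w i * b j) * w j) (fun i j => M i j + w i * b j)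

/-- The shear with first column `(1, w)` conjugates a block upper triangular matrix with diagonal
blocks `l` and `M` into `deflate l w b M`; spectrum and norm are read off from this form. -/
theorem deflate_eq (l : ℂ) (w b : Fin m → ℂ) (M : Fin m → Fin m → ℂ) :
    Matrix.of (deflate l w b M) = Matrix.reindex (blkEquiv m) (blkEquiv m)
      (Matrix.fromBlocks 1 0 (colMat w) 1 *
        Matrix.fromBlocks (Matrix.of fun _ _ => l) (rowMat b) 0 (Matrix.of M) *
        Matrix.fromBlocks 1 0 (-colMat w) 1) := by
  rw [deflate, of_blk, Matrix.fromBlocks_multiply, Matrix.fromBlocks_multiply]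
  congr 2
  · ext i j
    simp [Matrix.mul_apply, rowMat, colMat, sub_eq_add_neg]
  · simp
  · ext i j
    simp [Matrix.mul_apply, Matrix.add_apply, rowMat, colMat]
    ring_nf
  · ext i j
    simp [Matrix.mul_apply, rowMat, colMat, add_comm]

theorem lower_mul_lower (w : Matrix (Fin m) (Fin 1) ℂ) :
    Matrix.fromBlocks (1 : Matrix (Fin 1) (Fin 1) ℂ) 0 w (1 : Matrix (Fin m) (Fin m) ℂ) *
      Matrix.fromBlocks 1 0 (-w) 1 = 1 := by
  rw [Matrix.fromBlocks_multiply]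
  simp

theorem charpoly_conj {k : Type*} [Fintype k] [DecidableEq k] {G G' : Matrix k k ℂ}
    (h : G * G' = 1) (T : Matrix k k ℂ) : (G * T * G').charpoly = T.charpoly := by
  have h2 := Matrix.charpoly_units_conj (Units.mkOfMulEqOne G G' h) T
  rwa [Units.val_mkOfMulEqOne, Matrix.inv_eq_right_inv h] at h2

theorem charpoly_deflate (l : ℂ) (w b : Fin m → ℂ) (M : Fin m → Fin m → ℂ) :
    (Matrix.of (deflate l w b M)).charpoly =
      (Polynomial.X - Polynomial.C l) * (Matrix.of M).charpoly := by
  rw [deflate_eq, Matrix.charpoly_reindex, charpoly_conj (lower_mul_lower _),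
    Matrix.charpoly_fromBlocks_zero₂₁]
  congr 1
  simp [Matrix.charpoly, Matrix.charmatrix]

theorem spec_deflate (l : ℂ) (w b : Fin m → ℂ) (M : Fin m → Fin m → ℂ) :
    spec (deflate l w b M) = l ::ₘ spec M := by
  rw [spec, charpoly_deflate, Polynomial.roots_mul, Polynomial.roots_X_sub_C, spec]
  · rfl
  · exact mul_ne_zero (Polynomial.X_sub_C_ne_zero l) (Matrix.charpoly_monic _).ne_zero

theorem spec_conj {S S' : Matrix (Fin m) (Fin m) ℂ} (h : S * S' = 1) (M : Fin m → Fin m → ℂ) :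
    spec (S * Matrix.of M * S') = spec M := by
  unfold spec
  exact congrArg Polynomial.roots (charpoly_conj h (Matrix.of M))

/-- `√(1 + |w|²)` -/
noncomputable def vecRad (w : Fin m → ℂ) : ℝ := Real.sqrt (1 + ∑ i, ‖w i‖ ^ 2)

theorem vecRad_sq (w : Fin m → ℂ) : vecRad w ^ 2 = 1 + ∑ i, ‖w i‖ ^ 2 :=
  Real.sq_sqrt (by positivity)

theorem vecRad_pos (w : Fin m → ℂ) : 0 < vecRad w := Real.sqrt_pos.2 (by positivity)

/-- The positive square root of `1 - w w* / (1 + |w|²)`. -/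
noncomputable def shrink (w : Fin m → ℂ) : Matrix (Fin m) (Fin m) ℂ :=
  1 - (1 / (vecRad w * (vecRad w + 1)) : ℂ) • (colMat w * (colMat w).conjTranspose)

/-- The inverse of `shrink w`. -/
noncomputable def stretch (w : Fin m → ℂ) : Matrix (Fin m) (Fin m) ℂ :=
  1 + (1 / (vecRad w + 1) : ℂ) • (colMat w * (colMat w).conjTranspose)

theorem colMat_conj_mul (w : Fin m → ℂ) :
    (colMat w).conjTranspose * colMat w = ((vecRad w : ℂ) ^ 2 - 1) • 1 := by
  have h := congrArg (fun x : ℝ => (x : ℂ)) (vecRad_sq w)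
  push_cast at h
  ext i j
  rw [Matrix.mul_apply, h, Subsingleton.elim i j]
  simp [colMat, RCLike.conj_mul]

theorem colMat_sq (w : Fin m → ℂ) :
    (colMat w * (colMat w).conjTranspose) * (colMat w * (colMat w).conjTranspose) =
      ((vecRad w : ℂ) ^ 2 - 1) • (colMat w * (colMat w).conjTranspose) := by
  rw [Matrix.mul_assoc, ← Matrix.mul_assoc _ (colMat w), colMat_conj_mul]
  simp

theorem vecRad_ne (w : Fin m → ℂ) : (vecRad w : ℂ) ≠ 0 := by
  exact_mod_cast (vecRad_pos w).ne'

theorem vecRad_add_one_ne (w : Fin m → ℂ) : (vecRad w + 1 : ℂ) ≠ 0 := by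
  have := vecRad_pos w
  exact_mod_cast (by positivity : vecRad w + 1 ≠ 0)

theorem one_add_smul_mul (w : Fin m → ℂ) (x y : ℂ) :
    (1 + x • (colMat w * (colMat w).conjTranspose)) *
      (1 + y • (colMat w * (colMat w).conjTranspose)) =
    1 + (x + y + x * y * ((vecRad w : ℂ) ^ 2 - 1)) • (colMat w * (colMat w).conjTranspose) := by
  rw [Matrix.mul_add, Matrix.add_mul, Matrix.add_mul, Matrix.smul_mul,
    Matrix.smul_mul, Matrix.mul_smul, Matrix.mul_smul, colMat_sq, Matrix.one_mul, Matrix.mul_one,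
    Matrix.one_mul]
  module

theorem shrink_mul_stretch (w : Fin m → ℂ) : shrink w * stretch w = 1 := by
  have h0 := vecRad_ne w
  have h1 := vecRad_add_one_ne w
  rw [shrink, stretch, sub_eq_add_neg, ← neg_smul, one_add_smul_mul, add_eq_left]
  convert zero_smul ℂ _
  field_simp
  ring

theorem shrink_conjTranspose (w : Fin m → ℂ) : (shrink w).conjTranspose = shrink w := by
  simp [shrink, Matrix.conjTranspose_sub, Matrix.conjTranspose_smul, Matrix.conjTranspose_mul]

theorem shrink_sq (w : Fin m → ℂ) : shrink w * shrink w =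
    1 - (1 / (vecRad w : ℂ) ^ 2) • (colMat w * (colMat w).conjTranspose) := by
  have h0 := vecRad_ne w
  have h1 := vecRad_add_one_ne w
  rw [shrink, sub_eq_add_neg, ← neg_smul, one_add_smul_mul, sub_eq_add_neg (1 : Matrix (Fin m) (Fin m) ℂ), ← neg_smul]
  congr 2
  field_simp
  ring

theorem det_stretch (w : Fin m → ℂ) : (stretch w).det = vecRad w := by
  have h1 := vecRad_add_one_ne w
  rw [stretch, ← Matrix.mul_smul, Matrix.det_one_add_mul_comm, Matrix.smul_mul,
    colMat_conj_mul]
  simp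
  field_simp
  ring

/-- The part of the upper right block of the triangular form that does not involve `b`. -/
noncomputable def shiftRow (l : ℂ) (w : Fin m → ℂ) (M : Fin m → Fin m → ℂ) :
    Matrix (Fin 1) (Fin m) ℂ :=
  (1 / (vecRad w : ℂ)) • ((colMat w).conjTranspose * Matrix.of M - l • (colMat w).conjTranspose)

/-- The shear `G` of `deflate_eq` has a Cholesky-type factor `R`, block upper triangular with `R* R
= G* G`. Conjugating by `R` instead of `G` preserves the norm and keeps the zero lower left block,
so the norm splits over the blocks. The row `b` enters one block only, through an affine map, which
makes its integral Gaussian. -/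
theorem frobSq_deflate (l : ℂ) (w b : Fin m → ℂ) (M : Fin m → Fin m → ℂ) :
    frobSq (Matrix.of (deflate l w b M)) = ‖l‖ ^ 2 +
      frobSq (((vecRad w : ℂ) • rowMat b + shiftRow l w M) * stretch w) +
      frobSq (shrink w * Matrix.of M * stretch w) := by
  have h0 := vecRad_ne w
  have h1 := vecRad_add_one_ne w
  set r : ℂ := (vecRad w : ℂ) with hr
  set W := colMat w with hW
  let R : Matrix (Fin 1 ⊕ Fin m) (Fin 1 ⊕ Fin m) ℂ :=
    Matrix.fromBlocks (r • 1) ((1 / r) • W.conjTranspose) 0 (shrink w)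
  let R' : Matrix (Fin 1 ⊕ Fin m) (Fin 1 ⊕ Fin m) ℂ :=
    Matrix.fromBlocks ((1 / r) • 1) (-(1 / r ^ 2) • (W.conjTranspose * stretch w)) 0 (stretch w)
  have hRR : R * R' = 1 := by
    rw [Matrix.fromBlocks_multiply, shrink_mul_stretch]
    simp [smul_smul, h0, pow_two]
  have hGR : (Matrix.fromBlocks 1 0 W 1 : Matrix (Fin 1 ⊕ Fin m) (Fin 1 ⊕ Fin m) ℂ).conjTranspose *
      Matrix.fromBlocks 1 0 W 1 = R.conjTranspose * R := by
    have hrs : star r = r := by simp [hr]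
    simp only [R, Matrix.fromBlocks_conjTranspose, Matrix.fromBlocks_multiply, shrink_conjTranspose,
      shrink_sq]
    rw [← hW, ← hr]
    congr 1
    · rw [Matrix.conjTranspose_one, Matrix.one_mul, colMat_conj_mul]
      simp [smul_smul, Matrix.conjTranspose_smul, hrs]
      rw [← hr]; module
    · simp [smul_smul, Matrix.conjTranspose_smul, hrs, h0]
    · simp [smul_smul, Matrix.conjTranspose_smul, hrs, h0]
    · simp [smul_smul, Matrix.conjTranspose_smul, hrs, pow_two]
  rw [deflate_eq, frobSq_reindex, frobSq_conj (lower_mul_lower _) hRR hGR]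
  have hT : R * Matrix.fromBlocks (Matrix.of fun _ _ => l) (rowMat b) 0 (Matrix.of M) * R' =
      Matrix.fromBlocks (Matrix.of fun _ _ => l) ((r • rowMat b + shiftRow l w M) * stretch w) 0
        (shrink w * Matrix.of M * stretch w) := by
    have hl : (Matrix.of fun _ _ => l : Matrix (Fin 1) (Fin 1) ℂ) = l • 1 := by
      ext i j; simp [Subsingleton.elim i j]
    simp only [R, R', Matrix.fromBlocks_multiply, shiftRow, ← hr, ← hW, hl]
    congr 1
    · simp [smul_smul]
      field_simp
    · simp [smul_smul, Matrix.add_mul, Matrix.sub_mul, smul_sub, pow_two]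
      rw [show r⁻¹ * r⁻¹ * (l * r) = r⁻¹ * l by field_simp]
      abel
    · simp
    · simp
  rw [hT, frobSq_fromBlocks]
  simp [frobSq]

end Blocks

/-! ### Linear changes of variables and Gaussian integrals -/

instance isAddHaarMeasure_volume_pi_pi {ι κ : Type*} [Fintype ι] [Fintype κ] :
    (volume : Measure (ι → κ → ℂ)).IsAddHaarMeasure :=
  Measure.pi.isAddHaarMeasure _

theorem det_restrictScalars_complex {E : Type*} [NormedAddCommGroup E]
    [NormedSpace ℂ E] [FiniteDimensional ℂ E] (A : E →ₗ[ℂ] E) :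
    LinearMap.det (A.restrictScalars ℝ) = ‖LinearMap.det A‖ ^ 2 := by
  have : LinearMap.det (A.restrictScalars ℝ) = Algebra.norm ℝ (LinearMap.det A) :=
    LinearMap.det_restrictScalars
  rw [this, Algebra.norm_complex_eq]
  exact Complex.normSq_eq_norm_sq _

section LinearChange

variable {E : Type*} [NormedAddCommGroup E] [NormedSpace ℂ E] [MeasurableSpace E] [BorelSpace E]
  [FiniteDimensional ℂ E]

theorem lintegral_comp_complexLinear (μ : Measure E) [μ.IsAddHaarMeasure] (A : E →ₗ[ℂ] E)
    (hA : LinearMap.det A ≠ 0) (v : E) {g : E → ENNReal} (hg : Measurable g) :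
    ∫⁻ x, g (A x + v) ∂μ = ENNReal.ofReal ((‖LinearMap.det A‖ ^ 2)⁻¹) * ∫⁻ x, g x ∂μ := by
  have : FiniteDimensional ℝ E := FiniteDimensional.complexToReal E
  have hm : Measurable (A.restrictScalars ℝ) :=
    (LinearMap.continuous_of_finiteDimensional _).measurable
  have hd : LinearMap.det (A.restrictScalars ℝ) ≠ 0 := by
    rw [det_restrictScalars_complex]; positivity
  have h := Measure.map_linearMap_addHaar_eq_smul_addHaar μ hd
  have h2 : ∫⁻ x, g (A x + v) ∂μ = ∫⁻ y, g (y + v) ∂(Measure.map (A.restrictScalars ℝ) μ) := by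
    exact (lintegral_map (f := fun y => g (y + v)) (hg.comp (measurable_add_const v)) hm).symm
  rw [h2, h, lintegral_smul_measure, lintegral_add_right_eq_self g v, det_restrictScalars_complex,
    smul_eq_mul, abs_of_nonneg (by positivity)]

end LinearChange

variable {m : ℕ}

/-- In coordinates, conjugation is the Kronecker product of `S` and the transpose of `S'`, whose
determinant is `(det S · det S') ^ m`. -/
theorem det_conjugation {S S' : Matrix (Fin m) (Fin m) ℂ} (h : S * S' = 1) :
    ∃ A : (Fin m → Fin m → ℂ) →ₗ[ℂ] (Fin m → Fin m → ℂ),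
      LinearMap.det A = 1 ∧ ∀ M, A M = S * Matrix.of M * S' := by
  let e := LinearEquiv.curry ℂ ℂ (Fin m) (Fin m)
  let K := Matrix.kroneckerMap (· * ·) S S'.transpose
  refine ⟨(e : _ →ₗ[ℂ] _) ∘ₗ (Matrix.toLin' K) ∘ₗ (e.symm : _ →ₗ[ℂ] _), ?_, fun M => ?_⟩
  · rw [LinearMap.det_conj, LinearMap.det_toLin', Matrix.det_kronecker, Matrix.det_transpose,
      ← mul_pow, ← Matrix.det_mul, h, Matrix.det_one, one_pow]
  · funext i j
    simp only [LinearMap.comp_apply, LinearEquiv.coe_coe, Matrix.toLin'_apply, e, K,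
      LinearEquiv.coe_curry, LinearEquiv.coe_curry_symm, Function.curry_apply, Matrix.mulVec,
      dotProduct, Matrix.kroneckerMap_apply, Matrix.mul_apply, Matrix.of_apply,
      Matrix.transpose_apply, Fintype.sum_prod_type, Finset.sum_mul, Function.uncurry_apply_pair]
    rw [Finset.sum_comm]
    refine Finset.sum_congr rfl fun x _ => Finset.sum_congr rfl fun y _ => ?_
    ring

theorem lintegral_conjugation {S S' : Matrix (Fin m) (Fin m) ℂ} (h : S * S' = 1)
    {g : (Fin m → Fin m → ℂ) → ENNReal} (hg : Measurable g) :
    ∫⁻ M, g (S * Matrix.of M * S') = ∫⁻ M, g M := by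
  obtain ⟨A, hA, hAM⟩ := det_conjugation h
  have := lintegral_comp_complexLinear volume A (by rw [hA]; exact one_ne_zero) 0 hg
  rw [hA, norm_one, one_pow, inv_one, ENNReal.ofReal_one, one_mul] at this
  rw [← this]
  exact lintegral_congr fun M => congrArg g ((add_zero _).trans (hAM M)).symm

theorem integral_exp_neg_normSq {t : ℝ} (ht : 0 < t) :
    ∫ z : ℂ, Real.exp (-t * ‖z‖ ^ 2) = Real.pi / t := by
  have := GaussianFourier.integral_rexp_neg_mul_sq_norm (V := ℂ) ht
  simpa using this

theorem integrable_exp_neg_normSq {t : ℝ} (ht : 0 < t) :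
    Integrable fun z : ℂ => Real.exp (-t * ‖z‖ ^ 2) := by
  -- The integral of a non-integrable function is zero by convention, which contradicts the positive
  -- value just computed.
  by_contra h
  have h1 := integral_exp_neg_normSq ht
  rw [integral_undef h] at h1
  exact (div_pos Real.pi_pos ht).ne h1

theorem lintegral_gaussian_pi {ι : Type*} [Fintype ι] {t : ℝ} (ht : 0 < t) :
    ∫⁻ w : ι → ℂ, ENNReal.ofReal (Real.exp (-t * ∑ i, ‖w i‖ ^ 2)) =
      ENNReal.ofReal ((Real.pi / t) ^ Fintype.card ι) := by
  have hprod : ∀ w : ι → ℂ, Real.exp (-t * ∑ i, ‖w i‖ ^ 2) = ∏ i, Real.exp (-t * ‖w i‖ ^ 2) := by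
    intro w
    rw [← Real.exp_sum, Finset.mul_sum]
  have hint : Integrable fun w : ι → ℂ => ∏ i, Real.exp (-t * ‖w i‖ ^ 2) :=
    Integrable.fintype_prod fun _ => integrable_exp_neg_normSq ht
  simp only [hprod]
  rw [← ofReal_integral_eq_lintegral_ofReal hint (ae_of_all _ fun w => by positivity),
    integral_fintype_prod_volume_eq_pow (fun z : ℂ => Real.exp (-t * ‖z‖ ^ 2)),
    integral_exp_neg_normSq ht]

/-- The integrand is `(1 + |w|²)^(-(m+1))`. Writing it as a Gamma integral in `t` and exchanging the
integrals leaves a Gaussian integral `(π / t)^m`, which cancels the factor `t^m`; what remains is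
the integral of `e^(-t)`. -/
theorem lintegral_vecRad :
    ∫⁻ w : Fin m → ℂ, ENNReal.ofReal ((vecRad w ^ (2 * (m + 1)))⁻¹) =
      ENNReal.ofReal (Real.pi ^ m / m.factorial) := by
  have hgam : ∀ r : ℝ, 0 < r → ENNReal.ofReal ((r ^ (m + 1))⁻¹) =
      ∫⁻ t in Set.Ioi (0 : ℝ), ENNReal.ofReal (t ^ m / m.factorial * Real.exp (-(r * t))) := by
    intro r hr
    have h1 := Real.integral_rpow_mul_exp_neg_mul_Ioi (a := m + 1) (r := r) (by positivity) hr
    have h2 : ∫ t in Set.Ioi (0 : ℝ), t ^ m / m.factorial * Real.exp (-(r * t)) =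
        (r ^ (m + 1))⁻¹ := by
      have h3 : ∀ t : ℝ, t ^ m / m.factorial * Real.exp (-(r * t)) =
          (m.factorial : ℝ)⁻¹ * (t ^ ((m : ℝ) + 1 - 1) * Real.exp (-(r * t))) := by
        intro t
        rw [add_sub_cancel_right, Real.rpow_natCast]
        ring
      simp only [h3]
      rw [integral_const_mul, h1, Real.Gamma_nat_eq_factorial]
      have : (1 / r) ^ ((m : ℝ) + 1) = (r ^ (m + 1))⁻¹ := by
        rw [show (m : ℝ) + 1 = ((m + 1 : ℕ) : ℝ) by push_cast; ring, Real.rpow_natCast]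
        simp
      rw [this]
      field_simp
    rw [← ofReal_integral_eq_lintegral_ofReal, h2]
    · by_contra h
      rw [integral_undef h] at h2
      have : 0 < (r ^ (m + 1))⁻¹ := by positivity
      exact this.ne h2
    · filter_upwards [ae_restrict_mem measurableSet_Ioi] with t ht
      have : (0 : ℝ) < t := ht
      positivity
  have h1 : ∀ w : Fin m → ℂ, ENNReal.ofReal ((vecRad w ^ (2 * (m + 1)))⁻¹) =
      ∫⁻ t in Set.Ioi (0 : ℝ), ENNReal.ofReal (t ^ m / m.factorial * Real.exp (-t) *
        Real.exp (-t * ∑ i, ‖w i‖ ^ 2)) := by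
    intro w
    rw [pow_mul, hgam _ (pow_pos (vecRad_pos w) 2), vecRad_sq]
    refine lintegral_congr fun t => ?_
    rw [mul_assoc, ← Real.exp_add]
    ring_nf
  simp only [h1]
  rw [lintegral_lintegral_swap (by fun_prop)]
  have h2 : ∀ t ∈ Set.Ioi (0 : ℝ), ∫⁻ w : Fin m → ℂ, ENNReal.ofReal
      (t ^ m / m.factorial * Real.exp (-t) * Real.exp (-t * ∑ i, ‖w i‖ ^ 2)) =
      ENNReal.ofReal (Real.pi ^ m / m.factorial) *
        ENNReal.ofReal (t ^ 0 / (Nat.factorial 0) * Real.exp (-(1 * t))) := by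
    intro t ht
    have ht : 0 < t := ht
    have h3 : ∀ w : Fin m → ℂ, ENNReal.ofReal
        (t ^ m / m.factorial * Real.exp (-t) * Real.exp (-t * ∑ i, ‖w i‖ ^ 2)) =
        ENNReal.ofReal (t ^ m / m.factorial * Real.exp (-t)) *
          ENNReal.ofReal (Real.exp (-t * ∑ i, ‖w i‖ ^ 2)) :=
      fun w => ENNReal.ofReal_mul (by positivity)
    simp only [h3]
    rw [lintegral_const_mul _ (by fun_prop), lintegral_gaussian_pi ht,
      ← ENNReal.ofReal_mul (by positivity), ← ENNReal.ofReal_mul (by positivity)]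
    congr 1
    simp
    rw [div_pow]
    field_simp
  rw [setLIntegral_congr_fun measurableSet_Ioi h2, lintegral_const_mul _ (by fun_prop)]
  have h4 : ∫⁻ t in Set.Ioi (0 : ℝ), ENNReal.ofReal
      (t ^ 0 / (Nat.factorial 0) * Real.exp (-(1 * t))) = 1 := by
    simp only [pow_zero, Nat.factorial_zero, Nat.cast_one, div_one, one_mul]
    rw [← ofReal_integral_eq_lintegral_ofReal (integrableOn_exp_neg_Ioi 0)
      (ae_of_all _ fun t => (Real.exp_pos _).le), integral_exp_neg_Ioi_zero, ENNReal.ofReal_one]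
  rw [h4, mul_one]

/-! ### The eigenvector as a coordinate on matrices -/

/-- Integration over a matrix, block by block. -/
theorem lintegral_blk {H : (Fin (m + 1) → Fin (m + 1) → ℂ) → ENNReal} (hH : Measurable H) :
    ∫⁻ x, H x = ∫⁻ a : ℂ, ∫⁻ b : Fin m → ℂ, ∫⁻ Y : Fin m → Fin m → ℂ, ∫⁻ c : Fin m → ℂ,
      H (blk a b c Y) := by
  have e0 := (volume_preserving_piFinSuccAbove (fun _ : Fin (m + 1) => ℂ) 0).symm
  have eR := (volume_preserving_piFinSuccAbove (fun _ : Fin (m + 1) => (Fin (m + 1) → ℂ)) 0).symm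
  have eA := (volume_measurePreserving_arrowProdEquivProdArrow ℂ (Fin m → ℂ) (Fin m)).symm
  have eP := volume_preserving_pi (fun _ : Fin m => e0)
  have hmp := eR.comp (e0.prod (eP.comp eA))
  have hblk : ∀ p : (ℂ × (Fin m → ℂ)) × ((Fin m → ℂ) × (Fin m → Fin m → ℂ)),
      (MeasurableEquiv.piFinSuccAbove (fun _ : Fin (m + 1) => (Fin (m + 1) → ℂ)) 0).symm
        (Prod.map (MeasurableEquiv.piFinSuccAbove (fun _ : Fin (m + 1) => ℂ) 0).symm
          ((fun (u : Fin m → ℂ × (Fin m → ℂ)) i =>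
            (MeasurableEquiv.piFinSuccAbove (fun _ : Fin (m + 1) => ℂ) 0).symm (u i)) ∘
            (MeasurableEquiv.arrowProdEquivProdArrow ℂ (Fin m → ℂ) (Fin m)).symm) p) =
      blk p.1.1 p.1.2 p.2.1 p.2.2 := by
    rintro ⟨⟨a, b⟩, c, Y⟩
    funext i j
    refine Fin.cases ?_ (fun i => ?_) i <;> refine Fin.cases ?_ (fun j => ?_) j <;>
      simp [blk, MeasurableEquiv.piFinSuccAbove, MeasurableEquiv.arrowProdEquivProdArrow,
        Fin.insertNthEquiv, Equiv.arrowProdEquivProdArrow]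
  have hfun := funext hblk
  rw [← Function.comp_def] at hfun
  rw [hfun] at hmp
  have hHB : Measurable fun p : (ℂ × (Fin m → ℂ)) × ((Fin m → ℂ) × (Fin m → Fin m → ℂ)) =>
      H (blk p.1.1 p.1.2 p.2.1 p.2.2) := hH.comp hmp.measurable
  rw [← hmp.lintegral_comp hH, lintegral_prod _ hHB.aemeasurable, Measure.volume_eq_prod,
    lintegral_prod _ hHB.lintegral_prod_right'.aemeasurable]
  refine lintegral_congr fun a => lintegral_congr fun b => ?_
  rw [Measure.volume_eq_prod]
  -- The column is put innermost because it is the block that the eigenvector coordinate `w` will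
  -- replace.
  exact lintegral_prod_symm _ (hHB.comp measurable_prodMk_left).aemeasurable

/-- The pairs `(l, M)` such that `l` exceeds every eigenvalue of `M` in modulus. -/
def dominated (m : ℕ) : Set (ℂ × (Fin m → Fin m → ℂ)) := {p | ∀ z ∈ spec p.2, ‖z‖ < ‖p.1‖}

theorem measurableSet_dominated : MeasurableSet (dominated m) := by
  classical
  let F : ℂ → Multiset ℂ → ENNReal := fun l s => if ∀ z ∈ s, ‖z‖ < ‖l‖ then 1 else 0
  have hF : Measurable fun p : ℂ × (Fin m → ℂ) => F p.1 (tupleMultiset p.2) := by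
    refine Measurable.ite ?_ measurable_const measurable_const
    have : {p : ℂ × (Fin m → ℂ) | ∀ z ∈ tupleMultiset p.2, ‖z‖ < ‖p.1‖} =
        ⋂ i, {p : ℂ × (Fin m → ℂ) | ‖p.2 i‖ < ‖p.1‖} := by
      ext p
      simp [tupleMultiset]
    rw [this]
    exact MeasurableSet.iInter fun i => measurableSet_lt (by fun_prop) (by fun_prop)
  have := (measurable_spec hF) (measurableSet_singleton 1)
  convert this using 1
  ext p
  simp [dominated, F]

/-- The last column as a function of the eigenvector `(1, w)`, the rest of the matrix being fixed. -/
def eigenCol (a : ℂ) (b : Fin m → ℂ) (Y : Fin m → Fin m → ℂ) (w : Fin m → ℂ) : Fin m → ℂ :=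
  fun i => (a + ∑ k, b k * w k) * w i - ∑ j, Y i j * w j

/-- Passing from `(l, M)` to `(a, Y)` is a translation once `w` and `b` are fixed. The only
nonlinear part of the parametrisation is thus `w ↦ eigenCol a b Y w` at fixed `a`, `b`, `Y`. -/
theorem deflate_eigenCol (a : ℂ) (b : Fin m → ℂ) (Y : Fin m → Fin m → ℂ) (w : Fin m → ℂ) :
    deflate (a + ∑ k, b k * w k) w b (fun i j => Y i j - w i * b j) =
      blk a b (eigenCol a b Y w) Y := by
  simp [deflate]
  rfl

/-- The derivative of `eigenCol`. -/
noncomputable def eigenColDeriv (a : ℂ) (b : Fin m → ℂ) (Y : Fin m → Fin m → ℂ) (w : Fin m → ℂ) :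
    (Fin m → ℂ) →L[ℂ] (Fin m → ℂ) :=
  LinearMap.toContinuousLinearMap (Matrix.toLin'
    (Matrix.scalar (Fin m) (a + ∑ k, b k * w k) - Matrix.of fun i j => Y i j - w i * b j))

/-- Differentiating the factor `a + b · w` produces the rank one term `w (b · u)`, which turns `Y`
into the compression `M = Y - w b`. The derivative is then `l - M`, so the Jacobian is the
Vandermonde factor between `l` and the spectrum of `M`. -/
theorem hasFDerivAt_eigenCol (a : ℂ) (b : Fin m → ℂ) (Y : Fin m → Fin m → ℂ) (w : Fin m → ℂ) :
    HasFDerivAt (eigenCol a b Y) (eigenColDeriv a b Y w) w := by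
  rw [hasFDerivAt_pi']
  intro i
  have hp : ∀ k, HasFDerivAt (fun w : Fin m → ℂ => w k)
      (ContinuousLinearMap.proj (R := ℂ) (φ := fun _ : Fin m => ℂ) k) w :=
    fun k => (ContinuousLinearMap.proj (R := ℂ) (φ := fun _ : Fin m => ℂ) k).hasFDerivAt
  have h1 : HasFDerivAt (fun w : Fin m → ℂ => a + ∑ k, b k * w k) _ w :=
    (HasFDerivAt.fun_sum fun k _ => (hp k).const_mul (b k)).const_add a
  have h2 : HasFDerivAt (fun w : Fin m → ℂ => ∑ j, Y i j * w j) _ w :=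
    HasFDerivAt.fun_sum fun j _ => (hp j).const_mul (Y i j)
  refine ((h1.mul (hp i)).sub h2).congr_fderiv ?_
  ext u
  simp [eigenColDeriv, Matrix.mulVec, dotProduct, sub_mul, Finset.sum_sub_distrib, Finset.mul_sum]
  ring_nf

theorem det_scalar_sub (l : ℂ) (M : Fin m → Fin m → ℂ) :
    (Matrix.scalar (Fin m) l - Matrix.of M).det = ((spec M).map fun z => l - z).prod := by
  rw [← Matrix.eval_charpoly]
  conv_lhs => rw [(IsAlgClosed.splits (Matrix.of M).charpoly).eq_prod_roots_of_monic
    (Matrix.charpoly_monic _)]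
  rw [Polynomial.eval_multiset_prod, Multiset.map_map, spec]
  simp

theorem norm_det_scalar_sub (l : ℂ) (M : Fin m → Fin m → ℂ) :
    ‖(Matrix.scalar (Fin m) l - Matrix.of M).det‖ ^ 2 =
      ((spec M).map fun z => ‖l - z‖ ^ 2).prod := by
  rw [det_scalar_sub]
  generalize spec M = s
  induction s using Multiset.induction_on with
  | empty => simp
  | cons a s ih => simp [mul_pow, ih]

/-- Equal columns mean equal matrices, whose strictly dominant eigenvalue is unique, so `l = l'`.
Subtracting the two eigenvector equations puts `w - w'` in the kernel of `l - M`, which is trivial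
because `l` is not an eigenvalue of `M`. -/
theorem injOn_eigenCol (a : ℂ) (b : Fin m → ℂ) (Y : Fin m → Fin m → ℂ) :
    Set.InjOn (eigenCol a b Y)
      {w : Fin m → ℂ | (a + ∑ k, b k * w k, fun i j => Y i j - w i * b j) ∈ dominated m} := by
  intro w hw w' hw' h
  set l := a + ∑ k, b k * w k with hl
  set l' := a + ∑ k, b k * w' k with hl'
  set M : Fin m → Fin m → ℂ := fun i j => Y i j - w i * b j with hM
  set M' : Fin m → Fin m → ℂ := fun i j => Y i j - w' i * b j with hM'
  have hs : l ::ₘ spec M = l' ::ₘ spec M' := by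
    rw [← spec_deflate l w b M, ← spec_deflate l' w' b M', hl, hl', deflate_eigenCol,
      deflate_eigenCol, h]
  have hll : l = l' := by
    by_contra hne
    have h1 : l ∈ l' ::ₘ spec M' := hs ▸ Multiset.mem_cons_self _ _
    have h2 : l' ∈ l ::ₘ spec M := hs.symm ▸ Multiset.mem_cons_self _ _
    have h3 := hw' l ((Multiset.mem_cons.1 h1).resolve_left hne)
    have h4 := hw l' ((Multiset.mem_cons.1 h2).resolve_left (Ne.symm hne))
    exact lt_asymm h3 h4
  have hker : (Matrix.scalar (Fin m) l - Matrix.of M).mulVec (w - w') = 0 := by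
    have hb : ∑ k, b k * (w k - w' k) = 0 := by
      simp only [mul_sub, Finset.sum_sub_distrib]
      linear_combination hll
    funext i
    have hi := congrFun h i
    simp only [eigenCol] at hi
    rw [← hl, ← hl', ← hll] at hi
    have e1 : ∑ j, Y i j * (w j - w' j) = ∑ j, Y i j * w j - ∑ j, Y i j * w' j := by
      simp [mul_sub, Finset.sum_sub_distrib]
    have e2 : ∑ j, M i j * (w j - w' j) = ∑ j, Y i j * (w j - w' j) := by
      simp only [hM, sub_mul, Finset.sum_sub_distrib, mul_assoc, ← Finset.mul_sum, hb]
      simp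
    rw [Matrix.sub_mulVec]
    simp only [Pi.sub_apply, Matrix.scalar_apply, Matrix.mulVec, dotProduct,
      Matrix.of_apply, Pi.zero_apply]
    simp [Matrix.diagonal_apply]
    rw [e2, e1]
    linear_combination hi
  by_contra hne
  have hdet : (Matrix.scalar (Fin m) l - Matrix.of M).det = 0 :=
    Matrix.exists_mulVec_eq_zero_iff.1 ⟨w - w', sub_ne_zero.2 hne, hker⟩
  rw [det_scalar_sub, Multiset.prod_eq_zero_iff, Multiset.mem_map] at hdet
  obtain ⟨z, hz, hz'⟩ := hdet
  have := hw z hz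
  rw [← sub_eq_zero.1 hz'] at this
  exact lt_irrefl _ this

theorem measurableSet_dominated_section (a : ℂ) (b : Fin m → ℂ) (Y : Fin m → Fin m → ℂ) :
    MeasurableSet {w : Fin m → ℂ |
      (a + ∑ k, b k * w k, fun i j => Y i j - w i * b j) ∈ dominated m} := by
  have : Measurable fun w : Fin m → ℂ =>
      ((a + ∑ k, b k * w k, fun i j => Y i j - w i * b j) : ℂ × (Fin m → Fin m → ℂ)) := by
    fun_prop
  exact this measurableSet_dominated

/-- The area formula on the dominated set gives equality with the integral over its image; enlarging
the image to the whole space is enough for what follows. -/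
theorem lintegral_eigenCol_le (a : ℂ) (b : Fin m → ℂ) (Y : Fin m → Fin m → ℂ)
    (H : (Fin m → ℂ) → ENNReal) :
    ∫⁻ w in {w : Fin m → ℂ | (a + ∑ k, b k * w k, fun i j => Y i j - w i * b j) ∈ dominated m},
      ENNReal.ofReal ((spec fun i j => Y i j - w i * b j).map
        fun z => ‖a + ∑ k, b k * w k - z‖ ^ 2).prod * H (eigenCol a b Y w) ≤ ∫⁻ c, H c := by
  have hDm := measurableSet_dominated_section a b Y
  have h := lintegral_image_eq_lintegral_abs_det_fderiv_mul volume hDm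
    (f' := fun w => (eigenColDeriv a b Y w).restrictScalars ℝ)
    (fun w _ => ((hasFDerivAt_eigenCol a b Y w).restrictScalars ℝ).hasFDerivWithinAt)
    (injOn_eigenCol a b Y) H
  calc _ = _ := ?_
    _ ≤ _ := h.symm.le.trans (setLIntegral_le_lintegral _ _)
  refine lintegral_congr fun w => ?_
  congr 2
  rw [← norm_det_scalar_sub]
  have hdet : ((eigenColDeriv a b Y w).restrictScalars ℝ).det =
      LinearMap.det ((Matrix.toLin' (Matrix.scalar (Fin m) (a + ∑ k, b k * w k) -
        Matrix.of fun i j => Y i j - w i * b j)).restrictScalars ℝ) := rfl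
  rw [hdet, det_restrictScalars_complex, LinearMap.det_toLin', abs_of_nonneg (by positivity)]

/-! ### Reordering iterated integrals -/

section Swap

variable {α β γ δ : Type*} [MeasureSpace α] [MeasureSpace β] [MeasureSpace γ] [MeasureSpace δ]
  [SFinite (volume : Measure α)] [SFinite (volume : Measure β)] [SFinite (volume : Measure γ)]
  [SFinite (volume : Measure δ)]

theorem lintegral_swap_head {G : α → β → ENNReal}
    (hG : Measurable fun p : α × β => G p.1 p.2) :
    ∫⁻ a, ∫⁻ b, G a b = ∫⁻ b, ∫⁻ a, G a b :=
  lintegral_lintegral_swap hG.aemeasurable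

theorem lintegral_swap₃ {G : α → β → γ → ENNReal}
    (hG : Measurable fun p : α × β × γ => G p.1 p.2.1 p.2.2) :
    ∫⁻ a, ∫⁻ b, ∫⁻ c, G a b c = ∫⁻ b, ∫⁻ a, ∫⁻ c, G a b c := by
  refine lintegral_swap_head (G := fun a b => ∫⁻ c, G a b c) ?_
  exact Measurable.lintegral_prod_right' (f := fun q : (α × β) × γ => G q.1.1 q.1.2 q.2)
    (hG.comp (by fun_prop : Measurable fun q : (α × β) × γ => (q.1.1, q.1.2, q.2)))

theorem lintegral_swap₄ {G : α → β → γ → δ → ENNReal}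
    (hG : Measurable fun p : α × β × γ × δ => G p.1 p.2.1 p.2.2.1 p.2.2.2) :
    ∫⁻ a, ∫⁻ b, ∫⁻ c, ∫⁻ d, G a b c d = ∫⁻ b, ∫⁻ a, ∫⁻ c, ∫⁻ d, G a b c d := by
  refine lintegral_swap₃ (G := fun a b c => ∫⁻ d, G a b c d) ?_
  exact Measurable.lintegral_prod_right' (f := fun q : (α × β × γ) × δ =>
      G q.1.1 q.1.2.1 q.1.2.2 q.2)
    (hG.comp (by fun_prop :
      Measurable fun q : (α × β × γ) × δ => (q.1.1, q.1.2.1, q.1.2.2, q.2)))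

theorem lintegral_perm_abYw {G : α → β → γ → δ → ENNReal}
    (hG : Measurable fun p : α × β × γ × δ => G p.1 p.2.1 p.2.2.1 p.2.2.2) :
    ∫⁻ a, ∫⁻ b, ∫⁻ c, ∫⁻ d, G a b c d = ∫⁻ d, ∫⁻ b, ∫⁻ a, ∫⁻ c, G a b c d := by
  have h1 : ∀ a b, ∫⁻ c, ∫⁻ d, G a b c d = ∫⁻ d, ∫⁻ c, G a b c d := fun a b =>
    lintegral_swap_head (hG.comp (by fun_prop : Measurable fun q : γ × δ => (a, b, q.1, q.2)))
  have h2 : ∀ a, ∫⁻ b, ∫⁻ d, ∫⁻ c, G a b c d = ∫⁻ d, ∫⁻ b, ∫⁻ c, G a b c d := fun a =>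
    lintegral_swap₃ (G := fun b d c => G a b c d)
      (hG.comp (by fun_prop : Measurable fun q : β × δ × γ => (a, q.1, q.2.2, q.2.1)))
  simp only [h1, h2]
  rw [lintegral_swap₄ (G := fun a d b c => G a b c d)
      (hG.comp (by fun_prop : Measurable fun q : α × δ × β × γ => (q.1, q.2.2.1, q.2.2.2, q.2.1)))]
  refine lintegral_congr fun d => ?_
  exact lintegral_swap₃ (G := fun a b c => G a b c d)
      (hG.comp (by fun_prop : Measurable fun q : α × β × γ => (q.1, q.2.1, q.2.2, d)))

theorem lintegral_perm_wblM {G : α → β → γ → δ → ENNReal}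
    (hG : Measurable fun p : α × β × γ × δ => G p.1 p.2.1 p.2.2.1 p.2.2.2) :
    ∫⁻ a, ∫⁻ b, ∫⁻ c, ∫⁻ d, G a b c d = ∫⁻ c, ∫⁻ a, ∫⁻ d, ∫⁻ b, G a b c d := by
  have h1 : ∀ a, ∫⁻ b, ∫⁻ c, ∫⁻ d, G a b c d = ∫⁻ c, ∫⁻ b, ∫⁻ d, G a b c d := fun a =>
    lintegral_swap₃ (G := fun b c d => G a b c d)
      (hG.comp (by fun_prop : Measurable fun q : β × γ × δ => (a, q.1, q.2.1, q.2.2)))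
  simp only [h1]
  rw [lintegral_swap₄ (G := fun a c b d => G a b c d)
      (hG.comp (by fun_prop : Measurable fun q : α × γ × β × δ => (q.1, q.2.2.1, q.2.1, q.2.2.2)))]
  refine lintegral_congr fun c => lintegral_congr fun a => ?_
  exact lintegral_swap_head
    (hG.comp (by fun_prop : Measurable fun q : β × δ => (a, q.1, c, q.2)))

end Swap

/-! ### Splitting off the dominant eigenvalue of a Gaussian matrix -/

/-- The Gaussian integral over `n × n` matrices of a function of the spectrum. -/
noncomputable def matGauss (n : ℕ) (F : Multiset ℂ → ENNReal) : ENNReal :=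
  ∫⁻ x : Fin n → Fin n → ℂ, F (spec x) * ENNReal.ofReal (Real.exp (-frobSq (Matrix.of x)))

/-- The function of the other eigenvalues obtained by splitting off the eigenvalue `l` of largest
modulus. -/
noncomputable def peel (F : Multiset ℂ → ENNReal) (l : ℂ) (s : Multiset ℂ) : ENNReal :=
  open Classical in
  (if ∀ z ∈ s, ‖z‖ < ‖l‖ then ENNReal.ofReal (s.map fun z => ‖l - z‖ ^ 2).prod else 0) * F (l ::ₘ s)

theorem tupleMultiset_cons (l : ℂ) (z : Fin m → ℂ) :
    tupleMultiset (Fin.cons l z : Fin (m + 1) → ℂ) = l ::ₘ tupleMultiset z := by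
  simp [tupleMultiset, Fin.univ_succ, Function.comp_def]

theorem measurable_peel {F : Multiset ℂ → ENNReal}
    (hF : Measurable fun z : Fin (m + 1) → ℂ => F (tupleMultiset z)) :
    Measurable fun p : ℂ × (Fin m → ℂ) => peel F p.1 (tupleMultiset p.2) := by
  classical
  unfold peel
  refine Measurable.mul (Measurable.ite ?_ ?_ measurable_const) ?_
  · have : {p : ℂ × (Fin m → ℂ) | ∀ z ∈ tupleMultiset p.2, ‖z‖ < ‖p.1‖} =
        ⋂ i, {p : ℂ × (Fin m → ℂ) | ‖p.2 i‖ < ‖p.1‖} := by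
      ext p
      simp [tupleMultiset]
    rw [this]
    exact MeasurableSet.iInter fun i => measurableSet_lt (by fun_prop) (by fun_prop)
  · have : ∀ p : ℂ × (Fin m → ℂ), ((tupleMultiset p.2).map fun z => ‖p.1 - z‖ ^ 2).prod =
        ∏ i, ‖p.1 - p.2 i‖ ^ 2 := by
      intro p
      rw [tupleMultiset, Multiset.map_map]
      rfl
    simp only [this]
    fun_prop
  · simp only [← tupleMultiset_cons]
    exact hF.comp (by
      refine measurable_pi_lambda _ fun i => ?_
      refine Fin.cases ?_ (fun i => ?_) i
      · simpa using measurable_fst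
      · simp only [Fin.cons_succ]
        fun_prop)

theorem measurable_deflate :
    Measurable fun p : ℂ × (Fin m → ℂ) × (Fin m → ℂ) × (Fin m → Fin m → ℂ) =>
      deflate p.1 p.2.1 p.2.2.1 p.2.2.2 := by
  refine measurable_pi_lambda _ fun i => measurable_pi_lambda _ fun j => ?_
  refine Fin.cases ?_ (fun i => ?_) i <;> refine Fin.cases ?_ (fun j => ?_) j <;>
    simp only [deflate, blk, Fin.cons_zero, Fin.cons_succ] <;> fun_prop

theorem measurable_frobSq {k l : Type*} [Fintype k] [Fintype l] :
    Measurable fun x : k → l → ℂ => frobSq (Matrix.of x) := by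
  unfold frobSq
  simp only [Matrix.of_apply]
  fun_prop

/-- The `b`-dependent block is `A b + v` with `A = r · stretchᵀ` and `r = vecRad w`. The scalar
contributes `r^m` to the determinant and `stretch w` one more `r`; the shift `v` does not affect the
Gaussian integral. -/
theorem lintegral_row (l : ℂ) (w : Fin m → ℂ) (M : Fin m → Fin m → ℂ) :
    ∫⁻ b : Fin m → ℂ, ENNReal.ofReal (Real.exp (-frobSq (Matrix.of (deflate l w b M)))) =
      ENNReal.ofReal (Real.exp (-‖l‖ ^ 2)) *
        (ENNReal.ofReal (Real.exp (-frobSq (shrink w * Matrix.of M * stretch w))) *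
        (ENNReal.ofReal (Real.pi ^ m) * ENNReal.ofReal ((vecRad w ^ (2 * (m + 1)))⁻¹))) := by
  let A : (Fin m → ℂ) →ₗ[ℂ] (Fin m → ℂ) :=
    Matrix.toLin' ((vecRad w : ℂ) • (stretch w).transpose)
  let v : Fin m → ℂ := (shiftRow l w M * stretch w) 0
  have hdet : LinearMap.det A = (vecRad w : ℂ) ^ (m + 1) := by
    rw [LinearMap.det_toLin', Matrix.det_smul, Matrix.det_transpose, det_stretch, Fintype.card_fin,
      pow_succ]
  have hrow : ∀ b, frobSq (((vecRad w : ℂ) • rowMat b + shiftRow l w M) * stretch w) =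
      ∑ j, ‖(A b + v) j‖ ^ 2 := by
    intro b
    simp only [frobSq, Finset.univ_unique, Finset.sum_singleton]
    refine Finset.sum_congr rfl fun j _ => ?_
    congr 2
    rw [Matrix.add_mul, Matrix.add_apply, Pi.add_apply]
    congr 1
    simp [A, Matrix.mul_apply, Matrix.mulVec, dotProduct, rowMat]
    rw [Finset.mul_sum]
    exact Finset.sum_congr rfl fun k _ => by ring
  have hexp : ∀ b, ENNReal.ofReal (Real.exp (-frobSq (Matrix.of (deflate l w b M)))) =
      ENNReal.ofReal (Real.exp (-‖l‖ ^ 2)) *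
        (ENNReal.ofReal (Real.exp (-frobSq (shrink w * Matrix.of M * stretch w))) *
        ENNReal.ofReal (Real.exp (-1 * ∑ j, ‖(A b + v) j‖ ^ 2))) := by
    intro b
    rw [← ENNReal.ofReal_mul (by positivity), ← ENNReal.ofReal_mul (by positivity),
      ← Real.exp_add, ← Real.exp_add, frobSq_deflate, hrow]
    congr 2
    ring
  simp only [hexp]
  have hA : Measurable fun b => A b := (LinearMap.continuous_of_finiteDimensional A).measurable
  rw [lintegral_const_mul _ (by fun_prop), lintegral_const_mul _ (by fun_prop),
    lintegral_comp_complexLinear volume A (by rw [hdet]; exact pow_ne_zero _ (vecRad_ne w)) v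
      (g := fun b => ENNReal.ofReal (Real.exp (-1 * ∑ j, ‖b j‖ ^ 2))) (by fun_prop),
    lintegral_gaussian_pi one_pos, hdet]
  rw [mul_comm (ENNReal.ofReal (_ ^ _)⁻¹)]
  congr 4
  · simp
  · rw [norm_pow, Complex.norm_real, Real.norm_of_nonneg (vecRad_pos w).le]
    ring

theorem measurable_comp_spec {n : ℕ} {F : Multiset ℂ → ENNReal}
    (hF : Measurable fun z : Fin n → ℂ => F (tupleMultiset z)) :
    Measurable fun x : Fin n → Fin n → ℂ => F (spec x) := by
  have h0 : Measurable fun p : Unit × (Fin n → ℂ) => F (tupleMultiset p.2) :=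
    hF.comp (measurable_snd (α := Unit) (β := Fin n → ℂ))
  have h := measurable_spec (α := Unit) (F := fun _ => F) h0
  exact Measurable.comp (g := fun p : Unit × (Fin n → Fin n → ℂ) => F (spec p.2)) h
    (measurable_prodMk_left (x := ()))

/-- The integrand over `m + 1` by `m + 1` matrices in the coordinates of `deflate`. -/
noncomputable def peelKernel (F : Multiset ℂ → ENNReal) (l : ℂ) (w b : Fin m → ℂ)
    (M : Fin m → Fin m → ℂ) : ENNReal :=
  peel F l (spec M) * ENNReal.ofReal (Real.exp (-frobSq (Matrix.of (deflate l w b M))))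

theorem measurable_peel_spec {F : Multiset ℂ → ENNReal}
    (hF : Measurable fun z : Fin (m + 1) → ℂ => F (tupleMultiset z)) :
    Measurable fun p : ℂ × (Fin m → Fin m → ℂ) => peel F p.1 (spec p.2) :=
  measurable_spec (measurable_peel hF)

theorem measurable_peelKernel {F : Multiset ℂ → ENNReal}
    (hF : Measurable fun z : Fin (m + 1) → ℂ => F (tupleMultiset z)) :
    Measurable fun p : ℂ × (Fin m → ℂ) × (Fin m → ℂ) × (Fin m → Fin m → ℂ) =>
      peelKernel F p.1 p.2.1 p.2.2.1 p.2.2.2 := by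
  unfold peelKernel
  refine Measurable.mul ?_ ((measurable_frobSq.comp measurable_deflate).neg.exp).ennreal_ofReal
  exact Measurable.comp (g := fun p : ℂ × (Fin m → Fin m → ℂ) => peel F p.1 (spec p.2))
    (f := fun p : ℂ × (Fin m → ℂ) × (Fin m → ℂ) × (Fin m → Fin m → ℂ) => (p.1, p.2.2.2))
    (measurable_peel_spec hF) (by fun_prop)

/-- Once `b` is integrated out, `M` occurs in the Gaussian weight only through its conjugate by
`shrink w`. Conjugation preserves both the spectrum and Lebesgue measure, so the dependence on `w`
splits off as a power of `vecRad w`. -/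
theorem lintegral_peelKernel {F : Multiset ℂ → ENNReal}
    (hF : Measurable fun z : Fin (m + 1) → ℂ => F (tupleMultiset z)) (l : ℂ) (w : Fin m → ℂ) :
    ∫⁻ M : Fin m → Fin m → ℂ, ∫⁻ b : Fin m → ℂ, peelKernel F l w b M =
      ENNReal.ofReal (Real.pi ^ m) * (ENNReal.ofReal (Real.exp (-‖l‖ ^ 2)) *
        matGauss m (peel F l)) * ENNReal.ofReal ((vecRad w ^ (2 * (m + 1)))⁻¹) := by
  let Q : (Fin m → Fin m → ℂ) → ENNReal := fun M =>
    ENNReal.ofReal (Real.exp (-‖l‖ ^ 2)) *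
      (ENNReal.ofReal (Real.pi ^ m) * ENNReal.ofReal ((vecRad w ^ (2 * (m + 1)))⁻¹)) *
      (peel F l (spec M) * ENNReal.ofReal (Real.exp (-frobSq (Matrix.of M))))
  have hGl : Measurable fun M : Fin m → Fin m → ℂ =>
      peel F l (spec M) * ENNReal.ofReal (Real.exp (-frobSq (Matrix.of M))) :=
    (Measurable.comp (g := fun p : ℂ × (Fin m → Fin m → ℂ) => peel F p.1 (spec p.2))
      (f := fun M : Fin m → Fin m → ℂ => (l, M))
      (measurable_peel_spec hF) (by fun_prop)).mul (measurable_frobSq.neg.exp).ennreal_ofReal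
  have h2 : ∀ M : Fin m → Fin m → ℂ, ∫⁻ b : Fin m → ℂ, peelKernel F l w b M =
      Q (shrink w * Matrix.of M * stretch w) := by
    intro M
    have hb : Measurable fun b : Fin m → ℂ =>
        ENNReal.ofReal (Real.exp (-frobSq (Matrix.of (deflate l w b M)))) :=
      ((measurable_frobSq.comp (measurable_deflate.comp (by fun_prop :
        Measurable fun b => (l, w, b, M)))).neg.exp).ennreal_ofReal
    simp only [peelKernel, Q]
    rw [lintegral_const_mul _ hb, lintegral_row, spec_conj (shrink_mul_stretch w)]
    have : (Matrix.of (shrink w * Matrix.of M * stretch w)) =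
      shrink w * Matrix.of M * stretch w := rfl
    rw [this]
    ring
  have hQ : Measurable Q := hGl.const_mul _
  rw [lintegral_congr h2]
  refine (lintegral_conjugation (shrink_mul_stretch w) hQ).trans ?_
  rw [lintegral_const_mul _ hGl, matGauss]
  ring

/-- Splitting off the eigenvalue of largest modulus. -/
theorem matGauss_succ_ge {F : Multiset ℂ → ENNReal}
    (hF : Measurable fun z : Fin (m + 1) → ℂ => F (tupleMultiset z)) :
    ENNReal.ofReal (Real.pi ^ m) * ENNReal.ofReal (Real.pi ^ m / m.factorial) *
      ∫⁻ l, ENNReal.ofReal (Real.exp (-‖l‖ ^ 2)) * matGauss m (peel F l) ≤ matGauss (m + 1) F := by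
  have hK := measurable_peelKernel hF
  have hH : Measurable fun x : Fin (m + 1) → Fin (m + 1) → ℂ =>
      F (spec x) * ENNReal.ofReal (Real.exp (-frobSq (Matrix.of x))) :=
    (measurable_comp_spec hF).mul (measurable_frobSq.neg.exp).ennreal_ofReal
  rw [matGauss, lintegral_blk hH]
  calc _ = ∫⁻ l : ℂ, ∫⁻ w : Fin m → ℂ, ∫⁻ M : Fin m → Fin m → ℂ, ∫⁻ b : Fin m → ℂ,
        peelKernel F l w b M := ?_
    _ = ∫⁻ w : Fin m → ℂ, ∫⁻ b : Fin m → ℂ, ∫⁻ l : ℂ, ∫⁻ M : Fin m → Fin m → ℂ,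
        peelKernel F l w b M :=
      (lintegral_perm_wblM (G := fun (w b : Fin m → ℂ) (l : ℂ) (M : Fin m → Fin m → ℂ) =>
        peelKernel F l w b M) (hK.comp (by fun_prop :
        Measurable fun p : (Fin m → ℂ) × (Fin m → ℂ) × ℂ × (Fin m → Fin m → ℂ) =>
          (p.2.2.1, p.1, p.2.1, p.2.2.2)))).symm
    -- For fixed `w` and `b` the substitution `l = a + b · w`, `M = Y - w b` is a translation and
    -- has no Jacobian.
    _ = ∫⁻ w : Fin m → ℂ, ∫⁻ b : Fin m → ℂ, ∫⁻ a : ℂ, ∫⁻ Y : Fin m → Fin m → ℂ,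
        peelKernel F (a + ∑ k, b k * w k) w b (fun i j => Y i j - w i * b j) := by
      refine lintegral_congr fun w => lintegral_congr fun b => ?_
      rw [← lintegral_add_right_eq_self _ (∑ k, b k * w k)]
      refine lintegral_congr fun a => ?_
      exact (lintegral_sub_right_eq_self (μ := volume)
        (fun M => peelKernel F (a + ∑ k, b k * w k) w b M)
        (fun i j => w i * b j : Fin m → Fin m → ℂ)).symm
    _ = ∫⁻ a : ℂ, ∫⁻ b : Fin m → ℂ, ∫⁻ Y : Fin m → Fin m → ℂ, ∫⁻ w : Fin m → ℂ,
        peelKernel F (a + ∑ k, b k * w k) w b (fun i j => Y i j - w i * b j) :=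
      (lintegral_perm_abYw (G := fun (a : ℂ) (b : Fin m → ℂ) (Y : Fin m → Fin m → ℂ)
        (w : Fin m → ℂ) =>
        peelKernel F (a + ∑ k, b k * w k) w b (fun i j => Y i j - w i * b j))
        (hK.comp (by fun_prop :
        Measurable fun p : ℂ × (Fin m → ℂ) × (Fin m → Fin m → ℂ) × (Fin m → ℂ) =>
          (p.1 + ∑ k, p.2.1 k * p.2.2.2 k, p.2.2.2, p.2.1,
            (fun i j => p.2.2.1 i j - p.2.2.2 i * p.2.1 j : Fin m → Fin m → ℂ))))).symm
    _ ≤ _ := ?_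
  · have hw : Measurable fun w : Fin m → ℂ => ENNReal.ofReal ((vecRad w ^ (2 * (m + 1)))⁻¹) := by
      unfold vecRad
      fun_prop
    have h3 : ∀ l : ℂ, ∫⁻ w : Fin m → ℂ, ENNReal.ofReal (Real.pi ^ m) *
        (ENNReal.ofReal (Real.exp (-‖l‖ ^ 2)) *
          matGauss m (peel F l)) * ENNReal.ofReal ((vecRad w ^ (2 * (m + 1)))⁻¹) =
        (ENNReal.ofReal (Real.pi ^ m) * ENNReal.ofReal (Real.pi ^ m / m.factorial)) *
          (ENNReal.ofReal (Real.exp (-‖l‖ ^ 2)) * matGauss m (peel F l)) := by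
      intro l
      rw [lintegral_const_mul _ hw, lintegral_vecRad]
      ring
    simp only [lintegral_peelKernel hF, h3]
    rw [lintegral_const_mul' _ _ (ENNReal.mul_ne_top ENNReal.ofReal_ne_top ENNReal.ofReal_ne_top)]
  -- The product inside `peel` is the Jacobian of `w ↦ eigenCol a b Y w`, and `peel` vanishes off
  -- the dominated set, where injectivity could fail.
  · refine lintegral_mono fun a => lintegral_mono fun b => lintegral_mono fun Y => ?_
    refine le_trans (le_of_eq ?_) (lintegral_eigenCol_le a b Y _)
    rw [← lintegral_indicator (measurableSet_dominated_section a b Y)]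
    refine lintegral_congr fun w => ?_
    by_cases h : w ∈ {w : Fin m → ℂ |
        (a + ∑ k, b k * w k, fun i j => Y i j - w i * b j) ∈ dominated m}
    · have h' : ∀ z ∈ spec fun i j => Y i j - w i * b j, ‖z‖ < ‖a + ∑ k, b k * w k‖ := h
      rw [Set.indicator_of_mem h, ← deflate_eigenCol, spec_deflate, peelKernel, peel, if_pos h',
        mul_assoc]
    · have h' : ¬ ∀ z ∈ spec fun i j => Y i j - w i * b j, ‖z‖ < ‖a + ∑ k, b k * w k‖ := h
      rw [Set.indicator_of_notMem h, peelKernel, peel, if_neg h', zero_mul, zero_mul]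

/-! ### The Vandermonde density and its comparison with the Gaussian integral -/

/-- The joint density (up to a constant) of the eigenvalues of a complex Gaussian matrix. -/
noncomputable def vdmWeight {n : ℕ} (z : Fin n → ℂ) : ℝ :=
  ‖(Matrix.vandermonde z).det‖ ^ 2 * Real.exp (-∑ i, ‖z i‖ ^ 2)

/-- The integral over `n` points of a symmetric function against `vdmWeight`. -/
noncomputable def coulomb (n : ℕ) (F : Multiset ℂ → ENNReal) : ENNReal :=
  ∫⁻ z : Fin n → ℂ, F (tupleMultiset z) * ENNReal.ofReal (vdmWeight z)

theorem vdmWeight_cons (l : ℂ) (z : Fin m → ℂ) :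
    vdmWeight (Fin.cons l z : Fin (m + 1) → ℂ) =
      ((tupleMultiset z).map fun x => ‖l - x‖ ^ 2).prod * Real.exp (-‖l‖ ^ 2) * vdmWeight z := by
  have h1 : ((tupleMultiset z).map fun x => ‖l - x‖ ^ 2).prod = ‖∏ i, (z i - l)‖ ^ 2 := by
    rw [tupleMultiset, Multiset.map_map, norm_prod, ← Finset.prod_pow]
    exact Finset.prod_congr rfl fun i _ => by rw [Function.comp, norm_sub_rev]
  have h2 : (Matrix.vandermonde (Fin.cons l z : Fin (m + 1) → ℂ)).det =
      (∏ i, (z i - l)) * (Matrix.vandermonde z).det := by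
    rw [Matrix.det_vandermonde, Matrix.det_vandermonde, Fin.prod_univ_succ]
    congr 1
    · rw [Fin.prod_Ioi_zero]
      simp
    · refine Finset.prod_congr rfl fun i _ => ?_
      rw [Fin.prod_Ioi_succ]
      simp
  rw [vdmWeight, vdmWeight, h1, h2, Fin.sum_univ_succ, norm_mul, neg_add, Real.exp_add]
  simp only [Fin.cons_zero, Fin.cons_succ]
  ring

theorem tupleMultiset_comp_perm {n : ℕ} (z : Fin n → ℂ) (e : Equiv.Perm (Fin n)) :
    tupleMultiset (z ∘ e) = tupleMultiset z := by
  rw [tupleMultiset, tupleMultiset, ← Multiset.map_map]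
  congr 1
  exact congrArg Finset.val (Finset.map_univ_equiv e)

theorem vdmWeight_comp_perm {n : ℕ} (z : Fin n → ℂ) (e : Equiv.Perm (Fin n)) :
    vdmWeight (z ∘ e) = vdmWeight z := by
  have h : Matrix.vandermonde (z ∘ e) = (Matrix.vandermonde z).submatrix e id := by
    ext i j
    simp [Matrix.vandermonde_apply]
  rw [vdmWeight, vdmWeight, h, Matrix.det_permute, norm_mul]
  congr 1
  · rcases Int.units_eq_one_or (Equiv.Perm.sign e) with h | h <;> simp [h]
  · rw [← Equiv.sum_comp e fun i => ‖z i‖ ^ 2]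
    rfl

theorem measurable_vdmWeight {n : ℕ} : Measurable fun z : Fin n → ℂ => vdmWeight z := by
  unfold vdmWeight
  refine Measurable.mul ?_ (by fun_prop)
  simp only [Matrix.det_vandermonde]
  fun_prop

theorem vdmWeight_nonneg {n : ℕ} (z : Fin n → ℂ) : 0 ≤ vdmWeight z := by
  unfold vdmWeight; positivity

/-- With one coordinate fixed, equality of moduli confines the other to a sphere, which is null. -/
theorem ae_norm_ne {n : ℕ} : ∀ᵐ z : Fin n → ℂ, ∀ i j, i ≠ j → ‖z i‖ ≠ ‖z j‖ := by
  cases n with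
  | zero => exact ae_of_all _ fun z i => i.elim0
  | succ n =>
    rw [ae_all_iff]
    intro i
    rw [ae_all_iff]
    intro j
    by_cases hij : i = j
    · simp [hij]
    obtain ⟨k, rfl⟩ := Fin.exists_succAbove_eq (Ne.symm hij)
    have hmp := volume_preserving_piFinSuccAbove (fun _ : Fin (n + 1) => ℂ) i
    have hset : MeasurableSet {p : ℂ × (Fin n → ℂ) | ‖p.1‖ = ‖p.2 k‖} :=
      measurableSet_eq_fun (by fun_prop) (by fun_prop)
    have hnull : (volume : Measure (ℂ × (Fin n → ℂ))) {p | ‖p.1‖ = ‖p.2 k‖} = 0 := by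
      rw [Measure.volume_eq_prod, Measure.measure_prod_null hset]
      refine ae_of_all _ fun l => ?_
      have h := (Measure.quasiMeasurePreserving_eval (fun _ : Fin n => (volume : Measure ℂ))
        k).preimage_null (Measure.addHaar_sphere volume 0 ‖l‖)
      refine measure_mono_null (fun z hz => ?_) h
      simpa using Eq.symm hz
    have h := hmp.preimage_null hnull
    rw [ae_iff]
    refine measure_mono_null (fun z hz => ?_) h
    simpa [MeasurableEquiv.piFinSuccAbove, Fin.insertNthEquiv, Fin.removeNth] using hz

/-- The tuples in which the modulus of the `k`-th entry is strictly largest. -/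
def topAt {n : ℕ} (k : Fin n) : Set (Fin n → ℂ) := {z | ∀ i, i ≠ k → ‖z i‖ < ‖z k‖}

theorem measurableSet_topAt {n : ℕ} (k : Fin n) : MeasurableSet (topAt k) := by
  have : topAt k = ⋂ i, {z : Fin n → ℂ | i ≠ k → ‖z i‖ < ‖z k‖} := by
    ext z; simp [topAt]
  rw [this]
  refine MeasurableSet.iInter fun i => ?_
  by_cases h : i = k
  · simp [h]
  · simp only [ne_eq, h, not_false_eq_true, forall_const]
    exact measurableSet_lt (by fun_prop) (by fun_prop)

theorem ae_exists_topAt : ∀ᵐ z : Fin (m + 1) → ℂ, ∃ k, z ∈ topAt k := by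
  filter_upwards [ae_norm_ne] with z hz
  obtain ⟨k, hk⟩ := Finite.exists_max fun i => ‖z i‖
  exact ⟨k, fun i hi => lt_of_le_of_ne (hk i) (hz i k hi)⟩

theorem lintegral_comp_perm {n : ℕ} (e : Equiv.Perm (Fin n)) {g : (Fin n → ℂ) → ENNReal}
    (hg : Measurable g) : ∫⁻ z, g (z ∘ e) = ∫⁻ z, g z := by
  have h := volume_measurePreserving_piCongrLeft (fun _ : Fin n => ℂ) e.symm
  rw [← h.lintegral_comp hg]
  refine lintegral_congr fun z => congrArg g ?_
  funext i
  have := MeasurableEquiv.piCongrLeft_apply_apply (β := fun _ : Fin n => ℂ) e.symm z (e i)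
  simpa using this.symm

/-- Almost every tuple has a strict maximum of the modulus, and by symmetry each of the `m + 1`
possible positions contributes the same integral. -/
theorem coulomb_le_topAt {F : Multiset ℂ → ENNReal}
    (hF : Measurable fun z : Fin (m + 1) → ℂ => F (tupleMultiset z)) :
    coulomb (m + 1) F ≤ (m + 1 : ℕ) * ∫⁻ z in topAt (0 : Fin (m + 1)),
      F (tupleMultiset z) * ENNReal.ofReal (vdmWeight z) := by
  classical
  set W : (Fin (m + 1) → ℂ) → ENNReal := fun z =>
    F (tupleMultiset z) * ENNReal.ofReal (vdmWeight z) with hW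
  have hWm : Measurable W := hF.mul measurable_vdmWeight.ennreal_ofReal
  have hk : ∀ k, ∫⁻ z in topAt k, W z = ∫⁻ z in topAt (0 : Fin (m + 1)), W z := by
    intro k
    rw [← lintegral_indicator (measurableSet_topAt k), ← lintegral_indicator (measurableSet_topAt 0),
      ← lintegral_comp_perm (Equiv.swap 0 k) (hWm.indicator (measurableSet_topAt 0))]
    refine lintegral_congr fun z => ?_
    have h1 : W (z ∘ Equiv.swap 0 k) = W z := by
      simp only [hW, tupleMultiset_comp_perm, vdmWeight_comp_perm]
    have h2 : z ∘ Equiv.swap 0 k ∈ topAt 0 ↔ z ∈ topAt k := by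
      simp only [topAt, Set.mem_ofPred_eq, Function.comp, Equiv.swap_apply_left]
      constructor
      · intro h i hi
        have := h (Equiv.swap 0 k i) (by
          intro h0; apply hi
          rw [Equiv.swap_apply_eq_iff.1 h0, Equiv.swap_apply_left])
        simpa using this
      · intro h i hi
        refine h _ fun h0 => hi ?_
        rw [Equiv.swap_apply_eq_iff.1 h0, Equiv.swap_apply_right]
    by_cases h : z ∈ topAt k
    · rw [Set.indicator_of_mem h, Set.indicator_of_mem (h2.2 h), h1]
    · rw [Set.indicator_of_notMem h, Set.indicator_of_notMem (fun h' => h (h2.1 h'))]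
  calc coulomb (m + 1) F ≤ ∫⁻ z, ∑ k, (topAt k).indicator W z := by
        refine lintegral_mono_ae ?_
        filter_upwards [ae_exists_topAt] with z hz
        obtain ⟨k, hk⟩ := hz
        calc W z = (topAt k).indicator W z := (Set.indicator_of_mem hk W).symm
          _ ≤ _ := Finset.single_le_sum (f := fun k => (topAt k).indicator W z)
            (fun _ _ => zero_le) (Finset.mem_univ k)
    _ = ∑ k, ∫⁻ z in topAt k, W z := by
        rw [lintegral_finsetSum _ fun k _ => hWm.indicator (measurableSet_topAt k)]
        exact Finset.sum_congr rfl fun k _ => lintegral_indicator (measurableSet_topAt k) _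
    _ = _ := by simp [hk]

/-- The constant relating `coulomb` to `matGauss`. -/
noncomputable def coulombConst : ℕ → ℝ
  | 0 => 1
  | m + 1 => Real.pi ^ m * (Real.pi ^ m / m.factorial) * coulombConst m / (m + 1 : ℕ)

theorem coulombConst_pos (n : ℕ) : 0 < coulombConst n := by
  induction n with
  | zero => exact one_pos
  | succ m ih => rw [coulombConst]; positivity

/-- Both integrals reduce to size `m` with the same function `peel F l`, the left one through
`vdmWeight_cons` on the tuples with dominant first entry. The recursion of `coulombConst` collects
the constants, including the factor `m + 1` for the position of the maximum. -/
theorem coulomb_le_matGauss (n : ℕ) {F : Multiset ℂ → ENNReal}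
    (hF : Measurable fun z : Fin n → ℂ => F (tupleMultiset z)) :
    ENNReal.ofReal (coulombConst n) * coulomb n F ≤ matGauss n F := by
  induction n generalizing F with
  | zero =>
    have h1 : ∀ z : Fin 0 → ℂ, F (tupleMultiset z) * ENNReal.ofReal (vdmWeight z) = F 0 := by
      intro z; simp [tupleMultiset, vdmWeight]
    have h2 : ∀ x : Fin 0 → Fin 0 → ℂ, F (spec x) *
        ENNReal.ofReal (Real.exp (-frobSq (Matrix.of x))) = F 0 := by
      intro x
      have : spec x = 0 := Multiset.card_eq_zero.1 (card_spec x)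
      simp [this, frobSq]
    have h3 : (volume : Measure (Fin 0 → ℂ)) Set.univ = 1 := by simp [volume_pi]
    have h4 : (volume : Measure (Fin 0 → Fin 0 → ℂ)) Set.univ = 1 := by simp [volume_pi]
    simp only [coulomb, matGauss, h1, h2, coulombConst, lintegral_const, h3, h4]
    simp
  | succ m ih =>
    refine le_trans ?_ (matGauss_succ_ge hF)
    have hpeel : ∀ l, Measurable fun z : Fin m → ℂ => peel F l (tupleMultiset z) := fun l =>
      Measurable.comp (g := fun p : ℂ × (Fin m → ℂ) => peel F p.1 (tupleMultiset p.2))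
        (measurable_peel hF) measurable_prodMk_left
    have hW : Measurable fun z : Fin (m + 1) → ℂ =>
        F (tupleMultiset z) * ENNReal.ofReal (vdmWeight z) :=
      hF.mul measurable_vdmWeight.ennreal_ofReal
    have htop : ∫⁻ z in topAt (0 : Fin (m + 1)), F (tupleMultiset z) * ENNReal.ofReal (vdmWeight z) =
        ∫⁻ l : ℂ, ENNReal.ofReal (Real.exp (-‖l‖ ^ 2)) * coulomb m (peel F l) := by
      have hmp := (volume_preserving_piFinSuccAbove (fun _ : Fin (m + 1) => ℂ) 0).symm
      have hI := hW.indicator (measurableSet_topAt (0 : Fin (m + 1)))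
      rw [← lintegral_indicator (measurableSet_topAt 0), ← hmp.lintegral_comp hI,
        Measure.volume_eq_prod]
      refine (lintegral_prod _ (hI.comp hmp.measurable).aemeasurable).trans ?_
      refine lintegral_congr fun l => ?_
      have hpv : Measurable fun z : Fin m → ℂ =>
          peel F l (tupleMultiset z) * ENNReal.ofReal (vdmWeight z) :=
        (hpeel l).mul measurable_vdmWeight.ennreal_ofReal
      rw [coulomb, ← lintegral_const_mul _ hpv]
      refine lintegral_congr fun z => ?_
      have hc : (MeasurableEquiv.piFinSuccAbove (fun _ : Fin (m + 1) => ℂ) 0).symm (l, z) =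
          (Fin.cons l z : Fin (m + 1) → ℂ) := by
        simp [MeasurableEquiv.piFinSuccAbove, Fin.insertNthEquiv]
      rw [Function.comp, hc]
      have hmem : (Fin.cons l z : Fin (m + 1) → ℂ) ∈ topAt 0 ↔
          ∀ x ∈ tupleMultiset z, ‖x‖ < ‖l‖ := by
        simp [topAt, Fin.forall_fin_succ, tupleMultiset]
      have hp : 0 ≤ ((tupleMultiset z).map fun x => ‖l - x‖ ^ 2).prod :=
        Multiset.prod_nonneg (by
          intro y hy
          obtain ⟨x, -, rfl⟩ := Multiset.mem_map.1 hy
          positivity)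
      rw [peel]
      by_cases h : ∀ x ∈ tupleMultiset z, ‖x‖ < ‖l‖
      · rw [if_pos h, Set.indicator_of_mem (hmem.2 h), tupleMultiset_cons, vdmWeight_cons,
          ENNReal.ofReal_mul (mul_nonneg hp (Real.exp_pos _).le), ENNReal.ofReal_mul hp]
        ring
      · rw [if_neg h, Set.indicator_of_notMem (fun h' => h (hmem.1 h'))]
        simp
    have h1 := coulomb_le_topAt hF
    rw [htop] at h1
    have h2 : ENNReal.ofReal (coulombConst (m + 1)) * (m + 1 : ℕ) =
        ENNReal.ofReal (Real.pi ^ m) * ENNReal.ofReal (Real.pi ^ m / m.factorial) *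
          ENNReal.ofReal (coulombConst m) := by
      have := (coulombConst_pos m).le
      rw [← ENNReal.ofReal_natCast, ← ENNReal.ofReal_mul (coulombConst_pos _).le,
        ← ENNReal.ofReal_mul (by positivity), ← ENNReal.ofReal_mul (by positivity), coulombConst]
      congr 1
      field_simp
    calc _ ≤ ENNReal.ofReal (coulombConst (m + 1)) * ((m + 1 : ℕ) *
          ∫⁻ l : ℂ, ENNReal.ofReal (Real.exp (-‖l‖ ^ 2)) * coulomb m (peel F l)) := by gcongr
      _ = ENNReal.ofReal (Real.pi ^ m) * ENNReal.ofReal (Real.pi ^ m / m.factorial) *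
          ∫⁻ l : ℂ, ENNReal.ofReal (Real.exp (-‖l‖ ^ 2)) *
            (ENNReal.ofReal (coulombConst m) * coulomb m (peel F l)) := by
        rw [← mul_assoc, h2, mul_assoc _ (ENNReal.ofReal (coulombConst m)),
          ← lintegral_const_mul' _ _ ENNReal.ofReal_ne_top]
        congr 1
        refine lintegral_congr fun l => by ring
      _ ≤ _ := by
        gcongr with l
        exact ih (hpeel l)

/-! ### Andréief's identity and determinants in the Fock basis -/

/-- For fixed `σ` the sum over `τ` is the determinant of `A` with rows permuted by `σ`, and the two
signs of `σ` cancel. -/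
theorem sum_perm_sum_perm_prod {n : ℕ} (A : Matrix (Fin n) (Fin n) ℂ) :
    ∑ σ : Equiv.Perm (Fin n), ∑ τ : Equiv.Perm (Fin n),
      ((Equiv.Perm.sign σ : ℤ) : ℂ) * ((Equiv.Perm.sign τ : ℤ) : ℂ) * ∏ i, A (σ i) (τ i) =
      n.factorial * A.det := by
  have h : ∀ σ : Equiv.Perm (Fin n), ∑ τ : Equiv.Perm (Fin n),
      ((Equiv.Perm.sign σ : ℤ) : ℂ) * ((Equiv.Perm.sign τ : ℤ) : ℂ) * ∏ i, A (σ i) (τ i) =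
      A.det := by
    intro σ
    have h1 := Matrix.det_apply' (A.submatrix σ id).transpose
    rw [Matrix.det_transpose, Matrix.det_permute] at h1
    have h2 : ((Equiv.Perm.sign σ : ℤ) : ℂ) * ((Equiv.Perm.sign σ : ℤ) : ℂ) = 1 := by
      rcases Int.units_eq_one_or (Equiv.Perm.sign σ) with h | h <;> simp [h]
    simp only [mul_assoc, ← Finset.mul_sum]
    simp only [Matrix.transpose_apply, Matrix.submatrix_apply, id] at h1
    rw [← h1, ← mul_assoc, h2, one_mul]
  simp only [h]
  simp [Fintype.card_perm]

theorem prod_mul_det_mul_conj_det {α : Type*} {n : ℕ} (f : α → ℂ) (ψ : Fin n → α → ℂ) (z : Fin n → α) :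
    (∏ i, f (z i)) * ((‖(Matrix.of fun i j => ψ j (z i)).det‖ ^ 2 : ℝ) : ℂ) =
      ∑ σ : Equiv.Perm (Fin n), ∑ τ : Equiv.Perm (Fin n),
        ((Equiv.Perm.sign σ : ℤ) : ℂ) * ((Equiv.Perm.sign τ : ℤ) : ℂ) *
          ∏ i, (f (z i) * (ψ (σ i) (z i) * (starRingEnd ℂ) (ψ (τ i) (z i)))) := by
  have h1 : (Matrix.of fun i j => ψ j (z i)).det =
      ∑ σ : Equiv.Perm (Fin n), ((Equiv.Perm.sign σ : ℤ) : ℂ) * ∏ i, ψ (σ i) (z i) := by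
    rw [← Matrix.det_transpose, Matrix.det_apply']
    rfl
  have h2 : (((‖(Matrix.of fun i j => ψ j (z i)).det‖ ^ 2 : ℝ)) : ℂ) =
      (Matrix.of fun i j => ψ j (z i)).det *
        (starRingEnd ℂ) (Matrix.of fun i j => ψ j (z i)).det := by
    rw [RCLike.mul_conj]
    push_cast
    rfl
  rw [h2, h1, map_sum, Finset.sum_mul_sum, Finset.mul_sum]
  refine Finset.sum_congr rfl fun σ _ => ?_
  rw [Finset.mul_sum]
  refine Finset.sum_congr rfl fun τ _ => ?_
  rw [Finset.prod_mul_distrib, Finset.prod_mul_distrib, map_mul, map_prod]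
  simp
  ring

section Andreief

variable {α : Type*} [MeasureSpace α] [SigmaFinite (volume : Measure α)] {n : ℕ}

theorem integrable_andreief {f : α → ℂ} {ψ : Fin n → α → ℂ}
    (hi : ∀ j k, Integrable fun z => f z * (ψ j z * (starRingEnd ℂ) (ψ k z))) :
    Integrable fun z : Fin n → α =>
      (∏ i, f (z i)) * ((‖(Matrix.of fun i j => ψ j (z i)).det‖ ^ 2 : ℝ) : ℂ) := by
  simp only [prod_mul_det_mul_conj_det]
  refine integrable_finsetSum _ fun σ _ => integrable_finsetSum _ fun τ _ => ?_
  exact (Integrable.fintype_prod (fun i => hi (σ i) (τ i))).const_mul _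

/-- Andréief's identity. -/
theorem integral_andreief {f : α → ℂ} {ψ : Fin n → α → ℂ}
    (hi : ∀ j k, Integrable fun z => f z * (ψ j z * (starRingEnd ℂ) (ψ k z))) :
    ∫ z : Fin n → α, (∏ i, f (z i)) * ((‖(Matrix.of fun i j => ψ j (z i)).det‖ ^ 2 : ℝ) : ℂ) =
      n.factorial * (Matrix.of fun j k => ∫ z, f z * (ψ j z * (starRingEnd ℂ) (ψ k z))).det := by
  simp only [prod_mul_det_mul_conj_det]
  have h1 : ∀ σ τ : Equiv.Perm (Fin n), Integrable fun z : Fin n → α =>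
      ((Equiv.Perm.sign σ : ℤ) : ℂ) * ((Equiv.Perm.sign τ : ℤ) : ℂ) *
        ∏ i, (f (z i) * (ψ (σ i) (z i) * (starRingEnd ℂ) (ψ (τ i) (z i)))) := fun σ τ =>
    (Integrable.fintype_prod (fun i => hi (σ i) (τ i))).const_mul _
  have h2 : ∀ σ : Equiv.Perm (Fin n), Integrable fun z : Fin n → α =>
      ∑ τ : Equiv.Perm (Fin n), ((Equiv.Perm.sign σ : ℤ) : ℂ) * ((Equiv.Perm.sign τ : ℤ) : ℂ) *
        ∏ i, (f (z i) * (ψ (σ i) (z i) * (starRingEnd ℂ) (ψ (τ i) (z i)))) := fun σ =>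
    integrable_finsetSum _ fun τ _ => h1 σ τ
  rw [integral_finsetSum _ fun σ _ => h2 σ, ← sum_perm_sum_perm_prod]
  refine Finset.sum_congr rfl fun σ _ => ?_
  rw [integral_finsetSum _ fun τ _ => h1 σ τ]
  refine Finset.sum_congr rfl fun τ _ => ?_
  rw [integral_const_mul, integral_fintype_prod_volume_eq_prod
    (f := fun i (w : α) => f w * (ψ (σ i) w * (starRingEnd ℂ) (ψ (τ i) w)))]
  rfl

end Andreief

/-- The orthonormal functions `z ^ j e ^ (-|z|² / 2) / √(π j!)`. -/
noncomputable def fockFun (j : ℕ) (z : ℂ) : ℂ :=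
  z ^ j * ((Real.exp (-‖z‖ ^ 2 / 2) / Real.sqrt (Real.pi * j.factorial) : ℝ) : ℂ)

theorem measurable_fockFun (j : ℕ) : Measurable (fockFun j) := by
  unfold fockFun
  fun_prop

theorem norm_fockFun_sq (j : ℕ) (z : ℂ) :
    ‖fockFun j z‖ ^ 2 = (‖z‖ ^ 2) ^ j * Real.exp (-‖z‖ ^ 2) / (Real.pi * j.factorial) := by
  rw [fockFun, norm_mul, norm_pow, Complex.norm_real, Real.norm_of_nonneg (by positivity), mul_pow,
    div_pow, Real.sq_sqrt (by positivity), ← Real.exp_nat_mul]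
  push_cast
  ring_nf

theorem integral_normSq_pow (j : ℕ) :
    ∫ z : ℂ, (‖z‖ ^ 2) ^ j * Real.exp (-‖z‖ ^ 2) = Real.pi * j.factorial := by
  have h := Complex.integral_rpow_mul_exp_neg_rpow (p := 2) (q := 2 * j) (by norm_num)
    (by have : (0 : ℝ) ≤ 2 * j := by positivity
        linarith)
  have h2 : ((2 : ℝ) * j + 2) / 2 = j + 1 := by ring
  rw [h2, Real.Gamma_nat_eq_factorial] at h
  rw [show Real.pi * j.factorial = 2 * Real.pi / 2 * j.factorial by ring, ← h]
  refine integral_congr_ae (ae_of_all _ fun z => ?_)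
  simp only
  rw [← pow_mul, show (2 : ℝ) * j = ((2 * j : ℕ) : ℝ) by push_cast; ring, Real.rpow_natCast,
    show (2 : ℝ) = ((2 : ℕ) : ℝ) by norm_num, Real.rpow_natCast]

theorem integrable_normSq_pow (j : ℕ) :
    Integrable fun z : ℂ => (‖z‖ ^ 2) ^ j * Real.exp (-‖z‖ ^ 2) := by
  by_contra h
  have h1 := integral_normSq_pow j
  rw [integral_undef h] at h1
  have : 0 < Real.pi * j.factorial := by positivity
  exact this.ne h1

theorem integrable_fockFun_sq (j : ℕ) : Integrable fun z => ‖fockFun j z‖ ^ 2 := by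
  simp only [norm_fockFun_sq]
  exact (integrable_normSq_pow j).div_const _

theorem integral_fockFun_sq (j : ℕ) : ∫ z, ‖fockFun j z‖ ^ 2 = 1 := by
  simp only [norm_fockFun_sq]
  rw [integral_div, integral_normSq_pow, div_self (by positivity)]

theorem integrable_fockFun_mul {f : ℂ → ℂ} (hf : Measurable f) (hb : ∀ z, ‖f z‖ ≤ 1) (j k : ℕ) :
    Integrable fun z => f z * (fockFun j z * (starRingEnd ℂ) (fockFun k z)) := by
  refine Integrable.mono' ((integrable_fockFun_sq j).add (integrable_fockFun_sq k)) ?_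
    (ae_of_all _ fun z => ?_)
  · exact (hf.mul ((measurable_fockFun j).mul
      (Complex.continuous_conj.measurable.comp (measurable_fockFun k)))).aestronglyMeasurable
  · rw [norm_mul, norm_mul, RCLike.norm_conj, Pi.add_apply]
    have h1 : ‖f z‖ * (‖fockFun j z‖ * ‖fockFun k z‖) ≤ 1 * (‖fockFun j z‖ * ‖fockFun k z‖) := by
      gcongr
      exact hb z
    nlinarith [sq_nonneg (‖fockFun j z‖ - ‖fockFun k z‖), sq_nonneg ‖fockFun j z‖,
      sq_nonneg ‖fockFun k z‖]

/-- Off-diagonal entries vanish for rotation invariant weights. -/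
theorem integral_fockFun_mul_eq_zero {f : ℂ → ℂ} (hf : ∀ z w : ℂ, ‖z‖ = ‖w‖ → f z = f w) {j k : ℕ}
    (hjk : j ≠ k) : ∫ z, f z * (fockFun j z * (starRingEnd ℂ) (fockFun k z)) = 0 := by
  -- Rotation by this angle multiplies the integrand by `e^(iπ) = -1`, so the integral equals its
  -- own negative.
  let t : ℝ := Real.pi / ((j : ℝ) - k)
  have hjk' : (j : ℝ) - k ≠ 0 := sub_ne_zero.2 (by exact_mod_cast hjk)
  let u : ℂ := Complex.exp (t * Complex.I)
  have hu : ‖u‖ = 1 := Complex.norm_exp_ofReal_mul_I t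
  have huu : u ^ j * (starRingEnd ℂ) u ^ k = -1 := by
    rw [← Complex.exp_conj, ← Complex.exp_nat_mul, ← Complex.exp_nat_mul, ← Complex.exp_add,
      ← Complex.exp_pi_mul_I]
    congr 1
    have : (t : ℂ) * ((j : ℂ) - k) = Real.pi := by
      rw [show (t : ℂ) * ((j : ℂ) - k) = ((t * ((j : ℝ) - k) : ℝ) : ℂ) by push_cast; ring]
      congr 1
      exact div_mul_cancel₀ _ hjk'
    simp only [map_mul, Complex.conj_ofReal, Complex.conj_I]
    linear_combination Complex.I * this
  have hrot : ∀ (i : ℕ) (z : ℂ), fockFun i (u * z) = u ^ i * fockFun i z := by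
    intro i z
    simp only [fockFun, norm_mul, hu, one_mul, mul_pow]
    ring
  have hmp := (rotation (Circle.exp t)).measurePreserving
  have h1 := hmp.integral_comp (rotation (Circle.exp t)).toHomeomorph.measurableEmbedding
    (fun z => f z * (fockFun j z * (starRingEnd ℂ) (fockFun k z)))
  have h2 : ∀ z, f (rotation (Circle.exp t) z) * (fockFun j (rotation (Circle.exp t) z) *
      (starRingEnd ℂ) (fockFun k (rotation (Circle.exp t) z))) =
      -(f z * (fockFun j z * (starRingEnd ℂ) (fockFun k z))) := by
    intro z
    have h3 : rotation (Circle.exp t) z = u * z := by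
      rw [rotation_apply, Circle.coe_exp]
    rw [h3, hrot, hrot, map_mul, map_pow, hf (u * z) z (by rw [norm_mul, hu, one_mul])]
    linear_combination f z * (fockFun j z * (starRingEnd ℂ) (fockFun k z)) * huu
  simp only [h2] at h1
  rw [integral_neg] at h1
  have h4 : (2 : ℂ) * ∫ z, f z * (fockFun j z * (starRingEnd ℂ) (fockFun k z)) = 0 := by
    linear_combination -h1
  simpa using h4

/-- The matrix of multiplication by `f` in the basis `fockFun`. -/
noncomputable def fockMat (n : ℕ) (f : ℂ → ℝ) : Matrix (Fin n) (Fin n) ℂ :=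
  Matrix.of fun j k => ∫ z, (f z : ℂ) * (fockFun j z * (starRingEnd ℂ) (fockFun k z))

theorem fockMat_radial (n : ℕ) {f : ℂ → ℝ} (hf : ∀ z w : ℂ, ‖z‖ = ‖w‖ → f z = f w) :
    fockMat n f = Matrix.diagonal fun j : Fin n => ((∫ z, f z * ‖fockFun j z‖ ^ 2 : ℝ) : ℂ) := by
  ext j k
  by_cases hjk : j = k
  · subst hjk
    rw [Matrix.diagonal_apply_eq, fockMat, Matrix.of_apply, ← integral_complex_ofReal]
    refine integral_congr_ae (ae_of_all _ fun z => ?_)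
    simp only
    rw [RCLike.mul_conj]
    push_cast
    rfl
  · rw [Matrix.diagonal_apply_ne _ hjk, fockMat, Matrix.of_apply]
    exact integral_fockFun_mul_eq_zero (f := fun z => (f z : ℂ))
      (fun z w h => by rw [hf z w h]) (fun h => hjk (Fin.ext h))

theorem fockMat_one (n : ℕ) : fockMat n (fun _ => 1) = 1 := by
  rw [fockMat_radial n fun _ _ _ => rfl]
  simp [integral_fockFun_sq]

theorem fockMat_one_sub (n : ℕ) {f : ℂ → ℝ} (hf : Measurable f) (h0 : ∀ z, 0 ≤ f z)
    (h1 : ∀ z, f z ≤ 1) : fockMat n (fun z => 1 - f z) = 1 - fockMat n f := by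
  rw [← fockMat_one n]
  ext j k
  simp only [fockMat, Matrix.of_apply, Matrix.sub_apply]
  rw [← integral_sub (integrable_fockFun_mul (by fun_prop) (by simp) _ _)
    (integrable_fockFun_mul (by fun_prop) (fun z => by
      rw [Complex.norm_real, Real.norm_of_nonneg (h0 z)]; exact h1 z) _ _)]
  refine integral_congr_ae (ae_of_all _ fun z => ?_)
  push_cast
  ring

/-- The normalization of `vdmWeight`. -/
noncomputable def coulombMass (n : ℕ) : ℝ :=
  n.factorial * ∏ j : Fin n, (Real.pi * (j : ℕ).factorial)

theorem coulombMass_pos (n : ℕ) : 0 < coulombMass n := by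
  unfold coulombMass
  positivity

/-- The Gaussian factors scale the rows of the Vandermonde matrix and the normalisations scale its
columns. -/
theorem vdmWeight_eq_fockFun {n : ℕ} (z : Fin n → ℂ) :
    vdmWeight z = (∏ j : Fin n, (Real.pi * (j : ℕ).factorial)) *
      ‖(Matrix.of fun i j : Fin n => fockFun j (z i)).det‖ ^ 2 := by
  have h : (Matrix.of fun i j : Fin n => fockFun j (z i)) =
      Matrix.diagonal (fun i => ((Real.exp (-‖z i‖ ^ 2 / 2) : ℝ) : ℂ)) * Matrix.vandermonde z *
        Matrix.diagonal (fun j : Fin n => ((Real.sqrt (Real.pi * (j : ℕ).factorial) : ℝ) : ℂ)⁻¹) := by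
    ext i j
    rw [Matrix.mul_diagonal, Matrix.diagonal_mul, Matrix.vandermonde_apply, Matrix.of_apply,
      fockFun]
    push_cast
    ring
  rw [h, Matrix.det_mul, Matrix.det_mul, Matrix.det_diagonal, Matrix.det_diagonal, norm_mul,
    norm_mul, norm_prod, norm_prod, mul_pow, mul_pow, ← Finset.prod_pow, ← Finset.prod_pow, vdmWeight,
    neg_eq_neg_one_mul, Finset.mul_sum, Real.exp_sum]
  have h1 : ∀ i, ‖((Real.exp (-‖z i‖ ^ 2 / 2) : ℝ) : ℂ)‖ ^ 2 = Real.exp (-1 * ‖z i‖ ^ 2) := by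
    intro i
    rw [Complex.norm_real, Real.norm_of_nonneg (Real.exp_pos _).le, ← Real.exp_nat_mul]
    congr 1
    push_cast
    ring
  have h2 : ∀ j : Fin n, ‖((Real.sqrt (Real.pi * (j : ℕ).factorial) : ℝ) : ℂ)⁻¹‖ ^ 2 =
      (Real.pi * (j : ℕ).factorial)⁻¹ := by
    intro j
    rw [norm_inv, Complex.norm_real, Real.norm_of_nonneg (Real.sqrt_nonneg _), inv_pow,
      Real.sq_sqrt (by positivity)]
  simp only [h1, h2, Finset.prod_inv_distrib]
  have h3 : (∏ j : Fin n, (Real.pi * (j : ℕ).factorial)) ≠ 0 := by positivity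
  field_simp

theorem prod_tupleMultiset_map {n : ℕ} (f : ℂ → ℝ) (z : Fin n → ℂ) :
    ((tupleMultiset z).map f).prod = ∏ i, f (z i) := by
  rw [tupleMultiset, Multiset.map_map]
  rfl

/-- The integral of a product function is a determinant. -/
theorem coulomb_prod (n : ℕ) {f : ℂ → ℝ} (hf : Measurable f) (h0 : ∀ z, 0 ≤ f z)
    (h1 : ∀ z, f z ≤ 1) :
    coulomb n (fun s => ENNReal.ofReal (s.map f).prod) =
      ENNReal.ofReal (coulombMass n * (fockMat n f).det.re) := by
  have hi : ∀ j k : Fin n, Integrable fun z =>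
      (f z : ℂ) * (fockFun j z * (starRingEnd ℂ) (fockFun k z)) := fun j k =>
    integrable_fockFun_mul (by fun_prop) (fun z => by
      rw [Complex.norm_real, Real.norm_of_nonneg (h0 z)]; exact h1 z) _ _
  have h2 : ∀ z : Fin n → ℂ, (∏ i, f (z i)) * vdmWeight z =
      (∏ j : Fin n, (Real.pi * (j : ℕ).factorial)) * ((∏ i, (f (z i) : ℂ)) *
        ((‖(Matrix.of fun i j : Fin n => fockFun j (z i)).det‖ ^ 2 : ℝ) : ℂ)).re := by
    intro z
    rw [vdmWeight_eq_fockFun, ← Complex.ofReal_prod, ← Complex.ofReal_mul, Complex.ofReal_re]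
    ring
  have hI := integrable_andreief (f := fun z => (f z : ℂ)) (ψ := fun j : Fin n => fockFun j) hi
  have h3 : ∫ z : Fin n → ℂ, (∏ i, f (z i)) * vdmWeight z =
      coulombMass n * (fockMat n f).det.re := by
    simp only [h2]
    rw [integral_const_mul]
    have := integral_andreief (f := fun z => (f z : ℂ)) (ψ := fun j : Fin n => fockFun j) hi
    rw [show ∫ z : Fin n → ℂ, ((∏ i, (f (z i) : ℂ)) *
        ((‖(Matrix.of fun i j : Fin n => fockFun j (z i)).det‖ ^ 2 : ℝ) : ℂ)).re =
        (∫ z : Fin n → ℂ, ((∏ i, (f (z i) : ℂ)) *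
        ((‖(Matrix.of fun i j : Fin n => fockFun j (z i)).det‖ ^ 2 : ℝ) : ℂ))).re from
        integral_re hI, this, coulombMass, fockMat, ← Complex.ofReal_natCast, Complex.re_ofReal_mul]
    ring
  rw [coulomb, ← h3, ofReal_integral_eq_lintegral_ofReal]
  · refine lintegral_congr fun z => ?_
    rw [prod_tupleMultiset_map, ENNReal.ofReal_mul (Finset.prod_nonneg fun i _ => h0 _)]
  · simp only [h2]
    exact hI.re.const_mul _
  · exact ae_of_all _ fun z => mul_nonneg (Finset.prod_nonneg fun i _ => h0 _) (vdmWeight_nonneg z)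

theorem coulomb_one (n : ℕ) : coulomb n (fun _ => 1) = ENNReal.ofReal (coulombMass n) := by
  have := coulomb_prod n (f := fun _ => 1) (by fun_prop) (by simp) (by simp)
  rw [fockMat_one] at this
  simpa using this

/-- The right side is the Gaussian integral over all matrices. This agreement of total masses is
what upgrades `coulomb_le_matGauss` to an equality. -/
theorem coulombConst_mul_mass (n : ℕ) : coulombConst n * coulombMass n = Real.pi ^ (n * n) := by
  induction n with
  | zero => simp [coulombConst, coulombMass]
  | succ m ih =>
    have h : coulombConst (m + 1) * coulombMass (m + 1) =
        Real.pi ^ (2 * m + 1) * (coulombConst m * coulombMass m) := by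
      rw [coulombConst, coulombMass, coulombMass, Fin.prod_univ_castSucc, Nat.factorial_succ]
      simp only [Fin.val_castSucc, Fin.val_last]
      push_cast
      have h1 : (m.factorial : ℝ) ≠ 0 := by positivity
      field_simp
      ring
    rw [h, ih, ← pow_add]
    congr 1
    ring

theorem matGauss_one (n : ℕ) : matGauss n (fun _ => 1) = ENNReal.ofReal (Real.pi ^ (n * n)) := by
  have h1 : ∀ x : Fin n → Fin n → ℂ, ENNReal.ofReal (Real.exp (-frobSq (Matrix.of x))) =
      ENNReal.ofReal (∏ i, ∏ j, Real.exp (-1 * ‖x i j‖ ^ 2)) := by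
    intro x
    simp only [frobSq, ← Real.exp_sum, neg_one_mul, Finset.sum_neg_distrib,
      Matrix.of_apply]
  have h2 : Integrable fun w : Fin n → ℂ => ∏ j, Real.exp (-1 * ‖w j‖ ^ 2) :=
    Integrable.fintype_prod fun _ => integrable_exp_neg_normSq one_pos
  have h3 : Integrable fun x : Fin n → Fin n → ℂ => ∏ i, ∏ j, Real.exp (-1 * ‖x i j‖ ^ 2) :=
    Integrable.fintype_prod fun _ => h2
  simp only [matGauss, one_mul]
  rw [lintegral_congr h1]
  rw [← ofReal_integral_eq_lintegral_ofReal h3 (ae_of_all _ fun x => by positivity),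
    integral_fintype_prod_volume_eq_pow (fun w : Fin n → ℂ => ∏ j, Real.exp (-1 * ‖w j‖ ^ 2)),
    integral_fintype_prod_volume_eq_pow (fun w : ℂ => Real.exp (-1 * ‖w‖ ^ 2)),
    integral_exp_neg_normSq one_pos]
  simp [pow_mul]

/-- The law of the spectrum of a Gaussian matrix. -/
theorem matGauss_eq_coulomb (n : ℕ) {F : Multiset ℂ → ENNReal}
    (hF : Measurable fun z : Fin n → ℂ => F (tupleMultiset z)) (hF1 : ∀ s, F s ≤ 1) :
    matGauss n F = ENNReal.ofReal (coulombConst n) * coulomb n F := by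
  have hF' : Measurable fun z : Fin n → ℂ => 1 - F (tupleMultiset z) := measurable_const.sub hF
  have ha := coulomb_le_matGauss n hF
  -- The lower bound holds for `F` and for `1 - F`; as the two sums of masses coincide and are
  -- finite, neither bound can be strict.
  have hb := coulomb_le_matGauss n (F := fun s => 1 - F s) hF'
  have hm : matGauss n F + matGauss n (fun s => 1 - F s) = ENNReal.ofReal (Real.pi ^ (n * n)) := by
    have h : Measurable fun x : Fin n → Fin n → ℂ =>
        F (spec x) * ENNReal.ofReal (Real.exp (-frobSq (Matrix.of x))) :=
      (measurable_comp_spec hF).mul (measurable_frobSq.neg.exp).ennreal_ofReal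
    rw [← matGauss_one, matGauss, matGauss, matGauss, ← lintegral_add_left h]
    refine lintegral_congr fun x => ?_
    rw [← add_mul, add_tsub_cancel_of_le (hF1 _)]
  have hc : ENNReal.ofReal (coulombConst n) * coulomb n F +
      ENNReal.ofReal (coulombConst n) * coulomb n (fun s => 1 - F s) =
      ENNReal.ofReal (Real.pi ^ (n * n)) := by
    have h : Measurable fun z : Fin n → ℂ => F (tupleMultiset z) * ENNReal.ofReal (vdmWeight z) :=
      hF.mul measurable_vdmWeight.ennreal_ofReal
    rw [← mul_add, ← coulombConst_mul_mass, ENNReal.ofReal_mul (coulombConst_pos n).le,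
      ← coulomb_one, coulomb, coulomb, coulomb,
      ← lintegral_add_left h]
    congr 1
    refine lintegral_congr fun z => ?_
    rw [← add_mul, add_tsub_cancel_of_le (hF1 _)]
  refine le_antisymm ?_ ha
  have hfin : ENNReal.ofReal (coulombConst n) * coulomb n (fun s => 1 - F s) ≠ ⊤ :=
    ne_top_of_le_ne_top ENNReal.ofReal_ne_top (hc ▸ le_add_self)
  refine (ENNReal.add_le_add_iff_right hfin).1 ?_
  rw [hc, ← hm]
  gcongr

/-! ### From the Ginibre matrix to the Vandermonde density -/

theorem pi_withDensity_ofReal {ι E : Type*} [Fintype ι] [MeasureSpace E]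
    [SigmaFinite (volume : Measure E)] {d : E → ℝ} (hd : Integrable d) (h0 : ∀ x, 0 ≤ d x) :
    (Measure.pi fun _ : ι => (volume : Measure E).withDensity fun x => ENNReal.ofReal (d x)) =
      (volume : Measure (ι → E)).withDensity fun x => ENNReal.ofReal (∏ i, d (x i)) := by
  classical
  have : IsFiniteMeasure ((volume : Measure E).withDensity fun x => ENNReal.ofReal (d x)) :=
    isFiniteMeasure_withDensity_ofReal hd.2
  refine Measure.pi_eq fun s hs => ?_
  have hpi : MeasurableSet (Set.univ.pi s) := MeasurableSet.univ_pi hs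
  have hprod : ∀ x : ι → E, (Set.univ.pi s).indicator (fun x => ∏ i, d (x i)) x =
      ∏ i, (s i).indicator d (x i) := by
    intro x
    by_cases h : x ∈ Set.univ.pi s
    · rw [Set.indicator_of_mem h]
      exact Finset.prod_congr rfl fun i _ => (Set.indicator_of_mem (h i trivial) d).symm
    · rw [Set.indicator_of_notMem h]
      simp only [Set.mem_univ_pi, not_forall] at h
      obtain ⟨i, hi⟩ := h
      exact (Finset.prod_eq_zero (Finset.mem_univ i) (Set.indicator_of_notMem hi d)).symm
  have hint : ∀ i, Integrable ((s i).indicator d) := fun i => hd.indicator (hs i)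
  rw [withDensity_apply _ hpi, ← lintegral_indicator hpi]
  have h1 : ∀ x : ι → E, (Set.univ.pi s).indicator (fun x => ENNReal.ofReal (∏ i, d (x i))) x =
      ENNReal.ofReal (∏ i, (s i).indicator d (x i)) := by
    intro x
    rw [← hprod]
    by_cases h : x ∈ Set.univ.pi s
    · rw [Set.indicator_of_mem h, Set.indicator_of_mem h]
    · rw [Set.indicator_of_notMem h, Set.indicator_of_notMem h, ENNReal.ofReal_zero]
  have hnn : ∀ i x, 0 ≤ (s i).indicator d x := fun i x => Set.indicator_nonneg (fun x _ => h0 x) x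
  rw [lintegral_congr h1, ← ofReal_integral_eq_lintegral_ofReal
    (by rw [volume_pi]; exact Integrable.fintype_prod fun i => hint i)
    (ae_of_all _ fun x => Finset.prod_nonneg fun i _ => hnn i _),
    integral_fintype_prod_volume_eq_prod (f := fun i => (s i).indicator d),
    ENNReal.ofReal_prod_of_nonneg fun i _ => integral_nonneg (hnn i)]
  refine Finset.prod_congr rfl fun i _ => ?_
  rw [withDensity_apply _ (hs i), integral_indicator (hs i),
    ofReal_integral_eq_lintegral_ofReal hd.integrableOn (ae_of_all _ h0)]

theorem stdComplexGaussian_eq :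
    stdComplexGaussian = (volume : Measure ℂ).withDensity
      fun z => ENNReal.ofReal (Real.pi⁻¹ * Real.exp (-1 * ‖z‖ ^ 2)) := by
  have hm : Measurable (gaussianPDF 0 (1 / 2)) := measurable_gaussianPDF _ _
  rw [stdComplexGaussian, gaussianReal_of_var_ne_zero _ (by norm_num), prod_withDensity hm hm]
  have hf : (fun p : ℝ × ℝ => (p.1 : ℂ) + (p.2 : ℂ) * Complex.I) =
      Complex.measurableEquivRealProd.symm := by
    funext p
    simp [Complex.measurableEquivRealProd, Complex.ext_iff]
  have hvp := Complex.volume_preserving_equiv_real_prod.symm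
  rw [hf]
  ext s hs
  rw [Measure.map_apply Complex.measurableEquivRealProd.symm.measurable hs,
    withDensity_apply _ (Complex.measurableEquivRealProd.symm.measurable hs),
    withDensity_apply _ hs, ← hvp.setLIntegral_comp_preimage hs (by fun_prop)]
  refine lintegral_congr fun p => ?_
  rw [gaussianPDF, gaussianPDF, ← ENNReal.ofReal_mul (gaussianPDFReal_nonneg _ _ _),
    gaussianPDFReal, gaussianPDFReal, ← hf]
  congr 1
  have hn : ‖(p.1 : ℂ) + (p.2 : ℂ) * Complex.I‖ ^ 2 = p.1 ^ 2 + p.2 ^ 2 := by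
    rw [← Complex.normSq_eq_norm_sq, Complex.normSq_add_mul_I]
  have h2 : ((1 / 2 : NNReal) : ℝ) = 1 / 2 := by simp
  have h3 : Real.sqrt (2 * Real.pi * (1 / 2)) = Real.sqrt Real.pi := by congr 1; ring
  rw [hn, h2, h3]
  have h4 : (Real.sqrt Real.pi)⁻¹ * (Real.sqrt Real.pi)⁻¹ = Real.pi⁻¹ := by
    rw [← mul_inv, Real.mul_self_sqrt Real.pi_pos.le]
  rw [mul_mul_mul_comm, h4, ← Real.exp_add]
  congr 2
  ring

/-- The density of a matrix with independent standard complex Gaussian entries. -/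
theorem pi_pi_stdComplexGaussian (n : ℕ) :
    (Measure.pi fun _ : Fin n => Measure.pi fun _ : Fin n => stdComplexGaussian) =
      (volume : Measure (Fin n → Fin n → ℂ)).withDensity
        fun x => ENNReal.ofReal ((Real.pi ^ (n * n))⁻¹ * Real.exp (-frobSq (Matrix.of x))) := by
  have h1 : Integrable fun z : ℂ => Real.pi⁻¹ * Real.exp (-1 * ‖z‖ ^ 2) :=
    (integrable_exp_neg_normSq one_pos).const_mul _
  have h2 : Integrable fun w : Fin n → ℂ => ∏ i, Real.pi⁻¹ * Real.exp (-1 * ‖w i‖ ^ 2) :=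
    Integrable.fintype_prod fun _ => h1
  rw [stdComplexGaussian_eq, pi_withDensity_ofReal h1 fun z => by positivity,
    pi_withDensity_ofReal h2 fun z => by positivity]
  congr 1
  funext x
  congr 1
  simp only [Finset.prod_mul_distrib, Finset.prod_const, Finset.card_univ, Fintype.card_fin,
    ← Real.exp_sum, frobSq, Matrix.of_apply, neg_one_mul, Finset.sum_neg_distrib]
  rw [← pow_mul, inv_pow]

/-- Independence of the entries is indexed by pairs, whereas matrices are integrated as functions of
two arguments. -/
theorem map_curry_pi (n : ℕ) (γ : Measure ℂ) [SigmaFinite γ] :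
    (Measure.pi fun _ : Fin n × Fin n => γ).map Function.curry =
      Measure.pi fun _ : Fin n => Measure.pi fun _ : Fin n => γ := by
  have h : (Measure.pi fun _ : Fin n × Fin n => γ) =
      (Measure.pi fun _ : Fin n => Measure.pi fun _ : Fin n => γ).map Function.uncurry := by
    refine Measure.pi_eq fun s hs => ?_
    rw [Measure.map_apply measurable_uncurry (MeasurableSet.univ_pi hs)]
    have : Function.uncurry ⁻¹' Set.univ.pi s =
        Set.univ.pi fun i : Fin n => Set.univ.pi fun j : Fin n => s (i, j) := by
      ext x
      simp
    rw [this, Measure.pi_pi]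
    simp only [Measure.pi_pi]
    rw [Fintype.prod_prod_type]
  rw [h, Measure.map_map measurable_curry measurable_uncurry]
  exact Measure.map_id

theorem isProbabilityMeasure_stdComplexGaussian : IsProbabilityMeasure stdComplexGaussian := by
  unfold stdComplexGaussian
  exact Measure.isProbabilityMeasure_map (by fun_prop)

theorem hasLaw_ginibre {Ω : Type*} [MeasurableSpace Ω] {P : Measure Ω} [IsProbabilityMeasure P]
    {n : ℕ} (hn : 0 < n) {X : Ω → Matrix (Fin n) (Fin n) ℂ} (hX : IsComplexGinibre P X) :
    HasLaw (fun ω (a b : Fin n) => X ω a b * (Real.sqrt n : ℂ))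
      ((volume : Measure (Fin n → Fin n → ℂ)).withDensity
        fun x => ENNReal.ofReal ((Real.pi ^ (n * n))⁻¹ * Real.exp (-frobSq (Matrix.of x)))) P := by
  have := isProbabilityMeasure_stdComplexGaussian
  have hs : (Real.sqrt n : ℂ) ≠ 0 := by
    have : 0 < Real.sqrt n := Real.sqrt_pos.2 (by exact_mod_cast hn)
    exact_mod_cast this.ne'
  have hlaw : ∀ ab : Fin n × Fin n, HasLaw (fun ω => X ω ab.1 ab.2 * (Real.sqrt n : ℂ))
      stdComplexGaussian P := by
    intro ab
    have h := hX.law ab.1 ab.2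
    refine ⟨h.aemeasurable.mul_const _, ?_⟩
    have h2 : P.map (fun ω => X ω ab.1 ab.2 * (Real.sqrt n : ℂ)) =
        (P.map fun ω => X ω ab.1 ab.2).map fun z => z * (Real.sqrt n : ℂ) :=
      (AEMeasurable.map_map_of_aemeasurable (g := fun z : ℂ => z * (Real.sqrt n : ℂ))
        (by fun_prop) h.aemeasurable).symm
    rw [h2, h.map_eq, Measure.map_map (by fun_prop) (by fun_prop)]
    convert Measure.map_id
    funext z
    simp [hs]
  have hind : iIndepFun (fun (ab : Fin n × Fin n) ω => X ω ab.1 ab.2 * (Real.sqrt n : ℂ)) P :=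
    hX.indep.comp (fun _ z => z * (Real.sqrt n : ℂ)) fun _ => by fun_prop
  have hpi := hind.hasLaw_pi hlaw
  refine ⟨?_, ?_⟩
  · exact measurable_curry.comp_aemeasurable hpi.aemeasurable
  · rw [← pi_pi_stdComplexGaussian, ← map_curry_pi, ← hpi.map_eq,
      AEMeasurable.map_map_of_aemeasurable measurable_curry.aemeasurable hpi.aemeasurable]
    rfl

/-- The two monic polynomials agree at every `t`, because `det (t - c x) = c^n det (t / c - x)`. -/
theorem spec_smul {n : ℕ} {c : ℂ} (hc : c ≠ 0) (x : Fin n → Fin n → ℂ) :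
    spec (fun a b => x a b * c) = (spec x).map fun z => z * c := by
  have h : (Matrix.of fun a b => x a b * c).charpoly =
      (((spec x).map fun z => z * c).map fun a => Polynomial.X - Polynomial.C a).prod := by
    refine Polynomial.funext fun t => ?_
    have h1 : Matrix.scalar (Fin n) t - Matrix.of (fun a b => x a b * c) =
        c • (Matrix.scalar (Fin n) (t / c) - Matrix.of x) := by
      ext a b
      simp only [Matrix.sub_apply, Matrix.smul_apply, Matrix.scalar_apply, Matrix.diagonal_apply,
        Matrix.of_apply, smul_eq_mul]
      split_ifs
      · field_simp
      · ring
    rw [Matrix.eval_charpoly, h1, Matrix.det_smul, det_scalar_sub, Fintype.card_fin,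
      Polynomial.eval_multiset_prod]
    have h2 : ∀ s : Multiset ℂ, c ^ s.card * (s.map fun z => t / c - z).prod =
        (((s.map fun z => z * c).map fun a => Polynomial.X - Polynomial.C a).map
          (Polynomial.eval t)).prod := by
      intro s
      induction s using Multiset.induction_on with
      | empty => simp
      | cons a s ih =>
        simp only [Multiset.map_cons, Multiset.prod_cons, Multiset.card_cons, ← ih]
        simp only [Polynomial.eval_sub, Polynomial.eval_X, Polynomial.eval_C]
        field_simp
        ring
    have h3 := h2 (spec x)
    rwa [card_spec] at h3
  conv_lhs => unfold spec
  rw [h, Polynomial.roots_multiset_prod_X_sub_C]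

/-- The law of the spectrum of a Ginibre matrix. -/
theorem lintegral_ginibre {Ω : Type*} [MeasurableSpace Ω] {P : Measure Ω} [IsProbabilityMeasure P]
    {n : ℕ} (hn : 0 < n) {X : Ω → Matrix (Fin n) (Fin n) ℂ} (hX : IsComplexGinibre P X)
    {σ : Ω → ℕ → ℂ} (hσ : ∀ ω, IsOrderedSpectrum (X ω) (σ ω)) {F : Multiset ℂ → ENNReal}
    (hF : Measurable fun z : Fin n → ℂ => F (tupleMultiset z)) (hF1 : ∀ s, F s ≤ 1) :
    AEMeasurable (fun ω => F ((Finset.Icc 1 n).val.map fun j => σ ω j * (Real.sqrt n : ℂ))) P ∧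
    ∫⁻ ω, F ((Finset.Icc 1 n).val.map fun j => σ ω j * (Real.sqrt n : ℂ)) ∂P =
      ENNReal.ofReal (coulombMass n)⁻¹ * coulomb n F := by
  have hs : (Real.sqrt n : ℂ) ≠ 0 := by
    have : 0 < Real.sqrt n := Real.sqrt_pos.2 (by exact_mod_cast hn)
    exact_mod_cast this.ne'
  have hspec : ∀ ω, ((Finset.Icc 1 n).val.map fun j => σ ω j * (Real.sqrt n : ℂ)) =
      spec fun a b => X ω a b * (Real.sqrt n : ℂ) := by
    intro ω
    have h := (hσ ω).roots_eq
    have h2 := spec_smul hs (fun a b => X ω a b)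
    rw [h2]
    unfold spec
    rw [show (Matrix.of fun a b => X ω a b) = X ω from rfl, h, Multiset.map_map]
    rfl
  simp only [hspec]
  have hlaw := hasLaw_ginibre hn hX
  have hm := measurable_comp_spec hF
  refine ⟨hm.comp_aemeasurable hlaw.aemeasurable, ?_⟩
  have hd : Measurable fun x : Fin n → Fin n → ℂ =>
      ENNReal.ofReal ((Real.pi ^ (n * n))⁻¹ * Real.exp (-frobSq (Matrix.of x))) :=
    (measurable_frobSq.neg.exp.const_mul _).ennreal_ofReal
  have h1 := hlaw.lintegral_comp (f := fun x => F (spec x)) hm.aemeasurable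
  have h2 : ∀ x : Fin n → Fin n → ℂ, ENNReal.ofReal ((Real.pi ^ (n * n))⁻¹ *
      Real.exp (-frobSq (Matrix.of x))) * F (spec x) = ENNReal.ofReal (Real.pi ^ (n * n))⁻¹ *
        (F (spec x) * ENNReal.ofReal (Real.exp (-frobSq (Matrix.of x)))) := by
    intro x
    rw [ENNReal.ofReal_mul (by positivity)]
    ring
  rw [h1, lintegral_withDensity_eq_lintegral_mul _ hd hm]
  simp only [Pi.mul_apply]
  rw [lintegral_congr h2, lintegral_const_mul' _ _ ENNReal.ofReal_ne_top, ← matGauss,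
    matGauss_eq_coulomb n hF hF1, ← mul_assoc, ← ENNReal.ofReal_mul (by positivity),
    ← coulombConst_mul_mass]
  congr 2
  have := coulombConst_pos n
  have := coulombMass_pos n
  field_simp

/-! ### Eigenvalue bounds for compressions and convergence of determinants -/

section DetBounds

variable {n : ℕ}

theorem fockMat_isHermitian (f : ℂ → ℝ) : (fockMat n f).IsHermitian := by
  ext j k
  rw [Matrix.conjTranspose_apply, fockMat, Matrix.of_apply, Matrix.of_apply, RCLike.star_def,
    ← integral_conj]
  refine integral_congr_ae (ae_of_all _ fun z => ?_)
  simp only [map_mul, Complex.conj_ofReal, Complex.conj_conj]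
  ring

/-- The combination of the functions `fockFun` with coefficients `star v`. -/
noncomputable def fockComb (v : Fin n → ℂ) (z : ℂ) : ℂ := ∑ j, star (v j) * fockFun j z

theorem integrable_fockMat {f : ℂ → ℝ} (hf : Measurable f) (h0 : ∀ z, 0 ≤ f z)
    (h1 : ∀ z, f z ≤ 1) (j k : ℕ) :
    Integrable fun z => (f z : ℂ) * (fockFun j z * (starRingEnd ℂ) (fockFun k z)) :=
  integrable_fockFun_mul (by fun_prop) (fun z => by
    rw [Complex.norm_real, Real.norm_of_nonneg (h0 z)]; exact h1 z) _ _

theorem fockComb_expand (f : ℂ → ℝ) (v : Fin n → ℂ) (z : ℂ) :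
    ((f z * ‖fockComb v z‖ ^ 2 : ℝ) : ℂ) = ∑ j, ∑ k, star (v j) * v k *
      ((f z : ℂ) * (fockFun j z * (starRingEnd ℂ) (fockFun k z))) := by
  have h : ((‖fockComb v z‖ ^ 2 : ℝ) : ℂ) = fockComb v z * (starRingEnd ℂ) (fockComb v z) := by
    rw [RCLike.mul_conj]; push_cast; rfl
  rw [Complex.ofReal_mul, h, fockComb, map_sum, Finset.sum_mul_sum, Finset.mul_sum]
  refine Finset.sum_congr rfl fun j _ => ?_
  rw [Finset.mul_sum]
  refine Finset.sum_congr rfl fun k _ => ?_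
  rw [map_mul, RCLike.star_def, Complex.conj_conj]
  ring

theorem integrable_fockComb {f : ℂ → ℝ} (hf : Measurable f) (h0 : ∀ z, 0 ≤ f z)
    (h1 : ∀ z, f z ≤ 1) (v : Fin n → ℂ) : Integrable fun z => f z * ‖fockComb v z‖ ^ 2 := by
  have h : Integrable fun z => ((f z * ‖fockComb v z‖ ^ 2 : ℝ) : ℂ) := by
    simp only [fockComb_expand]
    exact integrable_finsetSum _ fun j _ => integrable_finsetSum _ fun k _ =>
      (integrable_fockMat hf h0 h1 j k).const_mul _
  exact h.re

/-- As the compression of a multiplication operator, `fockMat n f` has a quadratic form that is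
visibly monotone in `f`. -/
theorem fockMat_quadratic {f : ℂ → ℝ} (hf : Measurable f) (h0 : ∀ z, 0 ≤ f z)
    (h1 : ∀ z, f z ≤ 1) (v : Fin n → ℂ) :
    (star v ⬝ᵥ (fockMat n f).mulVec v) = ((∫ z, f z * ‖fockComb v z‖ ^ 2 : ℝ) : ℂ) := by
  rw [← integral_complex_ofReal]
  simp only [fockComb_expand]
  have hI : ∀ j k : Fin n, Integrable fun z => star (v j) * v k *
      ((f z : ℂ) * (fockFun j z * (starRingEnd ℂ) (fockFun k z))) := fun j k =>
    (integrable_fockMat hf h0 h1 j k).const_mul _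
  have hI2 : ∀ j : Fin n, Integrable fun z => ∑ k : Fin n, star (v j) * v k *
      ((f z : ℂ) * (fockFun j z * (starRingEnd ℂ) (fockFun k z))) := fun j =>
    integrable_finsetSum _ fun k _ => hI j k
  rw [integral_finsetSum _ fun j _ => hI2 j]
  simp only [dotProduct, Matrix.mulVec, Pi.star_apply]
  refine Finset.sum_congr rfl fun j _ => ?_
  rw [integral_finsetSum _ fun k _ => hI j k, Finset.mul_sum]
  refine Finset.sum_congr rfl fun k _ => ?_
  rw [integral_const_mul, fockMat, Matrix.of_apply]
  ring

/-- The indicator of the complement of a disc. -/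
noncomputable def outside (T : ℝ) (z : ℂ) : ℝ := if T ≤ ‖z‖ ^ 2 then 1 else 0

theorem measurable_outside (T : ℝ) : Measurable (outside T) :=
  Measurable.ite (measurableSet_le measurable_const (by fun_prop)) measurable_const measurable_const

theorem outside_nonneg (T : ℝ) (z : ℂ) : 0 ≤ outside T z := by
  unfold outside; split_ifs <;> norm_num

theorem outside_le_one (T : ℝ) (z : ℂ) : outside T z ≤ 1 := by
  unfold outside; split_ifs <;> norm_num

theorem outside_radial (T : ℝ) (z w : ℂ) (h : ‖z‖ = ‖w‖) : outside T z = outside T w := by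
  rw [outside, outside, h]

/-- Chebyshev's inequality for the modulus under `fockFun j`. -/
theorem integral_outside_le {T : ℝ} (hT : (n : ℝ) < T) {j : ℕ} (hj : j < n) :
    ∫ z, outside T z * ‖fockFun j z‖ ^ 2 ≤ n / (T - n) ^ 2 := by
  have hjn : (j : ℝ) + 1 ≤ n := by exact_mod_cast hj
  have hpos : 0 < T - n := sub_pos.2 hT
  -- Under the probability density `‖fockFun j z‖²` the variable `‖z‖²` has a Gamma law of shape `j
  -- + 1`, so this is both its mean and its variance.
  let a : ℝ := j + 1
  have hg : ∀ z : ℂ, (‖z‖ ^ 2 - a) ^ 2 / (T - n) ^ 2 * ‖fockFun j z‖ ^ 2 =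
      (Real.pi * j.factorial)⁻¹ * ((T - n) ^ 2)⁻¹ *
        ((‖z‖ ^ 2) ^ (j + 2) * Real.exp (-‖z‖ ^ 2) -
          2 * a * ((‖z‖ ^ 2) ^ (j + 1) * Real.exp (-‖z‖ ^ 2)) +
          a ^ 2 * ((‖z‖ ^ 2) ^ j * Real.exp (-‖z‖ ^ 2))) := by
    intro z
    rw [norm_fockFun_sq]
    ring
  have i0 := fun k => integrable_normSq_pow k
  have i1 : Integrable fun z : ℂ => 2 * a * ((‖z‖ ^ 2) ^ (j + 1) * Real.exp (-‖z‖ ^ 2)) :=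
    (i0 _).const_mul _
  have i2 : Integrable fun z : ℂ => a ^ 2 * ((‖z‖ ^ 2) ^ j * Real.exp (-‖z‖ ^ 2)) :=
    (i0 _).const_mul _
  have i3 : Integrable fun z : ℂ => (‖z‖ ^ 2) ^ (j + 2) * Real.exp (-‖z‖ ^ 2) -
      2 * a * ((‖z‖ ^ 2) ^ (j + 1) * Real.exp (-‖z‖ ^ 2)) := (i0 _).sub i1
  have hi := i3.add i2
  have hint : ∫ z : ℂ, (‖z‖ ^ 2 - a) ^ 2 / (T - n) ^ 2 * ‖fockFun j z‖ ^ 2 = a / (T - n) ^ 2 := by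
    simp only [hg]
    rw [integral_const_mul, integral_add i3 i2, integral_sub (i0 _) i1, integral_const_mul, integral_const_mul,
      integral_normSq_pow, integral_normSq_pow, integral_normSq_pow, Nat.factorial_succ (j + 1),
      Nat.factorial_succ j]
    have h1 : (j.factorial : ℝ) ≠ 0 := by positivity
    have h2 := Real.pi_pos.ne'
    simp only [a]
    push_cast
    field_simp
    ring
  calc ∫ z, outside T z * ‖fockFun j z‖ ^ 2
      ≤ ∫ z : ℂ, (‖z‖ ^ 2 - a) ^ 2 / (T - n) ^ 2 * ‖fockFun j z‖ ^ 2 := by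
        refine integral_mono_of_nonneg (ae_of_all _ fun z =>
          mul_nonneg (outside_nonneg _ _) (by positivity)) ?_ (ae_of_all _ fun z => ?_)
        · simp only [hg]
          exact hi.const_mul _
        · simp only
          gcongr
          rw [outside]
          split_ifs with h
          · rw [one_le_div (by positivity)]
            have : T - n ≤ ‖z‖ ^ 2 - a := by simp only [a]; linarith
            gcongr
          · positivity
    _ = a / (T - n) ^ 2 := hint
    _ ≤ _ := by
        gcongr

/-- An eigenvalue is the quadratic form at a unit eigenvector, and increases if `f` is replaced by
`outside T`. That weight is radial, hence diagonal in the Fock basis, so the form becomes a convex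
combination of the integrals bounded in `integral_outside_le`. -/
theorem eigenvalues_fockMat_mem {f : ℂ → ℝ} (hf : Measurable f) (h0 : ∀ z, 0 ≤ f z)
    (h1 : ∀ z, f z ≤ 1) {T : ℝ} (hT : (n : ℝ) < T) (hfT : ∀ z, f z ≤ outside T z) (i : Fin n) :
    (fockMat_isHermitian (n := n) f).eigenvalues i ∈ Set.Icc (0 : ℝ) (n / (T - n) ^ 2) := by
  set hB := fockMat_isHermitian (n := n) f
  set v : Fin n → ℂ := (hB.eigenvectorBasis i).ofLp with hv
  have hnorm : ∑ j, ‖v j‖ ^ 2 = 1 := by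
    have := hB.eigenvectorBasis.orthonormal.1 i
    rw [hv, ← EuclideanSpace.norm_sq_eq, this, one_pow]
  have he : hB.eigenvalues i = ∫ z, f z * ‖fockComb v z‖ ^ 2 := by
    rw [hB.eigenvalues_eq, fockMat_quadratic hf h0 h1]
    exact Complex.ofReal_re _
  have hout : ∫ z, outside T z * ‖fockComb v z‖ ^ 2 =
      ∑ j, ‖v j‖ ^ 2 * ∫ z, outside T z * ‖fockFun j z‖ ^ 2 := by
    have h := fockMat_quadratic (n := n) (measurable_outside T) (outside_nonneg T)
      (outside_le_one T) v
    rw [fockMat_radial n (outside_radial T)] at h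
    have h2 : ((∑ j, ‖v j‖ ^ 2 * ∫ z, outside T z * ‖fockFun j z‖ ^ 2 : ℝ) : ℂ) =
        star v ⬝ᵥ (Matrix.diagonal fun j : Fin n =>
          ((∫ z, outside T z * ‖fockFun j z‖ ^ 2 : ℝ) : ℂ)).mulVec v := by
      rw [Complex.ofReal_sum]
      simp only [dotProduct, Matrix.mulVec_diagonal, Pi.star_apply]
      refine Finset.sum_congr rfl fun j _ => ?_
      have h3 : ((‖v j‖ ^ 2 : ℝ) : ℂ) = star (v j) * v j := by
        rw [RCLike.star_def, RCLike.conj_mul]; push_cast; rfl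
      rw [Complex.ofReal_mul, h3]
      ring
    rw [← h2] at h
    exact_mod_cast h.symm
  rw [he]
  constructor
  · exact integral_nonneg fun z => mul_nonneg (h0 z) (by positivity)
  · calc ∫ z, f z * ‖fockComb v z‖ ^ 2 ≤ ∫ z, outside T z * ‖fockComb v z‖ ^ 2 := by
          refine integral_mono (integrable_fockComb hf h0 h1 v) (integrable_fockComb
            (measurable_outside T) (outside_nonneg T) (outside_le_one T) v) fun z => ?_
          simp only
          gcongr
          exact hfT z
      _ = ∑ j, ‖v j‖ ^ 2 * ∫ z, outside T z * ‖fockFun j z‖ ^ 2 := hout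
      _ ≤ ∑ j, ‖v j‖ ^ 2 * (n / (T - n) ^ 2) := by
          gcongr with j
          exact integral_outside_le hT j.2
      _ = _ := by rw [← Finset.sum_mul, hnorm, one_mul]

theorem prod_one_sub_le {ι : Type*} [Fintype ι] {κ : ι → ℝ}
    (h1 : ∀ i, κ i ≤ 1) : ∏ i, (1 - κ i) ≤ Real.exp (-∑ i, κ i) := by
  rw [← Finset.sum_neg_distrib, Real.exp_sum]
  refine Finset.prod_le_prod (fun i _ => sub_nonneg.2 (h1 i)) fun i _ => ?_
  have := Real.add_one_le_exp (-κ i)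
  linarith

/-- Factor by factor, `log (1 - κ) ≥ 1 - 1 / (1 - κ) = -κ / (1 - κ) ≥ -κ / (1 - ε)`. -/
theorem le_prod_one_sub {ι : Type*} [Fintype ι] {κ : ι → ℝ} {ε : ℝ} (hε : ε < 1)
    (h0 : ∀ i, 0 ≤ κ i) (h1 : ∀ i, κ i ≤ ε) :
    Real.exp (-(∑ i, κ i) / (1 - ε)) ≤ ∏ i, (1 - κ i) := by
  have hpos : 0 < 1 - ε := sub_pos.2 hε
  rw [← Finset.sum_neg_distrib, Finset.sum_div, Real.exp_sum]
  refine Finset.prod_le_prod (fun i _ => (Real.exp_pos _).le) fun i _ => ?_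
  have hk : 0 < 1 - κ i := by linarith [h1 i]
  rw [← Real.le_log_iff_exp_le hk]
  have h2 := Real.one_sub_inv_le_log_of_pos hk
  have h3 : -κ i / (1 - ε) ≤ -κ i / (1 - κ i) := by
    rw [neg_div, neg_div, neg_le_neg_iff]
    have := h1 i
    have := h0 i
    gcongr
  have h4 : -κ i / (1 - κ i) = 1 - (1 - κ i)⁻¹ := by
    field_simp
    ring
  linarith

theorem det_one_sub_fockMat (f : ℂ → ℝ) :
    (1 - fockMat n f).det.re = ∏ i, (1 - (fockMat_isHermitian (n := n) f).eigenvalues i) := by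
  have h := Matrix.eval_charpoly (fockMat n f) 1
  rw [(fockMat_isHermitian f).charpoly_eq, Polynomial.eval_prod, map_one] at h
  rw [← h]
  have h2 : ∏ i, Polynomial.eval 1 (Polynomial.X - Polynomial.C
      (((fockMat_isHermitian (n := n) f).eigenvalues i : ℝ) : ℂ)) =
      ((∏ i, (1 - (fockMat_isHermitian (n := n) f).eigenvalues i) : ℝ) : ℂ) := by
    push_cast
    simp
  exact (congrArg Complex.re h2).trans (Complex.ofReal_re _)

theorem trace_fockMat (f : ℂ → ℝ) :
    ∑ i, (fockMat_isHermitian (n := n) f).eigenvalues i =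
      ∑ j : Fin n, ∫ z, f z * ‖fockFun j z‖ ^ 2 := by
  have h := (fockMat_isHermitian (n := n) f).trace_eq_sum_eigenvalues
  have h2 : (fockMat n f).trace = ((∑ j : Fin n, ∫ z, f z * ‖fockFun j z‖ ^ 2 : ℝ) : ℂ) := by
    rw [Complex.ofReal_sum, Matrix.trace]
    refine Finset.sum_congr rfl fun j _ => ?_
    rw [Matrix.diag, fockMat, Matrix.of_apply, ← integral_complex_ofReal]
    refine integral_congr_ae (ae_of_all _ fun z => ?_)
    simp only
    rw [RCLike.mul_conj]
    push_cast
    rfl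
  rw [h2] at h
  have h3 : ((∑ j : Fin n, ∫ z, f z * ‖fockFun j z‖ ^ 2 : ℝ) : ℂ) =
      ((∑ i, (fockMat_isHermitian (n := n) f).eigenvalues i : ℝ) : ℂ) := by
    rw [h]; push_cast; rfl
  exact_mod_cast h3.symm

end DetBounds

/-- If the weights vanish inside a disc carrying most of the mass and the traces converge, then the
Fredholm determinants converge. -/
theorem tendsto_det_one_sub {f : ℕ → ℂ → ℝ} {T : ℕ → ℝ} {c : ℝ} (hf : ∀ n, Measurable (f n))
    (h0 : ∀ n z, 0 ≤ f n z) (h1 : ∀ n z, f n z ≤ 1)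
    (hT : ∀ᶠ n : ℕ in atTop, (n : ℝ) < T n) (hfT : ∀ᶠ n in atTop, ∀ z, f n z ≤ outside (T n) z)
    (hε : Tendsto (fun n : ℕ => (n : ℝ) / (T n - n) ^ 2) atTop (𝓝 0))
    (hc : Tendsto (fun n => ∑ j : Fin n, ∫ z, f n z * ‖fockFun j z‖ ^ 2) atTop (𝓝 c)) :
    Tendsto (fun n => (1 - fockMat n (f n)).det.re) atTop (𝓝 (Real.exp (-c))) := by
  have hlow : Tendsto (fun n : ℕ => Real.exp (-(∑ j : Fin n, ∫ z, f n z * ‖fockFun j z‖ ^ 2) /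
      (1 - (n : ℝ) / (T n - n) ^ 2))) atTop (𝓝 (Real.exp (-c / (1 - 0)))) :=
    (Real.continuous_exp.tendsto _).comp (hc.neg.div (hε.const_sub 1) (by norm_num))
  rw [sub_zero, div_one] at hlow
  have hup : Tendsto (fun n : ℕ => Real.exp (-(∑ j : Fin n, ∫ z, f n z * ‖fockFun j z‖ ^ 2)))
      atTop (𝓝 (Real.exp (-c))) := (Real.continuous_exp.tendsto _).comp hc.neg
  have hε1 : ∀ᶠ n : ℕ in atTop, (n : ℝ) / (T n - n) ^ 2 < 1 := hε.eventually_lt_const one_pos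
  -- The eigenvalues lie in `[0, ε]` with `ε → 0`, so the product of the `1 - κ i` is squeezed
  -- between `exp (-tr / (1 - ε))` and `exp (-tr)`.
  refine tendsto_of_tendsto_of_tendsto_of_le_of_le' hlow hup ?_ ?_
  · filter_upwards [hT, hfT, hε1] with n hTn hfn hεn
    have hmem := eigenvalues_fockMat_mem (hf n) (h0 n) (h1 n) hTn hfn
    rw [det_one_sub_fockMat, ← trace_fockMat]
    exact le_prod_one_sub hεn (fun i => (hmem i).1) fun i => (hmem i).2
  · filter_upwards [hT, hfT, hε1] with n hTn hfn hεn
    have hmem := eigenvalues_fockMat_mem (hf n) (h0 n) (h1 n) hTn hfn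
    rw [det_one_sub_fockMat, ← trace_fockMat]
    exact prod_one_sub_le fun i => (hmem i).2.trans hεn.le

/-! ### Lower tails of Poisson variables -/

/-- The probability that a Poisson variable of parameter `s` is less than `n`. -/
noncomputable def poissonCdf (n : ℕ) (s : ℝ) : ℝ :=
  Real.exp (-s) * ∑ j ∈ Finset.range n, s ^ j / j.factorial

/-- The probability that a Poisson variable of parameter `s` equals `n`. -/
noncomputable def poissonMass (n : ℕ) (s : ℝ) : ℝ := Real.exp (-s) * (s ^ n / n.factorial)

theorem poissonCdf_nonneg (n : ℕ) {s : ℝ} (hs : 0 ≤ s) : 0 ≤ poissonCdf n s := by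
  unfold poissonCdf; positivity

theorem poissonCdf_succ (n : ℕ) (s : ℝ) :
    poissonCdf (n + 1) s = poissonCdf n s + poissonMass n s := by
  rw [poissonCdf, poissonCdf, poissonMass, Finset.sum_range_succ, mul_add]

theorem poissonMass_nonneg (n : ℕ) {s : ℝ} (hs : 0 ≤ s) : 0 ≤ poissonMass n s := by
  unfold poissonMass; positivity

theorem poissonMass_succ (n : ℕ) (s : ℝ) :
    poissonMass (n + 1) s * (n + 1) = poissonMass n s * s := by
  rw [poissonMass, poissonMass, Nat.factorial_succ]
  push_cast
  have : (n.factorial : ℝ) ≠ 0 := by positivity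
  have : (n : ℝ) + 1 ≠ 0 := by positivity
  field_simp
  ring

/-- This is the bound given by a geometric series of ratio `n / s`; the induction rests on `1 + n /
(s - n) = s / (s - n)`. -/
theorem poissonCdf_le {n : ℕ} {s : ℝ} (hs : (n : ℝ) < s) :
    poissonCdf n s ≤ poissonMass n s * (n / (s - n)) := by
  induction n with
  | zero => simp [poissonCdf]
  | succ n ih =>
    push_cast at hs ⊢
    have h1 : (n : ℝ) < s := by linarith
    have hn : (0 : ℝ) ≤ n := n.cast_nonneg
    have hp := poissonMass_nonneg n (hn.trans h1.le)
    have h2 : poissonMass (n + 1) s * ((n + 1) / (s - (n + 1))) =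
        poissonMass n s * (s / (s - (n + 1))) := by
      rw [← mul_div_assoc, poissonMass_succ, mul_div_assoc]
    have h3 : 1 + n / (s - n) = s / (s - n) := by
      have : s - n ≠ 0 := by linarith
      field_simp
      ring
    have h4 : s / (s - n) ≤ s / (s - (n + 1)) :=
      div_le_div_of_nonneg_left (by linarith) (by linarith) (by linarith)
    rw [poissonCdf_succ, h2]
    nlinarith [ih h1, mul_le_mul_of_nonneg_left h4 hp]

/-- The companion of `poissonCdf_le`, smaller by the factor `1 / (1 + s / (s - n)²)`, which tends to
one in the regime of interest. This form closes under induction, since adding one to the coefficient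
gives `s (s - n + 1) / ((s - n)² + s)`. -/
theorem le_poissonCdf {n : ℕ} {s : ℝ} (hs : (n : ℝ) < s) :
    poissonMass n s * (n * (s - n) / ((s - n) ^ 2 + s)) ≤ poissonCdf n s := by
  induction n with
  | zero => simp [poissonCdf]
  | succ n ih =>
    push_cast at hs ⊢
    have h1 : (n : ℝ) < s := by linarith
    have hn : (0 : ℝ) ≤ n := n.cast_nonneg
    have hp := poissonMass_nonneg n (hn.trans h1.le)
    have h2 : poissonMass (n + 1) s * ((n + 1) * (s - (n + 1)) / ((s - (n + 1)) ^ 2 + s)) =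
        poissonMass n s * (s * ((s - (n + 1)) / ((s - (n + 1)) ^ 2 + s))) := by
      rw [mul_div_assoc, ← mul_assoc, poissonMass_succ, mul_assoc]
    have hs0 : 0 < s := hn.trans_lt h1
    have h3 : 1 + n * (s - n) / ((s - n) ^ 2 + s) = s * ((s - n + 1) / ((s - n) ^ 2 + s)) := by
      have : (s - n) ^ 2 + s ≠ 0 := by positivity
      field_simp
      ring
    have h4 : (s - (n + 1)) / ((s - (n + 1)) ^ 2 + s) ≤ (s - n + 1) / ((s - n) ^ 2 + s) := by
      rw [div_le_div_iff₀ (by positivity) (by positivity)]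
      nlinarith
    have h5 := mul_le_mul_of_nonneg_left (mul_le_mul_of_nonneg_left h4 hs0.le) hp
    rw [poissonCdf_succ, h2]
    refine h5.trans ?_
    rw [← h3, mul_add, mul_one, add_comm]
    exact add_le_add_left (ih h1) _

/-- For `j < n` one has `(s' / s)^j ≤ exp (n (s' - s) / s)`; against the gain `exp (-(s' - s))` this
leaves the rate `(s - n) / s`. -/
theorem poissonCdf_le_exp (n : ℕ) {s s' : ℝ} (hs : 0 < s) (hs' : s ≤ s') :
    poissonCdf n s' ≤ poissonCdf n s * Real.exp (-((s - n) / s * (s' - s))) := by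
  have h1 : s' / s ≤ Real.exp ((s' - s) / s) := by
    have := Real.add_one_le_exp ((s' - s) / s)
    have h : (s' - s) / s + 1 = s' / s := by field_simp; ring
    rwa [h] at this
  have h1' : 1 ≤ s' / s := (one_le_div hs).2 hs'
  have h2 : ∀ j ∈ Finset.range n, s' ^ j / j.factorial ≤
      Real.exp (n * ((s' - s) / s)) * (s ^ j / j.factorial) := by
    intro j hj
    have h3 : s' ^ j = (s' / s) ^ j * s ^ j := by rw [div_pow]; field_simp
    have h4 : (s' / s) ^ j ≤ Real.exp (n * ((s' - s) / s)) :=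
      calc (s' / s) ^ j ≤ (s' / s) ^ n :=
            pow_le_pow_right₀ h1' (Finset.mem_range.1 hj).le
        _ ≤ Real.exp ((s' - s) / s) ^ n := pow_le_pow_left₀ (by linarith) h1 _
        _ = _ := by rw [← Real.exp_nat_mul]
    rw [h3, mul_div_assoc]
    gcongr
  have h5 : Real.exp (-s') * Real.exp (n * ((s' - s) / s)) =
      Real.exp (-s) * Real.exp (-((s - n) / s * (s' - s))) := by
    rw [← Real.exp_add, ← Real.exp_add]
    congr 1
    field_simp
    ring
  calc poissonCdf n s' ≤ Real.exp (-s') * ∑ j ∈ Finset.range n,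
        Real.exp (n * ((s' - s) / s)) * (s ^ j / j.factorial) := by
        unfold poissonCdf
        gcongr with j hj
        exact h2 j hj
    _ = _ := by
        rw [← Finset.mul_sum, ← mul_assoc, h5, poissonCdf]
        ring

theorem continuous_poissonCdf (n : ℕ) : Continuous (poissonCdf n) := by
  unfold poissonCdf; fun_prop

/-! ### Asymptotics of the scaling and of the intensity -/

theorem tendsto_log_natCast : Tendsto (fun n : ℕ => Real.log n) atTop atTop :=
  Real.tendsto_log_atTop.comp tendsto_natCast_atTop_atTop

theorem tendsto_gammaSeq_div_log : Tendsto (fun n : ℕ => gammaSeq n / Real.log n) atTop (𝓝 1) := by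
  have h1 : Tendsto (fun x : ℝ => Real.log x / x) atTop (𝓝 0) :=
    Real.isLittleO_log_id_atTop.tendsto_div_nhds_zero
  have h2 := (h1.comp tendsto_log_natCast).const_mul 2
  have h3 : Tendsto (fun n : ℕ => Real.log (2 * Real.pi) / Real.log n) atTop (𝓝 0) :=
    tendsto_const_nhds.div_atTop tendsto_log_natCast
  have h4 := ((tendsto_const_nhds (x := (1 : ℝ))).sub h2).sub h3
  rw [mul_zero, sub_zero, sub_zero] at h4
  refine h4.congr' ?_
  filter_upwards [tendsto_log_natCast.eventually_gt_atTop 0] with n hn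
  simp only [Function.comp, gammaSeq]
  field_simp

theorem tendsto_gammaSeq : Tendsto gammaSeq atTop atTop := by
  have h := tendsto_gammaSeq_div_log.pos_mul_atTop one_pos tendsto_log_natCast
  refine h.congr' ?_
  filter_upwards [tendsto_log_natCast.eventually_gt_atTop 0] with n hn
  field_simp

theorem tendsto_gammaSeq_pow_div (k : ℕ) :
    Tendsto (fun n : ℕ => gammaSeq n ^ k / n) atTop (𝓝 0) := by
  have h1 : Tendsto (fun x : ℝ => Real.log x ^ k / x) atTop (𝓝 0) :=
    (Real.isLittleO_pow_log_id_atTop (n := k)).tendsto_div_nhds_zero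
  have h2 := (tendsto_gammaSeq_div_log.pow k).mul (h1.comp tendsto_natCast_atTop_atTop)
  rw [mul_zero] at h2
  refine h2.congr' ?_
  filter_upwards [tendsto_log_natCast.eventually_gt_atTop 0] with n hn
  simp only [Function.comp]
  rw [div_pow, mul_div_assoc', div_mul_cancel₀ _ (pow_ne_zero _ hn.ne')]

/-- The ratio `√(γ_n / n)`. -/
noncomputable def gapSeq (n : ℕ) : ℝ := Real.sqrt (gammaSeq n / n)

theorem tendsto_gapSeq : Tendsto gapSeq atTop (𝓝 0) := by
  have h := tendsto_gammaSeq_pow_div 1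
  simp only [pow_one] at h
  have h2 := (Real.continuous_sqrt.tendsto _).comp h
  rwa [Real.sqrt_zero] at h2

theorem tendsto_gammaSeq_mul_gapSeq : Tendsto (fun n => gammaSeq n * gapSeq n) atTop (𝓝 0) := by
  have h := (Real.continuous_sqrt.tendsto _).comp (tendsto_gammaSeq_pow_div 3)
  rw [Real.sqrt_zero] at h
  refine h.congr' ?_
  filter_upwards [tendsto_gammaSeq.eventually_gt_atTop 0] with n hn
  simp only [Function.comp, gapSeq]
  rw [show gammaSeq n ^ 3 / n = gammaSeq n ^ 2 * (gammaSeq n / n) by ring,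
    Real.sqrt_mul (by positivity), Real.sqrt_sq hn.le]

theorem gapSeq_pos {n : ℕ} (hn : 0 < n) (hg : 0 < gammaSeq n) : 0 < gapSeq n := by
  have : (0 : ℝ) < n := by exact_mod_cast hn
  exact Real.sqrt_pos.2 (by positivity)

theorem gapSeq_sq {n : ℕ} (hn : 0 < n) (hg : 0 < gammaSeq n) :
    n * gapSeq n ^ 2 = gammaSeq n := by
  have : (0 : ℝ) < n := by exact_mod_cast hn
  rw [gapSeq, Real.sq_sqrt (by positivity)]
  field_simp

/-- With `δ = gapSeq n` and `n δ² = γ_n`, the square roots of the scaling become rational in `δ` and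
`γ_n`; all later estimates are made in these two quantities. -/
theorem sqrt_four_mul {n : ℕ} (hn : 0 < n) (hg : 0 < gammaSeq n) :
    Real.sqrt (4 * n * gammaSeq n) = 2 * gammaSeq n / gapSeq n := by
  have h1 := gapSeq_pos hn hg
  have h2 := gapSeq_sq hn hg
  have : (0 : ℝ) < n := by exact_mod_cast hn
  rw [Real.sqrt_eq_iff_mul_self_eq (by positivity) (by positivity)]
  field_simp
  linear_combination 4 * h2

theorem sqrt_div_four {n : ℕ} : Real.sqrt (gammaSeq n / (4 * n)) = gapSeq n / 2 := by
  rw [gapSeq, show gammaSeq n / (4 * n) = gammaSeq n / n / 2 ^ 2 by ring, Real.sqrt_div' _ (by norm_num),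
    Real.sqrt_sq (by norm_num)]

theorem scaledRadius_eq {n : ℕ} (hn : 0 < n) (hg : 0 < gammaSeq n) (r : ℝ) :
    scaledRadius n r = 1 + gapSeq n / 2 * (1 + r / gammaSeq n) := by
  have h1 := gapSeq_pos hn hg
  rw [scaledRadius, sqrt_four_mul hn hg, sqrt_div_four]
  field_simp
  ring

theorem eventually_good : ∀ᶠ n : ℕ in atTop, 0 < n ∧ 0 < gammaSeq n ∧ 0 < Real.log n :=
  (eventually_gt_atTop 0).and ((tendsto_gammaSeq.eventually_gt_atTop 0).and
    (tendsto_log_natCast.eventually_gt_atTop 0))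

section Limits

variable (r : ℝ)

theorem tendsto_one_add_div : Tendsto (fun n => 1 + r / gammaSeq n) atTop (𝓝 1) := by
  have : Tendsto (fun n => r / gammaSeq n) atTop (𝓝 0) :=
    tendsto_const_nhds.div_atTop tendsto_gammaSeq
  simpa using this.const_add 1

theorem tendsto_scaledRadius : Tendsto (fun n => scaledRadius n r) atTop (𝓝 1) := by
  have h := ((tendsto_gapSeq.div_const 2).mul (tendsto_one_add_div r)).const_add 1
  norm_num at h
  refine h.congr' ?_
  filter_upwards [eventually_good] with n hn
  rw [scaledRadius_eq hn.1 hn.2.1]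

theorem tendsto_scaledRadius_sq_sub :
    Tendsto (fun n => (scaledRadius n r ^ 2 - 1) / gapSeq n) atTop (𝓝 1) := by
  have h := (tendsto_one_add_div r).mul (((tendsto_gapSeq.mul (tendsto_one_add_div r)).div_const
    4).const_add 1)
  norm_num at h
  refine h.congr' ?_
  filter_upwards [eventually_good] with n hn
  rw [scaledRadius_eq hn.1 hn.2.1]
  have := gapSeq_pos hn.1 hn.2.1
  field_simp
  ring

theorem eventually_one_lt_scaledRadius : ∀ᶠ n in atTop, 1 < scaledRadius n r := by
  filter_upwards [eventually_good, (tendsto_one_add_div r).eventually_const_lt one_pos]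
    with n hn h2
  rw [scaledRadius_eq hn.1 hn.2.1]
  have := gapSeq_pos hn.1 hn.2.1
  have : 0 < gapSeq n / 2 * (1 + r / gammaSeq n) := by positivity
  linarith

/-- Since `scaledRadius n r ^ 2 - 1` is equivalent to `gapSeq n`, the quotient is equivalent to `1 /
γ_n`. It is the Chebyshev bound on the eigenvalues of the compression. -/
theorem tendsto_div_sq : Tendsto (fun n : ℕ => (n : ℝ) / (n * scaledRadius n r ^ 2 - n) ^ 2) atTop
    (𝓝 0) := by
  have h1 := ((tendsto_scaledRadius_sq_sub r).pow 2).inv₀ (by norm_num)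
  have h2 := tendsto_gammaSeq.inv_tendsto_atTop.mul h1
  rw [zero_mul] at h2
  refine h2.congr' ?_
  filter_upwards [eventually_good, eventually_one_lt_scaledRadius r] with n hn hx
  have h3 := gapSeq_pos hn.1 hn.2.1
  have h4 := gapSeq_sq hn.1 hn.2.1
  have h5 : (0 : ℝ) < n := by exact_mod_cast hn.1
  have h6 : 0 < scaledRadius n r ^ 2 - 1 := by nlinarith
  rw [show (n : ℝ) * scaledRadius n r ^ 2 - n = n * (scaledRadius n r ^ 2 - 1) by ring,
    Pi.inv_apply, ← h4]
  field_simp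

theorem abs_log_one_add_le {y : ℝ} (hy : |y| < 1) :
    |Real.log (1 + y) - y + y ^ 2 / 2| ≤ |y| ^ 3 / (1 - |y|) := by
  have h := Real.abs_log_sub_add_sum_range_le (x := -y) (by rwa [abs_neg]) 2
  rw [abs_neg] at h
  convert h using 2
  simp [Finset.sum_range_succ]
  ring

/-- For a radius `1 + y` the bracket is `2 y² + O(y³)`. Here `2 n y² = (γ_n / 2) (1 + r / γ_n)² =
γ_n / 2 + r + r² / (2 γ_n)`, and the cubic error is of order `γ_n · gapSeq n`, which tends to zero.
-/
theorem tendsto_rate : Tendsto (fun n : ℕ => n * (scaledRadius n r ^ 2 - 1 -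
    2 * Real.log (scaledRadius n r)) - gammaSeq n / 2) atTop (𝓝 r) := by
  have hy0 : Tendsto (fun n => scaledRadius n r - 1) atTop (𝓝 0) := by
    simpa using (tendsto_scaledRadius r).sub_const 1
  have hy : Tendsto (fun n => |scaledRadius n r - 1|) atTop (𝓝 0) := by simpa using hy0.abs
  have herr : Tendsto (fun n : ℕ => 2 * (n * |scaledRadius n r - 1| ^ 3 /
      (1 - |scaledRadius n r - 1|))) atTop (𝓝 0) := by
    have h1 := (tendsto_gammaSeq_mul_gapSeq.mul (((tendsto_one_add_div r).abs).pow 3)).div_const 8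
    have h2 := (h1.div (hy.const_sub 1) (by norm_num)).const_mul 2
    norm_num at h2
    refine h2.congr' ?_
    filter_upwards [eventually_good] with n hn
    have h3 := gapSeq_pos hn.1 hn.2.1
    have h4 := gapSeq_sq hn.1 hn.2.1
    congr 2
    rw [scaledRadius_eq hn.1 hn.2.1, add_sub_cancel_left, abs_mul, abs_of_pos (half_pos h3), ← h4]
    ring
  have hmain : Tendsto (fun n => r + r ^ 2 / 2 * (gammaSeq n)⁻¹) atTop (𝓝 r) := by
    simpa using (tendsto_gammaSeq.inv_tendsto_atTop.const_mul (r ^ 2 / 2)).const_add r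
  have hdiff : Tendsto (fun n : ℕ => n * (scaledRadius n r ^ 2 - 1 -
      2 * Real.log (scaledRadius n r)) - gammaSeq n / 2 - (r + r ^ 2 / 2 * (gammaSeq n)⁻¹))
      atTop (𝓝 0) := by
    refine squeeze_zero_norm' ?_ herr
    filter_upwards [eventually_good, hy.eventually_lt_const one_pos] with n hn hy1
    have h3 := gapSeq_pos hn.1 hn.2.1
    have h4 := gapSeq_sq hn.1 hn.2.1
    have h5 := abs_log_one_add_le hy1
    have h6 := hn.2.1
    set y := scaledRadius n r - 1 with hyd
    have hx : scaledRadius n r = 1 + y := by rw [hyd]; ring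
    have hy2 : 2 * n * y ^ 2 = gammaSeq n / 2 + (r + r ^ 2 / 2 * (gammaSeq n)⁻¹) := by
      rw [hyd, scaledRadius_eq hn.1 hn.2.1, add_sub_cancel_left, mul_pow, div_pow,
        show 2 * (n : ℝ) * (gapSeq n ^ 2 / 2 ^ 2 * (1 + r / gammaSeq n) ^ 2) =
          n * gapSeq n ^ 2 / 2 * (1 + r / gammaSeq n) ^ 2 by ring, h4]
      field_simp
      ring
    rw [hx, Real.norm_eq_abs, show n * ((1 + y) ^ 2 - 1 - 2 * Real.log (1 + y)) - gammaSeq n / 2 -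
      (r + r ^ 2 / 2 * (gammaSeq n)⁻¹) = -(2 * (n * (Real.log (1 + y) - y + y ^ 2 / 2))) by
        linear_combination hy2]
    rw [abs_neg, abs_mul, abs_mul, abs_two, Nat.abs_cast, mul_div_assoc]
    gcongr
  simpa using hdiff.add hmain

theorem tendsto_stirling : Tendsto (fun n : ℕ => Real.sqrt (2 * Real.pi * n) *
    (n ^ n * Real.exp (-n) / n.factorial)) atTop (𝓝 1) := by
  have h := Stirling.factorial_isEquivalent_stirling
  have h2 := (Asymptotics.isEquivalent_iff_tendsto_one (by
    filter_upwards [eventually_gt_atTop 0] with n hn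
    have : (0 : ℝ) < n := by exact_mod_cast hn
    positivity)).1 h
  have h3 := h2.inv₀ one_ne_zero
  rw [inv_one] at h3
  refine h3.congr' ?_
  filter_upwards with n
  simp only [Pi.div_apply, inv_div]
  rw [div_pow, ← Real.exp_nat_mul, mul_one, Real.exp_neg, show 2 * (n : ℝ) * Real.pi = 2 * Real.pi * n by ring]
  ring

/-- The precise form of `γ_n` enters here: its `log log` term supplies `log n`, and its constant
supplies the `√(2π)` that cancels Stirling's. -/
theorem exp_neg_half_gammaSeq {n : ℕ} (hn : 0 < n) (hl : 0 < Real.log n) :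
    Real.exp (-(gammaSeq n / 2)) * Real.sqrt n = Real.log n * Real.sqrt (2 * Real.pi) := by
  have h5 : (0 : ℝ) < n := by exact_mod_cast hn
  have h1 : Real.sqrt n = Real.exp (Real.log n / 2) := by rw [Real.exp_half, Real.exp_log h5]
  have h2 : Real.sqrt (2 * Real.pi) = Real.exp (Real.log (2 * Real.pi) / 2) := by
    rw [Real.exp_half, Real.exp_log (by positivity)]
  rw [h1, h2, ← Real.exp_add]
  nth_rewrite 2 [← Real.exp_log hl]
  rw [← Real.exp_add]
  congr 1
  rw [gammaSeq]
  ring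

/-- By Stirling and `tendsto_rate` the mass is equivalent to `e^(-r) e^(-γ_n/2) / √(2πn) = e^(-r)
log n / n`. The tail factor is equivalent to `1 / gapSeq n`, so the whole is `e^(-r) log n / (n ·
gapSeq n ^ 2) = e^(-r) log n / γ_n` up to a factor tending to one. -/
theorem tendsto_poissonMass : Tendsto (fun n : ℕ => (gapSeq n)⁻¹ *
    (poissonMass n (n * scaledRadius n r ^ 2) * (n / (n * scaledRadius n r ^ 2 - n)))) atTop
    (𝓝 (Real.exp (-r))) := by
  have h1 := tendsto_gammaSeq_div_log.inv₀ one_ne_zero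
  have h2 := (Real.continuous_exp.tendsto _).comp (tendsto_rate r).neg
  have h3 := (tendsto_scaledRadius_sq_sub r).inv₀ one_ne_zero
  have h := ((h1.mul h2).mul h3).mul tendsto_stirling
  simp only [inv_one, one_mul, mul_one] at h
  refine h.congr' ?_
  filter_upwards [eventually_good, eventually_one_lt_scaledRadius r] with n hn hx
  have h3 := gapSeq_pos hn.1 hn.2.1
  have h4 := gapSeq_sq hn.1 hn.2.1
  have h5 : (0 : ℝ) < n := by exact_mod_cast hn.1
  have h6 : 0 < scaledRadius n r ^ 2 - 1 := by nlinarith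
  have h7 := exp_neg_half_gammaSeq hn.1 hn.2.2
  have hl := hn.2.2
  set x := scaledRadius n r
  have hx0 : 0 < x := by linarith
  have hpow : x ^ (2 * n) = Real.exp (n * (2 * Real.log x)) := by
    rw [← mul_assoc, mul_comm (n : ℝ) 2, ← Nat.cast_ofNat (R := ℝ), ← Nat.cast_mul, Real.exp_nat_mul,
      Real.exp_log hx0]
  have hmass : poissonMass n (n * x ^ 2) = Real.exp (-(n * (x ^ 2 - 1 - 2 * Real.log x))) *
      (n ^ n * Real.exp (-n) / n.factorial) := by
    rw [poissonMass, mul_pow, ← pow_mul, hpow]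
    have : Real.exp (-(n * (x ^ 2 - 1 - 2 * Real.log x))) * Real.exp (-n) =
      Real.exp (-(n * x ^ 2)) * Real.exp (n * (2 * Real.log x)) := by
      rw [← Real.exp_add, ← Real.exp_add]; congr 1; ring
    linear_combination -(n ^ n / n.factorial : ℝ) * this
  have hexp : Real.exp (-(n * (x ^ 2 - 1 - 2 * Real.log x) - gammaSeq n / 2)) *
      Real.exp (-(gammaSeq n / 2)) = Real.exp (-(n * (x ^ 2 - 1 - 2 * Real.log x))) := by
    rw [← Real.exp_add]; congr 1; ring
  have hsq : Real.sqrt (2 * Real.pi * n) = Real.sqrt (2 * Real.pi) * Real.sqrt n :=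
    Real.sqrt_mul (by positivity) _
  have hnn : Real.sqrt n * Real.sqrt n = n := Real.mul_self_sqrt h5.le
  have hpi : 0 < Real.sqrt (2 * Real.pi) := Real.sqrt_pos.2 (by positivity)
  rw [hmass, ← hexp, hsq, Function.comp_apply, show (n : ℝ) * x ^ 2 - n = n * (x ^ 2 - 1) by ring,
    inv_div, inv_div]
  set A := Real.exp (-(n * (x ^ 2 - 1 - 2 * Real.log x) - gammaSeq n / 2))
  set S := (n : ℝ) ^ n * Real.exp (-n) / n.factorial
  have h8 : Real.log n * Real.sqrt (2 * Real.pi) * Real.sqrt n =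
      Real.exp (-(gammaSeq n / 2)) * n := by rw [← h7, mul_assoc, hnn]
  have h9 : Real.log n / gammaSeq n * A * (gapSeq n / (x ^ 2 - 1)) *
      (Real.sqrt (2 * Real.pi) * Real.sqrt n * S) = A * S / (x ^ 2 - 1) * (gapSeq n / gammaSeq n) *
      (Real.log n * Real.sqrt (2 * Real.pi) * Real.sqrt n) := by ring
  rw [h9, h8, ← h4]
  field_simp

theorem tendsto_poissonCdf : Tendsto (fun n : ℕ => (gapSeq n)⁻¹ *
    poissonCdf n (n * scaledRadius n r ^ 2)) atTop (𝓝 (Real.exp (-r))) := by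
  have hup := tendsto_poissonMass r
  have hq : Tendsto (fun n : ℕ => (n : ℝ) / (n * scaledRadius n r ^ 2 - n) ^ 2 *
      scaledRadius n r ^ 2 + 1) atTop (𝓝 1) := by
    simpa using ((tendsto_div_sq r).mul ((tendsto_scaledRadius r).pow 2)).add_const 1
  have hlow := hup.mul (hq.inv₀ one_ne_zero)
  rw [inv_one, mul_one] at hlow
  refine tendsto_of_tendsto_of_tendsto_of_le_of_le' hlow hup ?_ ?_
  · filter_upwards [eventually_good, eventually_one_lt_scaledRadius r] with n hn hx
    have h3 := gapSeq_pos hn.1 hn.2.1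
    have h5 : (0 : ℝ) < n := by exact_mod_cast hn.1
    have h6 : 0 < scaledRadius n r ^ 2 - 1 := by nlinarith
    have h7 : (0 : ℝ) < n * scaledRadius n r ^ 2 - n := by nlinarith
    have h8 := le_poissonCdf (n := n) (s := n * scaledRadius n r ^ 2) (by linarith)
    rw [mul_assoc]
    refine mul_le_mul_of_nonneg_left (le_of_eq_of_le ?_ h8) (by positivity)
    rw [mul_assoc]
    congr 1
    field_simp
    ring
  · filter_upwards [eventually_good, eventually_one_lt_scaledRadius r] with n hn hx
    have h3 := gapSeq_pos hn.1 hn.2.1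
    have h5 : (0 : ℝ) < n := by exact_mod_cast hn.1
    have h6 : 0 < scaledRadius n r ^ 2 - 1 := by nlinarith
    have h7 : (0 : ℝ) < n * scaledRadius n r ^ 2 - n := by nlinarith
    exact mul_le_mul_of_nonneg_left (poissonCdf_le (by linarith)) (by positivity)

end Limits

/-! ### The rescaled radial intensity and its limit -/

/-- The rescaled position of a point at distance `ρ` from the origin, when the eigenvalues are
multiplied by `√n`. -/
noncomputable def unscale (n : ℕ) (ρ : ℝ) : ℝ :=
  Real.sqrt (4 * n * gammaSeq n) * (ρ / Real.sqrt n - 1 - Real.sqrt (gammaSeq n / (4 * n)))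

theorem measurable_unscale (n : ℕ) : Measurable (unscale n) := by unfold unscale; fun_prop

theorem unscale_scaledRadius {n : ℕ} (hn : 0 < n) (hg : 0 < gammaSeq n) (r : ℝ) :
    unscale n (Real.sqrt n * scaledRadius n r) = r := by
  have h5 : (0 : ℝ) < n := by exact_mod_cast hn
  have h6 : 0 < Real.sqrt n := Real.sqrt_pos.2 h5
  have h7 : 0 < Real.sqrt (4 * n * gammaSeq n) := Real.sqrt_pos.2 (by positivity)
  rw [unscale, scaledRadius]
  field_simp
  ring

theorem scaledRadius_unscale {n : ℕ} (hn : 0 < n) (hg : 0 < gammaSeq n) (ρ : ℝ) :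
    Real.sqrt n * scaledRadius n (unscale n ρ) = ρ := by
  have h5 : (0 : ℝ) < n := by exact_mod_cast hn
  have h6 : 0 < Real.sqrt n := Real.sqrt_pos.2 h5
  have h7 : 0 < Real.sqrt (4 * n * gammaSeq n) := Real.sqrt_pos.2 (by positivity)
  rw [unscale, scaledRadius]
  field_simp
  ring

theorem scaledRadius_sub {n : ℕ} (hn : 0 < n) (hg : 0 < gammaSeq n) (r r₀ : ℝ) :
    scaledRadius n r - scaledRadius n r₀ = gapSeq n / (2 * gammaSeq n) * (r - r₀) := by
  rw [scaledRadius_eq hn hg, scaledRadius_eq hn hg]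
  field_simp
  ring

theorem scaledRadius_mono {n : ℕ} (hn : 0 < n) (hg : 0 < gammaSeq n) {r r₀ : ℝ} (h : r₀ ≤ r) :
    scaledRadius n r₀ ≤ scaledRadius n r := by
  have h1 := gapSeq_pos hn hg
  have h2 := scaledRadius_sub hn hg r r₀
  have h3 : 0 ≤ gapSeq n / (2 * gammaSeq n) * (r - r₀) :=
    mul_nonneg (by positivity) (sub_nonneg.2 h)
  linarith

/-- The intensity of the rescaled radial positions. -/
noncomputable def radialDensity (n : ℕ) (r : ℝ) : ℝ :=
  (gapSeq n)⁻¹ * poissonCdf n (n * scaledRadius n r ^ 2) * scaledRadius n r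

theorem continuous_radialDensity (n : ℕ) : Continuous (radialDensity n) := by
  have h : Continuous (scaledRadius n) := by unfold scaledRadius; fun_prop
  unfold radialDensity
  exact (continuous_const.mul ((continuous_poissonCdf n).comp
    (continuous_const.mul (h.pow 2)))).mul h

theorem tendsto_radialDensity (r : ℝ) :
    Tendsto (fun n => radialDensity n r) atTop (𝓝 (Real.exp (-r))) := by
  simpa [radialDensity] using (tendsto_poissonCdf r).mul (tendsto_scaledRadius r)

/-- A majorant for dominated convergence. In the variable `r` the rate of `poissonCdf_le_exp` is
asymptotically at least one, and `1 / 2` is kept; half of that is spent on the growing factor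
`scaledRadius n r ≤ 4 exp ((r - r₀) / 4)`. -/
theorem eventually_radialDensity_le (r₀ : ℝ) : ∀ᶠ n : ℕ in atTop, ∀ r, r₀ ≤ r →
    ‖radialDensity n r‖ ≤ (Real.exp (-r₀) + 1) * 4 * Real.exp (-((r - r₀) / 4)) := by
  have hrate : Tendsto (fun n : ℕ => (scaledRadius n r₀ ^ 2 - 1) / gapSeq n /
      scaledRadius n r₀ ^ 2) atTop (𝓝 1) := by
    have h := (tendsto_scaledRadius_sq_sub r₀).div ((tendsto_scaledRadius r₀).pow 2)
      (by norm_num)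
    rwa [one_pow, div_one] at h
  have hslope : Tendsto (fun n => gapSeq n * (gammaSeq n)⁻¹) atTop (𝓝 0) := by
    simpa using tendsto_gapSeq.mul tendsto_gammaSeq.inv_tendsto_atTop
  filter_upwards [eventually_good, eventually_one_lt_scaledRadius r₀,
    hrate.eventually_const_lt (show (1 / 2 : ℝ) < 1 by norm_num),
    hslope.eventually_lt_const (show (0 : ℝ) < 1 by norm_num),
    (tendsto_scaledRadius r₀).eventually_lt_const (show (1 : ℝ) < 2 by norm_num),
    (tendsto_poissonCdf r₀).eventually_lt_const (lt_add_one _)] with n hn hx hr hs hx2 hC r hle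
  have h3 := gapSeq_pos hn.1 hn.2.1
  have h4 := gapSeq_sq hn.1 hn.2.1
  have h5 : (0 : ℝ) < n := by exact_mod_cast hn.1
  have hg := hn.2.1
  have hsub := scaledRadius_sub hn.1 hn.2.1 r r₀
  have hmono := scaledRadius_mono hn.1 hn.2.1 hle
  set x₀ := scaledRadius n r₀
  set x := scaledRadius n r
  have ht : 0 ≤ r - r₀ := sub_nonneg.2 hle
  have hQ := poissonCdf_le_exp n (s := n * x₀ ^ 2) (s' := n * x ^ 2) (by positivity) (by gcongr)
  have hexp : (r - r₀) / 2 ≤ (n * x₀ ^ 2 - n) / (n * x₀ ^ 2) * (n * x ^ 2 - n * x₀ ^ 2) := by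
    have e1 : (n * x₀ ^ 2 - n) / (n * x₀ ^ 2) = (x₀ ^ 2 - 1) / gapSeq n / x₀ ^ 2 * gapSeq n := by
      field_simp
    have e2 : (r - r₀) / gapSeq n ≤ n * x ^ 2 - n * x₀ ^ 2 := by
      have e3 : n * x ^ 2 - n * x₀ ^ 2 = n * (x + x₀) * (gapSeq n / (2 * gammaSeq n) * (r - r₀)) := by
        rw [← hsub]; ring
      have e4 : (r - r₀) / gapSeq n = n * 2 * (gapSeq n / (2 * gammaSeq n) * (r - r₀)) := by
        rw [← h4]; field_simp
      rw [e3, e4]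
      gcongr
      linarith
    calc (r - r₀) / 2 = 1 / 2 * gapSeq n * ((r - r₀) / gapSeq n) := by field_simp
      _ ≤ _ := by
        rw [e1]
        gcongr
  have hx4 : x ≤ 4 * Real.exp ((r - r₀) / 4) := by
    have e1 := Real.add_one_le_exp ((r - r₀) / 4)
    have e2 : gapSeq n / (2 * gammaSeq n) * (r - r₀) ≤ 1 * (r - r₀) := by
      gcongr
      rw [← div_eq_mul_inv] at hs
      rw [mul_comm, ← div_div]
      linarith [div_pos h3 hg]
    linarith
  have hQ0 : 0 ≤ poissonCdf n (n * x ^ 2) := poissonCdf_nonneg _ (by positivity)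
  have hx0 : 0 < x := by linarith
  rw [radialDensity, Real.norm_of_nonneg (by positivity)]
  calc (gapSeq n)⁻¹ * poissonCdf n (n * x ^ 2) * x
      ≤ (gapSeq n)⁻¹ * (poissonCdf n (n * x₀ ^ 2) * Real.exp (-((r - r₀) / 2))) *
        (4 * Real.exp ((r - r₀) / 4)) := by
        have h0 : 0 ≤ poissonCdf n (n * x₀ ^ 2) := poissonCdf_nonneg _ (by positivity)
        gcongr
        refine hQ.trans ?_
        gcongr
    _ = (gapSeq n)⁻¹ * poissonCdf n (n * x₀ ^ 2) * 4 *
        (Real.exp (-((r - r₀) / 2)) * Real.exp ((r - r₀) / 4)) := by ring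
    _ ≤ _ := by
        rw [← Real.exp_add, show -((r - r₀) / 2) + (r - r₀) / 4 = -((r - r₀) / 4) by ring]
        gcongr

/-- The substitution `ρ = √n · scaledRadius n r` is affine in `r`. The restriction `ρ > 0` costs
nothing, as `φ` vanishes below `r₀` and the radius at `r₀` is already positive. -/
theorem integral_radial {n : ℕ} (hn : 0 < n) (hg : 0 < gammaSeq n) {φ : ℝ → ℝ} {r₀ : ℝ}
    (hx : 0 < scaledRadius n r₀) (hφ : ∀ r < r₀, φ r = 0) :
    ∫ ρ in Set.Ioi (0 : ℝ), 2 * ρ * poissonCdf n (ρ ^ 2) * φ (unscale n ρ) =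
      ∫ r, radialDensity n r * φ r := by
  have h5 : (0 : ℝ) < n := by exact_mod_cast hn
  have h6 : 0 < Real.sqrt n := Real.sqrt_pos.2 h5
  have h3 := gapSeq_pos hn hg
  have h4 := gapSeq_sq hn hg
  set Ψ : ℝ → ℝ := (Set.Ioi (0 : ℝ)).indicator fun ρ =>
    2 * ρ * poissonCdf n (ρ ^ 2) * φ (unscale n ρ)
  set a : ℝ := Real.sqrt n * (1 + gapSeq n / 2)
  set b : ℝ := Real.sqrt n * (gapSeq n / (2 * gammaSeq n))
  have hb : 0 < b := by positivity
  have hlin : ∀ r, a + b * r = Real.sqrt n * scaledRadius n r := by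
    intro r
    rw [scaledRadius_eq hn hg]
    simp only [a, b]
    field_simp
    ring
  have hsub : ∫ r, Ψ (a + b * r) = b⁻¹ * ∫ ρ, Ψ ρ := by
    rw [Measure.integral_comp_mul_left (fun r => Ψ (a + r)) b, integral_add_left_eq_self Ψ a,
      abs_of_pos (inv_pos.2 hb), smul_eq_mul]
  have hI : ∫ ρ, Ψ ρ = b * ∫ r, Ψ (a + b * r) := by
    rw [hsub, mul_inv_cancel_left₀ hb.ne']
  rw [← integral_indicator measurableSet_Ioi]
  refine hI.trans ?_
  rw [← integral_const_mul]
  refine integral_congr_ae (ae_of_all _ fun r => ?_)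
  simp only [hlin, Ψ]
  have hsq : Real.sqrt n ^ 2 = n := Real.sq_sqrt h5.le
  by_cases hr : r < r₀
  · rw [hφ r hr, mul_zero]
    by_cases h0 : 0 < Real.sqrt n * scaledRadius n r
    · rw [Set.indicator_of_mem (by exact h0), unscale_scaledRadius hn hg, hφ r hr]
      ring
    · rw [Set.indicator_of_notMem (by exact h0), mul_zero]
  · have h7 : 0 < scaledRadius n r := hx.trans_le (scaledRadius_mono hn hg (not_lt.1 hr))
    have h8 : 0 < Real.sqrt n * scaledRadius n r := by positivity
    rw [Set.indicator_of_mem (by exact h8), unscale_scaledRadius hn hg, radialDensity, mul_pow, hsq]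
    have h9 : b * (2 * (Real.sqrt n * scaledRadius n r)) = (gapSeq n)⁻¹ * scaledRadius n r := by
      rw [show b * (2 * (Real.sqrt n * scaledRadius n r)) = Real.sqrt n ^ 2 * (gapSeq n / gammaSeq n)
        * scaledRadius n r by simp only [b]; field_simp, hsq, ← h4]
      field_simp
    linear_combination (poissonCdf n (n * scaledRadius n r ^ 2) * φ r) * h9

theorem tendsto_integral_radial {φ : ℝ → ℝ} (hφm : Measurable φ) (hφ1 : ∀ r, |φ r| ≤ 1) {r₀ : ℝ}
    (hφ : ∀ r < r₀, φ r = 0) :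
    Tendsto (fun n : ℕ => ∫ ρ in Set.Ioi (0 : ℝ), 2 * ρ * poissonCdf n (ρ ^ 2) * φ (unscale n ρ))
      atTop (𝓝 (∫ r, Real.exp (-r) * φ r)) := by
  have hlim : Tendsto (fun n : ℕ => ∫ r, radialDensity n r * φ r) atTop
      (𝓝 (∫ r, Real.exp (-r) * φ r)) := by
    refine tendsto_integral_filter_of_dominated_convergence ((Set.Ici r₀).indicator fun r =>
      (Real.exp (-r₀) + 1) * 4 * Real.exp (-((r - r₀) / 4))) ?_ ?_ ?_ ?_
    · exact Eventually.of_forall fun n =>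
        ((continuous_radialDensity n).measurable.mul hφm).aestronglyMeasurable
    · filter_upwards [eventually_radialDensity_le r₀] with n hn
      refine ae_of_all _ fun r => ?_
      by_cases hr : r₀ ≤ r
      · rw [Set.indicator_of_mem (by exact hr), norm_mul]
        calc _ ≤ ‖radialDensity n r‖ * 1 := by gcongr; exact hφ1 r
          _ ≤ _ := by rw [mul_one]; exact hn r hr
      · rw [Set.indicator_of_notMem (by exact hr), hφ r (not_le.1 hr), mul_zero, norm_zero]
    · rw [integrable_indicator_iff measurableSet_Ici, integrableOn_Ici_iff_integrableOn_Ioi]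
      have h := (exp_neg_integrableOn_Ioi r₀ (show (0 : ℝ) < 1 / 4 by norm_num)).const_mul
        ((Real.exp (-r₀) + 1) * 4 * Real.exp (r₀ / 4))
      refine h.congr (ae_of_all _ fun r => ?_)
      simp only
      rw [mul_assoc, ← Real.exp_add]
      congr 2
      ring
    · exact ae_of_all _ fun r => (tendsto_radialDensity r).mul_const _
  refine hlim.congr' ?_
  filter_upwards [eventually_good, eventually_one_lt_scaledRadius r₀] with n hn hx
  exact (integral_radial hn.1 hn.2.1 (one_pos.trans hx) hφ).symm

/-! ### Traces in polar coordinates -/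

/-- The average of a function of polar coordinates over the angle. -/
noncomputable def angAvg (H : ℝ → ℝ → ℝ) (r : ℝ) : ℝ :=
  (2 * Real.pi)⁻¹ * ∫ θ in Set.Ioo (-Real.pi) Real.pi, H r θ

/-- The one-point intensity `∑ ‖fockFun j z‖²` is `π⁻¹` times a truncated exponential series in
`‖z‖²` with its factor `exp (-‖z‖²)`, that is, a Poisson probability. -/
theorem sum_integral_fockFun {n : ℕ} {h : ℂ → ℝ} (hm : Measurable h) (h0 : ∀ z, 0 ≤ h z)
    (h1 : ∀ z, h z ≤ 1) : ∑ j : Fin n, ∫ z, h z * ‖fockFun j z‖ ^ 2 =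
      ∫ z, h z * (Real.pi⁻¹ * poissonCdf n (‖z‖ ^ 2)) := by
  have hI : ∀ j : Fin n, Integrable fun z => h z * ‖fockFun j z‖ ^ 2 := fun j =>
    (integrable_fockFun_sq j).bdd_mul (c := 1) hm.aestronglyMeasurable (ae_of_all _ fun z => by
      rw [Real.norm_of_nonneg (h0 z)]; exact h1 z)
  refine (integral_finsetSum Finset.univ fun j _ => hI j).symm.trans ?_
  refine integral_congr_ae (ae_of_all _ fun z => ?_)
  simp only
  have h2 : Real.pi⁻¹ * poissonCdf n (‖z‖ ^ 2) = ∑ j : Fin n, ‖fockFun j z‖ ^ 2 := by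
    simp only [norm_fockFun_sq]
    rw [poissonCdf, ← Fin.sum_univ_eq_sum_range (fun j => (‖z‖ ^ 2) ^ j / (j.factorial : ℝ)) n,
      Finset.mul_sum, Finset.mul_sum]
    refine Finset.sum_congr rfl fun j _ => ?_
    have := Real.pi_pos.ne'
    field_simp
  rw [h2, Finset.mul_sum]

theorem integrableOn_mul_poissonCdf (n : ℕ) :
    IntegrableOn (fun ρ : ℝ => ρ * poissonCdf n (ρ ^ 2)) (Set.Ioi 0) := by
  have h : ∀ j : ℕ, Integrable fun ρ : ℝ => ρ ^ (2 * j + 1) * Real.exp (-ρ ^ 2) := by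
    intro j
    have := integrable_rpow_mul_exp_neg_mul_sq (b := 1) one_pos (s := ((2 * j + 1 : ℕ) : ℝ))
      (by have : (0 : ℝ) ≤ ((2 * j + 1 : ℕ) : ℝ) := Nat.cast_nonneg _
          linarith)
    simpa only [Real.rpow_natCast, neg_mul, one_mul] using this
  refine Integrable.integrableOn ?_
  have h2 : (fun ρ : ℝ => ρ * poissonCdf n (ρ ^ 2)) = fun ρ => ∑ j ∈ Finset.range n,
      ρ ^ (2 * j + 1) * Real.exp (-ρ ^ 2) / j.factorial := by
    funext ρ
    rw [poissonCdf, Finset.mul_sum, Finset.mul_sum]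
    refine Finset.sum_congr rfl fun j _ => ?_
    ring
  rw [h2]
  exact integrable_finsetSum _ fun j _ => (h j).div_const _

theorem integral_polar {n : ℕ} {H : ℝ → ℝ → ℝ} (hH : Measurable (Function.uncurry H))
    (h0 : ∀ r θ, 0 ≤ H r θ) (h1 : ∀ r θ, H r θ ≤ 1) :
    ∫ z : ℂ, H (unscale n ‖z‖) z.arg * (Real.pi⁻¹ * poissonCdf n (‖z‖ ^ 2)) =
      ∫ ρ in Set.Ioi (0 : ℝ), 2 * ρ * poissonCdf n (ρ ^ 2) * angAvg H (unscale n ρ) := by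
  rw [← Complex.integral_comp_polarCoord_symm]
  have e1 : ∫ p in polarCoord.target, p.1 • (H (unscale n ‖Complex.polarCoord.symm p‖)
      (Complex.polarCoord.symm p).arg *
        (Real.pi⁻¹ * poissonCdf n (‖Complex.polarCoord.symm p‖ ^ 2))) =
      ∫ p in Set.Ioi (0 : ℝ) ×ˢ Set.Ioo (-Real.pi) Real.pi,
        H (unscale n p.1) p.2 * (p.1 * poissonCdf n (p.1 ^ 2)) * Real.pi⁻¹ := by
    refine setIntegral_congr_fun polarCoord.open_target.measurableSet fun p hp => ?_
    have e2 : (‖Complex.polarCoord.symm p‖, (Complex.polarCoord.symm p).arg) = p := by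
      rw [← Complex.polarCoord_apply]
      exact Complex.polarCoord.right_inv hp
    rw [show ‖Complex.polarCoord.symm p‖ = p.1 from congrArg Prod.fst e2,
      show (Complex.polarCoord.symm p).arg = p.2 from congrArg Prod.snd e2, smul_eq_mul]
    ring
  have hint : IntegrableOn (fun p : ℝ × ℝ => H (unscale n p.1) p.2 *
      (p.1 * poissonCdf n (p.1 ^ 2)) * Real.pi⁻¹)
      (Set.Ioi (0 : ℝ) ×ˢ Set.Ioo (-Real.pi) Real.pi) := by
    rw [IntegrableOn, Measure.volume_eq_prod, ← Measure.prod_restrict]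
    refine Integrable.mul_const ?_ _
    refine Integrable.bdd_mul (c := 1) ((integrableOn_mul_poissonCdf n).comp_fst _) ?_ ?_
    · exact (hH.comp (((measurable_unscale n).comp measurable_fst).prodMk
        measurable_snd)).aestronglyMeasurable
    · refine ae_of_all _ fun p => ?_
      rw [Real.norm_of_nonneg (h0 _ _)]
      exact h1 _ _
  rw [e1, Measure.volume_eq_prod, setIntegral_prod _ hint]
  refine setIntegral_congr_fun measurableSet_Ioi fun ρ _ => ?_
  simp only
  rw [integral_mul_const, integral_mul_const, angAvg]
  have := Real.pi_pos.ne'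
  field_simp

theorem measurable_angAvg {H : ℝ → ℝ → ℝ} (hH : Measurable (Function.uncurry H)) :
    Measurable (angAvg H) := by
  unfold angAvg
  exact (hH.stronglyMeasurable.integral_prod_right.measurable).const_mul _

theorem abs_angAvg_le {H : ℝ → ℝ → ℝ} (h0 : ∀ r θ, 0 ≤ H r θ) (h1 : ∀ r θ, H r θ ≤ 1) (r : ℝ) :
    |angAvg H r| ≤ 1 := by
  have h := norm_setIntegral_le_of_norm_le_const (μ := volume) (s := Set.Ioo (-Real.pi) Real.pi)
    (f := H r) (C := 1) (by simp) fun θ _ => by rw [Real.norm_of_nonneg (h0 _ _)]; exact h1 _ _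
  rw [Real.volume_real_Ioo_of_le (by linarith [Real.pi_pos])] at h
  rw [angAvg, abs_mul, abs_of_pos (by positivity)]
  rw [Real.norm_eq_abs] at h
  have hp := Real.pi_pos
  rw [inv_mul_le_iff₀ (by positivity)]
  linarith

/-- Convergence of the Fredholm determinants of functions of the rescaled polar coordinates. -/
theorem tendsto_det_polar {H : ℝ → ℝ → ℝ} (hH : Measurable (Function.uncurry H))
    (h0 : ∀ r θ, 0 ≤ H r θ) (h1 : ∀ r θ, H r θ ≤ 1) {r₀ : ℝ} (hr : ∀ r < r₀, ∀ θ, H r θ = 0) :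
    Tendsto (fun n : ℕ => (1 - fockMat n fun z => H (unscale n ‖z‖) z.arg).det.re) atTop
      (𝓝 (Real.exp (-∫ r, Real.exp (-r) * angAvg H r))) := by
  have hm : ∀ n : ℕ, Measurable fun z : ℂ => H (unscale n ‖z‖) z.arg := fun n =>
    hH.comp (((measurable_unscale n).comp measurable_norm).prodMk Complex.measurable_arg)
  -- The threshold is the squared modulus, after multiplication by `√n`, of points at the rescaled
  -- position `r₀` below which `H` vanishes.
  refine tendsto_det_one_sub (T := fun n => n * scaledRadius n r₀ ^ 2) hm
    (fun n z => h0 _ _) (fun n z => h1 _ _) ?_ ?_ (tendsto_div_sq r₀) ?_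
  · filter_upwards [eventually_good, eventually_one_lt_scaledRadius r₀] with n hn hx
    have h5 : (0 : ℝ) < n := by exact_mod_cast hn.1
    have : 1 < scaledRadius n r₀ ^ 2 := by nlinarith
    nlinarith
  · filter_upwards [eventually_good, eventually_one_lt_scaledRadius r₀] with n hn hx z
    by_cases hz : unscale n ‖z‖ < r₀
    · rw [hr _ hz]
      exact outside_nonneg _ _
    · have h2 := scaledRadius_mono hn.1 hn.2.1 (not_lt.1 hz)
      have h3 : Real.sqrt n * scaledRadius n r₀ ≤ ‖z‖ := by
        rw [← scaledRadius_unscale hn.1 hn.2.1 ‖z‖]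
        gcongr
      have h4 : (n : ℝ) * scaledRadius n r₀ ^ 2 ≤ ‖z‖ ^ 2 := by
        have : (Real.sqrt n * scaledRadius n r₀) ^ 2 ≤ ‖z‖ ^ 2 := by gcongr
        rwa [mul_pow, Real.sq_sqrt n.cast_nonneg] at this
      rw [outside, if_pos h4]
      exact h1 _ _
  · simp only [sum_integral_fockFun (hm _) (fun z => h0 _ _) fun z => h1 _ _]
    simp only [integral_polar hH h0 h1]
    refine tendsto_integral_radial (measurable_angAvg hH) (abs_angAvg_le h0 h1) (r₀ := r₀) ?_
    intro r hr'
    simp [angAvg, hr r hr']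

/-! ### The eigenvalue of largest modulus -/

open scoped Classical in
/-- The indicator that all elements of maximal modulus lie in `B`. -/
noncomputable def topInd (B : Set ℂ) (s : Multiset ℂ) : ENNReal :=
  if ∀ a ∈ s, (∀ b ∈ s, ‖b‖ ≤ ‖a‖) → a ∈ B then 1 else 0

theorem topInd_le_one (B : Set ℂ) (s : Multiset ℂ) : topInd B s ≤ 1 := by
  unfold topInd; split_ifs <;> simp

theorem mem_tupleMultiset {n : ℕ} {z : Fin n → ℂ} {a : ℂ} :
    a ∈ tupleMultiset z ↔ ∃ i, z i = a := by
  simp [tupleMultiset]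

theorem topInd_tupleMultiset {n : ℕ} (B : Set ℂ) (z : Fin n → ℂ) [Decidable (∀ i, (∀ j,
    ‖z j‖ ≤ ‖z i‖) → z i ∈ B)] : topInd B (tupleMultiset z) =
      if ∀ i, (∀ j, ‖z j‖ ≤ ‖z i‖) → z i ∈ B then 1 else 0 := by
  unfold topInd
  congr 1
  simp [mem_tupleMultiset]

theorem measurable_topInd {α : Type*} [MeasurableSpace α] {n : ℕ} {B : α → Set ℂ}
    (hB : MeasurableSet {p : α × ℂ | p.2 ∈ B p.1}) :
    Measurable fun p : α × (Fin n → ℂ) => topInd (B p.1) (tupleMultiset p.2) := by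
  classical
  simp only [topInd_tupleMultiset]
  refine Measurable.ite ?_ measurable_const measurable_const
  have h : {p : α × (Fin n → ℂ) | ∀ i, (∀ j, ‖p.2 j‖ ≤ ‖p.2 i‖) → p.2 i ∈ B p.1} =
      ⋂ i, ((⋂ j, {p : α × (Fin n → ℂ) | ‖p.2 j‖ ≤ ‖p.2 i‖})ᶜ ∪
        {p : α × (Fin n → ℂ) | p.2 i ∈ B p.1}) := by
    ext p
    simp only [Set.mem_ofPred_eq, Set.mem_iInter, Set.mem_union, Set.mem_compl_iff]
    exact forall_congr' fun i => imp_iff_not_or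
  rw [h]
  refine MeasurableSet.iInter fun i => MeasurableSet.union (MeasurableSet.compl
    (MeasurableSet.iInter fun j => measurableSet_le (by fun_prop) (by fun_prop))) ?_
  have hm : Measurable fun p : α × (Fin n → ℂ) => (p.1, p.2 i) := by fun_prop
  exact hm hB

theorem measurable_topInd_tuple {n : ℕ} {B : Set ℂ} (hB : MeasurableSet B) :
    Measurable fun z : Fin n → ℂ => topInd B (tupleMultiset z) := by
  have h : MeasurableSet {p : Unit × ℂ | p.2 ∈ B} := measurable_snd hB
  have hm : Measurable fun z : Fin n → ℂ => (Unit.unit, z) := by fun_prop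
  exact (measurable_topInd (B := fun _ : Unit => B) h).comp hm

theorem topInd_of_topAt {n : ℕ} {z : Fin n → ℂ} {k : Fin n} (hz : z ∈ topAt k) (B : Set ℂ) :
    topInd B (tupleMultiset z) = B.indicator 1 (z k) := by
  classical
  have hmax : ∀ j, ‖z j‖ ≤ ‖z k‖ := fun j => by
    by_cases h : j = k
    · rw [h]
    · exact (hz j h).le
  have h : (∀ i, (∀ j, ‖z j‖ ≤ ‖z i‖) → z i ∈ B) ↔ z k ∈ B := by
    refine ⟨fun h => h k hmax, fun h i hi => ?_⟩
    by_cases hik : i = k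
    · rwa [hik]
    · exact absurd (hi k) (not_le.2 (hz i hik))
  rw [topInd_tupleMultiset, Set.indicator_apply, Pi.one_apply]
  simp only [h]

/-- Off the null set of tuples without a strict maximum, exactly one of the two indicators equals
one. -/
theorem coulomb_topInd_add_compl {m : ℕ} {B : Set ℂ} (hB : MeasurableSet B) :
    coulomb (m + 1) (topInd B) + coulomb (m + 1) (topInd Bᶜ) =
      ENNReal.ofReal (coulombMass (m + 1)) := by
  have hm : Measurable fun z : Fin (m + 1) → ℂ =>
      topInd B (tupleMultiset z) * ENNReal.ofReal (vdmWeight z) :=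
    (measurable_topInd_tuple hB).mul measurable_vdmWeight.ennreal_ofReal
  rw [← coulomb_one, coulomb, coulomb, coulomb, ← lintegral_add_left hm]
  refine lintegral_congr_ae ?_
  filter_upwards [ae_exists_topAt] with z ⟨k, hk⟩
  rw [topInd_of_topAt hk, topInd_of_topAt hk, ← add_mul]
  congr 1
  by_cases h : z k ∈ B <;> simp [h]

/-- The law of the eigenvalue of largest modulus of a Ginibre matrix. -/
theorem measure_top_mem {Ω : Type*} [MeasurableSpace Ω] {P : Measure Ω} [IsProbabilityMeasure P]
    {n : ℕ} (hn : 0 < n) {X : Ω → Matrix (Fin n) (Fin n) ℂ} (hX : IsComplexGinibre P X)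
    {σ : Ω → ℕ → ℂ} (hσ : ∀ ω, IsOrderedSpectrum (X ω) (σ ω)) {B : Set ℂ} (hB : MeasurableSet B) :
    P {ω | σ ω 1 * (Real.sqrt n : ℂ) ∈ B} =
      ENNReal.ofReal (coulombMass n)⁻¹ * coulomb n (topInd B) := by
  set S : Ω → Multiset ℂ := fun ω => (Finset.Icc 1 n).val.map fun j => σ ω j * (Real.sqrt n : ℂ)
  have hS : ∀ ω, ∀ C : Set ℂ, topInd C (S ω) = 1 → σ ω 1 * (Real.sqrt n : ℂ) ∈ C := by
    intro ω C h
    rw [topInd] at h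
    split_ifs at h with h2
    · have h1 : 1 ∈ Finset.Icc 1 n := Finset.mem_Icc.2 ⟨le_rfl, hn⟩
      refine h2 _ (Multiset.mem_map.2 ⟨1, h1, rfl⟩) fun b hb => ?_
      obtain ⟨j, hj, rfl⟩ := Multiset.mem_map.1 hb
      have hj' : 1 ≤ j ∧ j ≤ n := Finset.mem_Icc.1 hj
      rw [norm_mul, norm_mul]
      gcongr
      exact (hσ ω).norm_anti 1 j le_rfl hj'.1 hj'.2
    · exact absurd h zero_ne_one
  have hL : ∀ C : Set ℂ, MeasurableSet C → NullMeasurableSet {ω | topInd C (S ω) = 1} P ∧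
      P {ω | topInd C (S ω) = 1} = ENNReal.ofReal (coulombMass n)⁻¹ * coulomb n (topInd C) := by
    intro C hC
    obtain ⟨h1, h2⟩ := lintegral_ginibre hn hX hσ (measurable_topInd_tuple hC) (topInd_le_one C)
    have h3 : NullMeasurableSet {ω | topInd C (S ω) = 1} P :=
      h1.nullMeasurable (measurableSet_singleton 1)
    refine ⟨h3, ?_⟩
    rw [← h2, ← lintegral_indicator_one₀ h3]
    refine lintegral_congr fun ω => ?_
    by_cases h : topInd C (S ω) = 1
    · rw [Set.indicator_of_mem (by exact h), Pi.one_apply]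
      exact h.symm
    · rw [Set.indicator_of_notMem (by exact h)]
      change 0 = topInd C (S ω)
      unfold topInd at h ⊢
      split_ifs at h ⊢ with h3
      · exact absurd rfl h
      · rfl
  obtain ⟨hm, hLB⟩ := hL B hB
  obtain ⟨hm', hLB'⟩ := hL Bᶜ hB.compl
  have hsum : ENNReal.ofReal (coulombMass n)⁻¹ * coulomb n (topInd B) +
      ENNReal.ofReal (coulombMass n)⁻¹ * coulomb n (topInd Bᶜ) = 1 := by
    obtain ⟨m, rfl⟩ := Nat.exists_eq_succ_of_ne_zero hn.ne'
    rw [← mul_add, coulomb_topInd_add_compl hB, ← ENNReal.ofReal_mul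
      (inv_nonneg.2 (coulombMass_pos _).le), inv_mul_cancel₀ (coulombMass_pos _).ne',
      ENNReal.ofReal_one]
  -- The labelling is not assumed measurable, so the event is sandwiched between the one defined by
  -- `topInd B` and the complement of the one defined by `topInd Bᶜ`. These two have the same
  -- probability by `hsum`.
  refine le_antisymm ?_ ?_
  · calc P {ω | σ ω 1 * (Real.sqrt n : ℂ) ∈ B} ≤ P {ω | topInd Bᶜ (S ω) = 1}ᶜ :=
          measure_mono fun ω h h2 => hS ω _ h2 h
      _ = 1 - P {ω | topInd Bᶜ (S ω) = 1} := prob_compl_eq_one_sub₀ hm'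
      _ = _ := by
          rw [hLB', ← hsum]
          refine ENNReal.add_sub_cancel_right ?_
          rw [← hLB']
          exact measure_ne_top _ _
  · rw [← hLB]
    exact measure_mono fun ω h => hS ω _ h

/-- For a centred disc, a condition on the maximal points is a condition on all points, hence a
multiplicative statistic to which the determinant formula applies. -/
theorem topInd_disc (ρ : ℝ) {n : ℕ} (z : Fin n → ℂ) : topInd {w | ‖w‖ ≤ ρ} (tupleMultiset z) =
    ENNReal.ofReal ((tupleMultiset z).map ({w | ‖w‖ ≤ ρ}.indicator 1 : ℂ → ℝ)).prod := by
  classical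
  rw [prod_tupleMultiset_map, topInd_tupleMultiset]
  by_cases h : ∀ i, ‖z i‖ ≤ ρ
  · have h2 : ∀ i, ({w | ‖w‖ ≤ ρ}.indicator 1 : ℂ → ℝ) (z i) = 1 := fun i =>
      Set.indicator_of_mem (show z i ∈ {w : ℂ | ‖w‖ ≤ ρ} from h i) _
    rw [if_pos (show ∀ i, (∀ j, ‖z j‖ ≤ ‖z i‖) → z i ∈ {w : ℂ | ‖w‖ ≤ ρ} from fun i _ => h i)]
    simp only [h2, Finset.prod_const_one, ENNReal.ofReal_one]
  · push Not at h
    obtain ⟨i, hi⟩ := h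
    have h2 : ({w | ‖w‖ ≤ ρ}.indicator 1 : ℂ → ℝ) (z i) = 0 :=
      Set.indicator_of_notMem (show z i ∉ {w : ℂ | ‖w‖ ≤ ρ} from not_le.2 hi) _
    rw [Finset.prod_eq_zero (Finset.mem_univ i) h2, ENNReal.ofReal_zero, if_neg]
    intro h
    have : Nonempty (Fin n) := ⟨i⟩
    obtain ⟨k, hk⟩ := Finite.exists_max fun i => ‖z i‖
    exact absurd ((hk i).trans (h k hk)) (not_le.2 hi)

theorem vdmWeight_smul {n : ℕ} {c : ℂ} (hc : ‖c‖ = 1) (z : Fin n → ℂ) :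
    vdmWeight (fun i => c * z i) = vdmWeight z := by
  simp only [vdmWeight, Matrix.det_vandermonde, ← mul_sub, norm_prod, norm_mul, hc, one_mul]

theorem coulomb_rotate {n : ℕ} {c : ℂ} (hc : ‖c‖ = 1) {F : Multiset ℂ → ENNReal}
    (hF : Measurable fun z : Fin n → ℂ => F (tupleMultiset z)) :
    coulomb n (fun s => F (s.map fun w => c * w)) = coulomb n F := by
  have h1 : MeasurePreserving (fun w : ℂ => c * w) :=
    (rotation ⟨c, mem_sphere_zero_iff_norm.2 hc⟩).measurePreserving
  have h2 := volume_preserving_pi fun _ : Fin n => h1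
  have hm : Measurable fun z : Fin n → ℂ => F (tupleMultiset z) * ENNReal.ofReal (vdmWeight z) :=
    hF.mul measurable_vdmWeight.ennreal_ofReal
  rw [coulomb, coulomb, ← h2.lintegral_comp hm]
  refine lintegral_congr fun z => ?_
  rw [vdmWeight_smul hc]
  congr 2
  rw [tupleMultiset, tupleMultiset, Multiset.map_map]
  rfl

theorem argTwoPi_nonneg (z : ℂ) : 0 ≤ argTwoPi z := by
  unfold argTwoPi
  split_ifs with h
  · exact h
  · linarith [Complex.neg_pi_lt_arg z, Real.pi_pos]

theorem measurable_argTwoPi : Measurable argTwoPi :=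
  Measurable.ite (measurableSet_le measurable_const Complex.measurable_arg) Complex.measurable_arg
    (Complex.measurable_arg.add_const _)

theorem argTwoPi_mul_real {x : ℝ} (hx : 0 < x) (z : ℂ) : argTwoPi (z * x) = argTwoPi z := by
  rw [argTwoPi, argTwoPi, Complex.arg_mul_real hx]

theorem argTwoPi_exp {β : ℝ} (h0 : 0 ≤ β) (h1 : β < 2 * Real.pi) :
    argTwoPi (Complex.exp (β * Complex.I)) = β := by
  by_cases h : β ≤ Real.pi
  · have : (Complex.exp (β * Complex.I)).arg = β := by
      rw [Complex.arg_exp_mul_I, toIocMod_eq_self]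
      exact ⟨by linarith [Real.pi_pos], by linarith⟩
    rw [argTwoPi, this, if_pos h0]
  · have : (Complex.exp (β * Complex.I)).arg = β - 2 * Real.pi := by
      rw [Complex.arg_exp_mul_I, ← toIocMod_sub, toIocMod_eq_self]
      exact ⟨by linarith, by linarith⟩
    rw [argTwoPi, this, if_neg (by linarith)]
    ring

/-- A rotation by a uniform angle makes the argument uniform. -/
theorem lintegral_argTwoPi_le {w : ℂ} (hw : w ≠ 0) {θ : ℝ} (h0 : 0 ≤ θ) (h1 : θ < 2 * Real.pi) :
    ∫⁻ α in Set.Ioc 0 (2 * Real.pi), {v : ℂ | argTwoPi v ≤ θ}.indicator (1 : ℂ → ENNReal)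
      (Complex.exp (α * Complex.I) * w) = ENNReal.ofReal θ := by
  have hpi := Real.pi_pos
  set A : Set ℝ := {β | argTwoPi (Complex.exp (β * Complex.I)) ≤ θ}
  have hA : MeasurableSet A :=
    measurableSet_le (measurable_argTwoPi.comp (by fun_prop)) measurable_const
  let k : ℝ → ℝ := A.indicator 1
  have hk : Function.Periodic k (2 * Real.pi) := by
    intro β
    have : Complex.exp (((β + 2 * Real.pi : ℝ) : ℂ) * Complex.I) = Complex.exp (β * Complex.I) := by
      rw [← Complex.exp_periodic (β * Complex.I)]
      congr 1
      push_cast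
      ring
    simp only [k, Set.indicator_apply, A, Set.mem_ofPred_eq, this, Pi.one_apply]
  have hkm : Measurable k := measurable_one.indicator hA
  have hw' : w = ‖w‖ * Complex.exp (w.arg * Complex.I) := (Complex.norm_mul_exp_arg_mul_I w).symm
  have hrot : ∀ α : ℝ, {v : ℂ | argTwoPi v ≤ θ}.indicator (1 : ℂ → ENNReal)
      (Complex.exp (α * Complex.I) * w) = ENNReal.ofReal (k (α + w.arg)) := by
    intro α
    have : Complex.exp (α * Complex.I) * w =
        Complex.exp (((α + w.arg : ℝ) : ℂ) * Complex.I) * (‖w‖ : ℝ) := by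
      conv_lhs => rw [hw']
      push_cast
      rw [add_mul, Complex.exp_add]
      ring
    have h2 := argTwoPi_mul_real (norm_pos_iff.2 hw) (Complex.exp (((α + w.arg : ℝ) : ℂ) * Complex.I))
    simp only [this, k, Set.indicator_apply, A, Set.mem_ofPred_eq, Pi.one_apply, h2]
    split_ifs <;> simp
  simp only [hrot]
  have hint : ∀ s : Set ℝ, volume s ≠ ⊤ → IntegrableOn (fun α => k (α + w.arg)) s := by
    intro s hs
    refine Measure.integrableOn_of_bounded (M := 1) hs
      (hkm.comp (measurable_add_const _)).aestronglyMeasurable (ae_of_all _ fun α => ?_)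
    simp only [k, Set.indicator_apply]
    split_ifs <;> simp
  rw [← ofReal_integral_eq_lintegral_ofReal (hint _ measure_Ioc_lt_top.ne) (ae_of_all _ fun α =>
    Set.indicator_nonneg (fun _ _ => zero_le_one) _)]
  congr 1
  -- Shifting by `w.arg` moves the interval of integration, which spans a full period and can be
  -- brought back to start at zero.
  rw [← intervalIntegral.integral_of_le (by positivity),
    intervalIntegral.integral_comp_add_right (fun β => k β), zero_add, add_comm (2 * Real.pi),
    hk.intervalIntegral_add_eq w.arg 0, zero_add, intervalIntegral.integral_of_le (by positivity),
    integral_Ioc_eq_integral_Ioo, ← integral_Ico_eq_integral_Ioo, integral_indicator_one hA,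
    measureReal_restrict_apply hA]
  have hI : A ∩ Set.Ico 0 (2 * Real.pi) = Set.Icc 0 θ := by
    ext β
    constructor
    · rintro ⟨hβ, hβ0, hβ1⟩
      refine ⟨hβ0, ?_⟩
      rwa [Set.mem_ofPred_eq, argTwoPi_exp hβ0 hβ1] at hβ
    · rintro ⟨hβ0, hβ1⟩
      have h2 := hβ1.trans_lt h1
      refine ⟨?_, hβ0, h2⟩
      rwa [Set.mem_ofPred_eq, argTwoPi_exp hβ0 h2]
  rw [hI, Real.volume_real_Icc_of_le h0, sub_zero]

/-- The argument of the largest eigenvalue is uniform and independent of the modulus. -/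
theorem coulomb_topInd_sector {n : ℕ} (hn : 2 ≤ n) (ρ : ℝ) {θ : ℝ} (h0 : 0 ≤ θ)
    (h1 : θ < 2 * Real.pi) :
    ENNReal.ofReal (2 * Real.pi) * coulomb n (topInd {w | ‖w‖ ≤ ρ ∧ argTwoPi w ≤ θ}) =
      ENNReal.ofReal θ * coulomb n (topInd {w | ‖w‖ ≤ ρ}) := by
  obtain ⟨m, rfl⟩ := Nat.exists_eq_add_of_le' hn
  set B : Set ℂ := {w | ‖w‖ ≤ ρ ∧ argTwoPi w ≤ θ}
  have hB : MeasurableSet B := (measurableSet_le measurable_norm measurable_const).inter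
    (measurableSet_le measurable_argTwoPi measurable_const)
  let R : ℝ → Set ℂ := fun α => {w | Complex.exp (α * Complex.I) * w ∈ B}
  have hR : MeasurableSet {p : ℝ × ℂ | p.2 ∈ R p.1} := by
    have hm : Measurable fun p : ℝ × ℂ => Complex.exp (p.1 * Complex.I) * p.2 := by fun_prop
    exact hm hB
  have hrot : ∀ α : ℝ, coulomb (m + 2) (topInd (R α)) = coulomb (m + 2) (topInd B) := by
    intro α
    have hc := Complex.norm_exp_ofReal_mul_I α
    rw [← coulomb_rotate hc (measurable_topInd_tuple hB)]
    refine lintegral_congr fun z => ?_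
    congr 1
    have h2 : ((tupleMultiset z).map fun w => Complex.exp (α * Complex.I) * w) =
        tupleMultiset fun i => Complex.exp (α * Complex.I) * z i := by
      rw [tupleMultiset, tupleMultiset, Multiset.map_map]
      rfl
    classical
    simp only
    rw [h2, topInd_tupleMultiset, topInd_tupleMultiset]
    simp only [norm_mul, hc, one_mul]
    rfl
  have hm := measurable_topInd (n := m + 2) hR
  have hmz : Measurable fun p : ℝ × (Fin (m + 2) → ℂ) =>
      topInd (R p.1) (tupleMultiset p.2) * ENNReal.ofReal (vdmWeight p.2) :=
    hm.mul (measurable_vdmWeight.comp measurable_snd).ennreal_ofReal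
  -- By invariance, `coulomb` may be averaged over all rotations of `B`. After exchanging the
  -- integrals, the rotation average of the sector condition is `θ`, whatever the position of the
  -- dominant point.
  calc ENNReal.ofReal (2 * Real.pi) * coulomb (m + 2) (topInd B)
      = ∫⁻ α in Set.Ioc 0 (2 * Real.pi), coulomb (m + 2) (topInd (R α)) := by
        simp only [hrot]
        rw [setLIntegral_const, Real.volume_Ioc, sub_zero, mul_comm]
    _ = ∫⁻ z : Fin (m + 2) → ℂ, ∫⁻ α in Set.Ioc 0 (2 * Real.pi),
        topInd (R α) (tupleMultiset z) * ENNReal.ofReal (vdmWeight z) := by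
        simp only [coulomb]
        exact lintegral_lintegral_swap hmz.aemeasurable
    _ = ∫⁻ z : Fin (m + 2) → ℂ, ENNReal.ofReal θ *
        (topInd {w | ‖w‖ ≤ ρ} (tupleMultiset z) * ENNReal.ofReal (vdmWeight z)) := by
        refine lintegral_congr_ae ?_
        filter_upwards [ae_exists_topAt] with z ⟨k, hk⟩
        rw [lintegral_mul_const' _ _ ENNReal.ofReal_ne_top, ← mul_assoc]
        congr 1
        -- A second point, of strictly smaller modulus, forces the dominant one to be nonzero, so
        -- that its argument is meaningful; this needs size at least two.
        obtain ⟨j, hj⟩ := exists_ne k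
        have hzk : z k ≠ 0 := norm_pos_iff.1 ((norm_nonneg _).trans_lt (hk j hj))
        simp only [topInd_of_topAt hk]
        rw [← lintegral_argTwoPi_le hzk h0 h1, ← lintegral_mul_const' _ _ (by
          rw [Set.indicator_apply]; split_ifs <;> simp)]
        refine lintegral_congr fun α => ?_
        simp only [R, B, Set.indicator_apply, Set.mem_ofPred_eq, norm_mul,
          Complex.norm_exp_ofReal_mul_I, one_mul, Pi.one_apply]
        by_cases h2 : ‖z k‖ ≤ ρ <;> simp [h2]
    _ = _ := by
        rw [lintegral_const_mul' _ _ ENNReal.ofReal_ne_top, coulomb]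

/-! ### The Laplace functional and the Gumbel limit -/

theorem multiset_prod_map_mem {f : ℂ → ℝ} (h0 : ∀ z, 0 ≤ f z) (h1 : ∀ z, f z ≤ 1)
    (s : Multiset ℂ) : 0 ≤ (s.map f).prod ∧ (s.map f).prod ≤ 1 := by
  induction s using Multiset.induction_on with
  | empty => simp
  | cons a s ih =>
    rw [Multiset.map_cons, Multiset.prod_cons]
    exact ⟨mul_nonneg (h0 a) ih.1, mul_le_one₀ (h1 a) ih.1 ih.2⟩

theorem mass_inv_mul_coulomb_prod (n : ℕ) {f : ℂ → ℝ} (hf : Measurable f) (h0 : ∀ z, 0 ≤ f z)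
    (h1 : ∀ z, f z ≤ 1) : ENNReal.ofReal (coulombMass n)⁻¹ *
      coulomb n (fun s => ENNReal.ofReal (s.map f).prod) = ENNReal.ofReal (fockMat n f).det.re := by
  have h := coulombMass_pos n
  rw [coulomb_prod n hf h0 h1, ← ENNReal.ofReal_mul (inv_nonneg.2 h.le), inv_mul_cancel_left₀ h.ne']

/-- Multiplicative statistics of the eigenvalues of a Ginibre matrix are determinants. -/
theorem integral_prod_eigenvalues {Ω : Type*} [MeasurableSpace Ω] {P : Measure Ω}
    [IsProbabilityMeasure P] {n : ℕ} (hn : 0 < n) {X : Ω → Matrix (Fin n) (Fin n) ℂ}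
    (hX : IsComplexGinibre P X) {σ : Ω → ℕ → ℂ} (hσ : ∀ ω, IsOrderedSpectrum (X ω) (σ ω))
    {f : ℂ → ℝ} (hf : Measurable f) (h0 : ∀ z, 0 ≤ f z) (h1 : ∀ z, f z ≤ 1) :
    ∫ ω, ∏ j ∈ Finset.Icc 1 n, f (σ ω j * (Real.sqrt n : ℂ)) ∂P = max (fockMat n f).det.re 0 := by
  have hF : Measurable fun z : Fin n → ℂ => ENNReal.ofReal ((tupleMultiset z).map f).prod := by
    simp only [prod_tupleMultiset_map]
    exact (Finset.measurable_prod _ fun i _ => hf.comp (measurable_pi_apply i)).ennreal_ofReal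
  obtain ⟨hm, he⟩ := lintegral_ginibre (F := fun s => ENNReal.ofReal (s.map f).prod) hn hX hσ hF
    fun s => ENNReal.ofReal_le_one.2 (multiset_prod_map_mem h0 h1 s).2
  rw [mass_inv_mul_coulomb_prod n hf h0 h1] at he
  have h2 := integral_toReal hm (ae_of_all _ fun ω => ENNReal.ofReal_lt_top)
  -- The maximum with zero comes from truncation in `ENNReal.ofReal`; it is harmless, since the
  -- limits of these determinants are positive.
  rw [he, ENNReal.toReal_ofReal'] at h2
  rw [← h2]
  refine integral_congr_ae (ae_of_all _ fun ω => ?_)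
  simp only
  rw [ENNReal.toReal_ofReal (multiset_prod_map_mem h0 h1 _).1, Multiset.map_map]
  rfl

theorem rescaledModulus_eq {n : ℕ} (hn : 0 < n) (w : ℂ) :
    rescaledModulus n w = unscale n ‖w * (Real.sqrt n : ℂ)‖ := by
  have h6 : 0 < Real.sqrt n := Real.sqrt_pos.2 (by exact_mod_cast hn)
  rw [unscale, norm_mul, Complex.norm_real, Real.norm_of_nonneg h6.le,
    mul_div_cancel_right₀ _ h6.ne', rescaledModulus]

theorem tendsto_integral_prod {Ω : ℕ → Type*} [∀ n, MeasurableSpace (Ω n)]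
    {P : ∀ n, Measure (Ω n)} [∀ n, IsProbabilityMeasure (P n)]
    {X : ∀ n, Ω n → Matrix (Fin n) (Fin n) ℂ} (hX : ∀ n, IsComplexGinibre (P n) (X n))
    {σ : ∀ n, Ω n → ℕ → ℂ} (hσ : ∀ n ω, IsOrderedSpectrum (X n ω) (σ n ω))
    {H : ℝ → ℝ → ℝ} (hH : Measurable (Function.uncurry H))
    (h0 : ∀ r θ, 0 ≤ H r θ) (h1 : ∀ r θ, H r θ ≤ 1) {r₀ : ℝ} (hr : ∀ r < r₀, ∀ θ, H r θ = 0) :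
    Tendsto (fun n => ∫ ω, ∏ j ∈ Finset.Icc 1 n,
      (1 - H (rescaledModulus n (σ n ω j)) (σ n ω j).arg) ∂(P n)) atTop
      (𝓝 (Real.exp (-∫ r, Real.exp (-r) * angAvg H r))) := by
  have h := (tendsto_det_polar hH h0 h1 hr).max (tendsto_const_nhds (x := (0 : ℝ)))
  rw [max_eq_left (Real.exp_pos _).le] at h
  refine h.congr' ?_
  filter_upwards [eventually_gt_atTop 0] with n hn
  have hm : Measurable fun z : ℂ => H (unscale n ‖z‖) z.arg :=
    hH.comp (((measurable_unscale n).comp measurable_norm).prodMk Complex.measurable_arg)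
  have h6 : 0 < Real.sqrt n := Real.sqrt_pos.2 (by exact_mod_cast hn)
  rw [← fockMat_one_sub n hm (fun z => h0 _ _) fun z => h1 _ _, ← integral_prod_eigenvalues hn
    (hX n) (hσ n) (f := fun z => 1 - H (unscale n ‖z‖) z.arg) (hm.const_sub 1)
    (fun z => sub_nonneg.2 (h1 _ _)) fun z => by linarith [h0 (unscale n ‖z‖) z.arg]]
  simp only [Complex.arg_mul_real h6, rescaledModulus_eq hn]

theorem polarPoint_periodic (r : ℝ) : Function.Periodic (polarPoint r) (2 * Real.pi) := by
  intro θ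
  rw [polarPoint, polarPoint, ← Complex.exp_periodic (θ * Complex.I)]
  congr 2
  push_cast
  ring

theorem polarPoint_argTwoPi (r : ℝ) (z : ℂ) : polarPoint r (argTwoPi z) = polarPoint r z.arg := by
  rw [argTwoPi]
  split_ifs
  · rfl
  · exact polarPoint_periodic r _

theorem continuous_polarPoint : Continuous fun p : ℝ × ℝ => polarPoint p.1 p.2 := by
  unfold polarPoint; fun_prop

theorem norm_polarPoint (r θ : ℝ) : ‖polarPoint r θ‖ = |r| := by
  rw [polarPoint, norm_mul, Complex.norm_exp_ofReal_mul_I, mul_one, Complex.norm_real,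
    Real.norm_eq_abs]

/-- Fubini's theorem for angularly periodic functions supported on a compact range of radii. -/
theorem integral_angAvg {H : ℝ → ℝ → ℝ} (hH : Measurable (Function.uncurry H))
    (h0 : ∀ r θ, 0 ≤ H r θ) (h1 : ∀ r θ, H r θ ≤ 1) (hper : ∀ r, Function.Periodic (H r)
      (2 * Real.pi)) {R : ℝ} (hR : ∀ r θ, R < |r| → H r θ = 0) :
    ∫ r, Real.exp (-r) * angAvg H r =
      ∫ θ in (0 : ℝ)..(2 * Real.pi), ∫ r : ℝ, H r θ * (Real.exp (-r) / (2 * Real.pi)) := by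
  have hpi := Real.pi_pos
  set K : ℝ → ℝ := fun θ => ∫ r : ℝ, H r θ * (Real.exp (-r) / (2 * Real.pi))
  have hK : Function.Periodic K (2 * Real.pi) := fun θ => by
    simp only [K, fun r => hper r θ]
  have hint : Integrable (Function.uncurry fun θ r => H r θ * (Real.exp (-r) / (2 * Real.pi)))
      ((volume.restrict (Set.Ioo (-Real.pi) Real.pi)).prod volume) := by
    have hb : Integrable fun r : ℝ => (Set.Icc (-R) R).indicator
        (fun r => Real.exp (-r) / (2 * Real.pi)) r := by
      rw [integrable_indicator_iff measurableSet_Icc]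
      exact ContinuousOn.integrableOn_Icc (by fun_prop)
    refine (hb.comp_snd (volume.restrict (Set.Ioo (-Real.pi) Real.pi))).mono' ?_
      (ae_of_all _ fun p => ?_)
    · refine Measurable.aestronglyMeasurable ?_
      exact (hH.comp measurable_swap).mul (by fun_prop)
    · simp only [Function.uncurry]
      by_cases hp : R < |p.2|
      · rw [hR _ _ hp, zero_mul, norm_zero]
        exact Set.indicator_nonneg (fun _ _ => by positivity) _
      · rw [Set.indicator_of_mem (by exact abs_le.1 (not_lt.1 hp)), norm_mul,
          Real.norm_of_nonneg (h0 _ _), Real.norm_of_nonneg (by positivity)]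
        exact mul_le_of_le_one_left (by positivity) (h1 _ _)
  -- Periodicity reconciles the angles in `[0, 2π]` with the range `(-π, π)` used by `angAvg`.
  have h2 := hK.intervalIntegral_add_eq 0 (-Real.pi)
  rw [zero_add, show -Real.pi + 2 * Real.pi = Real.pi by ring,
    intervalIntegral.integral_of_le (a := -Real.pi) (by linarith), integral_Ioc_eq_integral_Ioo] at h2
  rw [h2, integral_integral_swap hint]
  refine integral_congr_ae (ae_of_all _ fun r => ?_)
  simp only
  rw [integral_mul_const, angAvg]
  field_simp

/-- Take `1 - H = exp (-g)` at the polar point. Compact support makes `H` vanish for `|r|` large, in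
particular below some level `-R`, and the choice of branch of the argument is immaterial because
`polarPoint` is periodic in the angle. -/
theorem tendsto_laplace {Ω : ℕ → Type*} [∀ n, MeasurableSpace (Ω n)]
    {P : ∀ n, Measure (Ω n)} [∀ n, IsProbabilityMeasure (P n)]
    {X : ∀ n, Ω n → Matrix (Fin n) (Fin n) ℂ} (hX : ∀ n, IsComplexGinibre (P n) (X n))
    {σ : ∀ n, Ω n → ℕ → ℂ} (hσ : ∀ n ω, IsOrderedSpectrum (X n ω) (σ n ω))
    {g : ℂ → ℝ} (hg : Continuous g) (hc : HasCompactSupport g) (h0 : ∀ z, 0 ≤ g z) :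
    Tendsto (fun n : ℕ => ∫ ω, Real.exp (-∑ j ∈ Finset.Icc 1 n,
      g (polarPoint (rescaledModulus n (σ n ω j)) (argTwoPi (σ n ω j)))) ∂(P n)) atTop
      (𝓝 (Real.exp (-∫ θ in (0 : ℝ)..(2 * Real.pi), ∫ r : ℝ,
        (1 - Real.exp (-g (polarPoint r θ))) * (Real.exp (-r) / (2 * Real.pi))))) := by
  set H : ℝ → ℝ → ℝ := fun r θ => 1 - Real.exp (-g (polarPoint r θ))
  have hH : Measurable (Function.uncurry H) := by
    have : Continuous (Function.uncurry H) :=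
      continuous_const.sub (Real.continuous_exp.comp (hg.comp continuous_polarPoint).neg)
    exact this.measurable
  have hH0 : ∀ r θ, 0 ≤ H r θ := fun r θ =>
    sub_nonneg.2 (Real.exp_le_one_iff.2 (neg_nonpos.2 (h0 _)))
  have hH1 : ∀ r θ, H r θ ≤ 1 := fun r θ => sub_le_self _ (Real.exp_pos _).le
  obtain ⟨R, hR⟩ := hc.isCompact.isBounded.exists_norm_le
  have hHR : ∀ r θ, R < |r| → H r θ = 0 := by
    intro r θ hr
    have : g (polarPoint r θ) = 0 := by
      by_contra h
      have h2 := hR _ (subset_tsupport g h)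
      rw [norm_polarPoint] at h2
      linarith
    simp only [H, this, neg_zero, Real.exp_zero, sub_self]
  have hper : ∀ r, Function.Periodic (H r) (2 * Real.pi) := fun r θ => by
    simp only [H, polarPoint_periodic r θ]
  have h := tendsto_integral_prod hX hσ hH hH0 hH1 (r₀ := -R) fun r hr θ =>
    hHR r θ (by linarith [neg_le_abs r])
  rw [integral_angAvg hH hH0 hH1 hper hHR] at h
  refine h.congr fun n => ?_
  refine integral_congr_ae (ae_of_all _ fun ω => ?_)
  simp only [H, sub_sub_cancel, polarPoint_argTwoPi]
  rw [← Finset.sum_neg_distrib, Real.exp_sum]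

theorem integral_exp_neg_mul_angAvg (r : ℝ) :
    ∫ s, Real.exp (-s) * angAvg (fun s _ => (Set.Ioi r).indicator 1 s) s = Real.exp (-r) := by
  have hpi := Real.pi_pos
  rw [← integral_exp_neg_Ioi r, ← integral_indicator measurableSet_Ioi]
  refine integral_congr_ae (ae_of_all _ fun s => ?_)
  simp only [angAvg]
  rw [setIntegral_const, Real.volume_real_Ioo_of_le (by linarith), smul_eq_mul]
  by_cases hs : s ∈ Set.Ioi r
  · rw [Set.indicator_of_mem hs, Set.indicator_of_mem hs, Pi.one_apply]
    field_simp
    ring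
  · rw [Set.indicator_of_notMem hs, Set.indicator_of_notMem hs]
    ring

/-- With `H` the indicator of positions beyond `r`, the determinant is the probability that no
eigenvalue lies there; the limiting intensity has mass `e^(-r)` beyond `r`. -/
theorem tendsto_disc (r : ℝ) : Tendsto (fun n : ℕ => (ENNReal.ofReal (coulombMass n)⁻¹ *
    coulomb n (topInd {w | ‖w‖ ≤ Real.sqrt n * scaledRadius n r})).toReal) atTop
    (𝓝 (Real.exp (-Real.exp (-r)))) := by
  set H : ℝ → ℝ → ℝ := fun s _ => (Set.Ioi r).indicator 1 s
  have hH : Measurable (Function.uncurry H) :=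
    (measurable_one.indicator measurableSet_Ioi).comp measurable_fst
  have hH0 : ∀ s θ, 0 ≤ H s θ := fun s θ => Set.indicator_nonneg (fun _ _ => zero_le_one) _
  have hH1 : ∀ s θ, H s θ ≤ 1 := fun s θ =>
    Set.indicator_le_self' (fun _ _ => zero_le_one) _
  have h := (tendsto_det_polar hH hH0 hH1 (r₀ := r) fun s hs θ =>
    Set.indicator_of_notMem (by simpa using hs.le) _).max (tendsto_const_nhds (x := (0 : ℝ)))
  rw [max_eq_left (Real.exp_pos _).le, integral_exp_neg_mul_angAvg] at h
  refine h.congr' ?_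
  filter_upwards [eventually_good] with n hn
  have hm : Measurable fun z : ℂ => H (unscale n ‖z‖) z.arg :=
    hH.comp (((measurable_unscale n).comp measurable_norm).prodMk Complex.measurable_arg)
  have h6 : 0 < Real.sqrt n := Real.sqrt_pos.2 (by exact_mod_cast hn.1)
  have hf : ({w | ‖w‖ ≤ Real.sqrt n * scaledRadius n r}.indicator 1 : ℂ → ℝ) =
      fun z => 1 - H (unscale n ‖z‖) z.arg := by
    funext z
    have hiff : ‖z‖ ≤ Real.sqrt n * scaledRadius n r ↔ unscale n ‖z‖ ≤ r := by
      constructor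
      · intro h
        by_contra h2
        have h3 := scaledRadius_sub hn.1 hn.2.1 (unscale n ‖z‖) r
        have h4 : 0 < gapSeq n / (2 * gammaSeq n) * (unscale n ‖z‖ - r) :=
          mul_pos (div_pos (gapSeq_pos hn.1 hn.2.1) (by linarith [hn.2.1])) (by linarith)
        have h5 : Real.sqrt n * scaledRadius n r < Real.sqrt n * scaledRadius n (unscale n ‖z‖) := by
          gcongr
          linarith
        rw [scaledRadius_unscale hn.1 hn.2.1] at h5
        linarith
      · intro h
        rw [← scaledRadius_unscale hn.1 hn.2.1 ‖z‖]
        gcongr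
        exact scaledRadius_mono hn.1 hn.2.1 h
    by_cases h : unscale n ‖z‖ ≤ r
    · rw [Set.indicator_of_mem (by exact hiff.2 h)]
      simp [H, h]
    · rw [Set.indicator_of_notMem (by exact fun h2 => h (hiff.1 h2))]
      have h2 : r < unscale n ‖z‖ := not_le.1 h
      simp [H, h2]
  have hcoul : coulomb n (topInd {w | ‖w‖ ≤ Real.sqrt n * scaledRadius n r}) =
      coulomb n fun s => ENNReal.ofReal (s.map fun z => 1 - H (unscale n ‖z‖) z.arg).prod := by
    rw [coulomb, coulomb]
    refine lintegral_congr fun z => ?_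
    rw [topInd_disc, hf]
  have h0 : ∀ z : ℂ, 0 ≤ H (unscale n ‖z‖) z.arg := fun z => hH0 _ z.arg
  have h1 : ∀ z : ℂ, H (unscale n ‖z‖) z.arg ≤ 1 := fun z => hH1 _ z.arg
  rw [hcoul, mass_inv_mul_coulomb_prod n (f := fun z => 1 - H (unscale n ‖z‖) z.arg)
    (hm.const_sub 1) (fun z => sub_nonneg.2 (h1 z)) (fun z => sub_le_self _ (h0 z)),
    ENNReal.toReal_ofReal', fockMat_one_sub n hm h0 h1]

/-- For `n ≥ 2` the probability is exactly `θ / 2π` times the probability of the modulus condition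
alone, by `coulomb_topInd_sector`, so only `tendsto_disc` involves a limit. -/
theorem tendsto_top {Ω : ℕ → Type*} [∀ n, MeasurableSpace (Ω n)]
    {P : ∀ n, Measure (Ω n)} [∀ n, IsProbabilityMeasure (P n)]
    {X : ∀ n, Ω n → Matrix (Fin n) (Fin n) ℂ} (hX : ∀ n, IsComplexGinibre (P n) (X n))
    {σ : ∀ n, Ω n → ℕ → ℂ} (hσ : ∀ n ω, IsOrderedSpectrum (X n ω) (σ n ω))
    (r : ℝ) {θ : ℝ} (h0 : 0 ≤ θ) (h1 : θ < 2 * Real.pi) :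
    Tendsto (fun n : ℕ => (P n).real {ω | ‖σ n ω 1‖ ≤ scaledRadius n r ∧
        0 ≤ argTwoPi (σ n ω 1) ∧ argTwoPi (σ n ω 1) ≤ θ}) atTop
      (𝓝 (θ / (2 * Real.pi) * Real.exp (-Real.exp (-r)))) := by
  have hpi := Real.pi_pos
  refine ((tendsto_disc r).const_mul (θ / (2 * Real.pi))).congr' ?_
  filter_upwards [eventually_ge_atTop 2] with n hn
  have h6 : 0 < Real.sqrt n := Real.sqrt_pos.2 (by exact_mod_cast (by omega : 0 < n))
  set ρ := Real.sqrt n * scaledRadius n r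
  have hB : MeasurableSet {w : ℂ | ‖w‖ ≤ ρ ∧ argTwoPi w ≤ θ} :=
    (measurableSet_le measurable_norm measurable_const).inter
      (measurableSet_le measurable_argTwoPi measurable_const)
  have hset : {ω | ‖σ n ω 1‖ ≤ scaledRadius n r ∧ 0 ≤ argTwoPi (σ n ω 1) ∧
      argTwoPi (σ n ω 1) ≤ θ} =
      {ω | σ n ω 1 * (Real.sqrt n : ℂ) ∈ {w : ℂ | ‖w‖ ≤ ρ ∧ argTwoPi w ≤ θ}} := by
    ext ω
    simp only [Set.mem_ofPred_eq, argTwoPi_mul_real h6, norm_mul, Complex.norm_real,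
      Real.norm_of_nonneg h6.le, argTwoPi_nonneg, true_and, ρ]
    rw [mul_comm, mul_le_mul_iff_right₀ h6]
  have hsec := congrArg ENNReal.toReal (coulomb_topInd_sector hn ρ h0 h1)
  rw [ENNReal.toReal_mul, ENNReal.toReal_mul, ENNReal.toReal_ofReal (by positivity),
    ENNReal.toReal_ofReal h0] at hsec
  rw [hset, measureReal_def, measure_top_mem (by omega) (hX n) (hσ n) hB, ENNReal.toReal_mul,
    ENNReal.toReal_mul]
  generalize (ENNReal.ofReal (coulombMass n)⁻¹).toReal = c
  field_simp
  linear_combination -c * hsec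

theorem corollaryF3 {Ω : ℕ → Type*} [∀ n, MeasurableSpace (Ω n)]
    (P : ∀ n, Measure (Ω n)) [∀ n, IsProbabilityMeasure (P n)]
    (X : ∀ n, Ω n → Matrix (Fin n) (Fin n) ℂ) (hX : ∀ n, IsComplexGinibre (P n) (X n))
    (σ : ∀ n, Ω n → ℕ → ℂ) (hσ : ∀ n ω, IsOrderedSpectrum (X n ω) (σ n ω)) :
    (∀ r θ : ℝ, 0 ≤ θ → θ < 2 * Real.pi →
      Tendsto
        (fun n : ℕ => (P n).real
          {ω | ‖σ n ω 1‖ ≤ scaledRadius n r ∧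
            0 ≤ argTwoPi (σ n ω 1) ∧ argTwoPi (σ n ω 1) ≤ θ})
        atTop (𝓝 (θ / (2 * Real.pi) * Real.exp (-Real.exp (-r))))) ∧
    (∀ (t : ℝ) (g : ℂ → ℝ), ContDiff ℝ 2 g → HasCompactSupport g → (∀ z, 0 ≤ g z) →
      Function.support g ⊆
        {z | ∃ r θ : ℝ, t ≤ r ∧ 0 ≤ θ ∧ θ < 2 * Real.pi ∧ z = polarPoint r θ} →
      Tendsto
        (fun n : ℕ => ∫ ω, Real.exp (-∑ j ∈ Finset.Icc 1 n,
          g (polarPoint (rescaledModulus n (σ n ω j)) (argTwoPi (σ n ω j)))) ∂(P n))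
        atTop
        (𝓝 (Real.exp (-∫ θ in (0 : ℝ)..(2 * Real.pi), ∫ r : ℝ,
          (1 - Real.exp (-g (polarPoint r θ))) * (Real.exp (-r) / (2 * Real.pi)))))) := by
  refine ⟨fun r θ h0 h1 => tendsto_top hX hσ r h0 h1, fun t g hg hc h0 _ => ?_⟩
  exact tendsto_laplace hX hσ hg.continuous hc h0
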